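/- Let $q$ be a nonzero complex number. **Conventions.** For formal series write $a(x)=\sum_{n\in\mathbb Z}a(n)x^{-n-1}$. Let $T$ be the tensor algebra over $sl_2\otimes\mathbb C[t,t^{-1}]$, i.e. the free associative algebra on $a(n)=a\otimes t^n$ with $a\in\{e,f,h\}$, $n\in\mathbb Z$. A *$DY_q(sl_2)$-module* is a $T$-module $W$ such that for every $w\in W$ one has $a(n)w=0$ for all $a\in\{e,f,h\}$ and all sufficiently large $n$, and such that on $W$ $$e(x_1)e(x_2)=\tfrac{q+x_1-x_2}{-q+x_1-x_2}\,e(x_2)e(x_1),\quad f(x_1)f(x_2)=\tfrac{-q+x_1-x_2}{q+x_1-x_2}\,f(x_2)f(x_1),\quad [e(x_1),f(x_2)]=x_1^{-1}\delta\!\left(\tfrac{x_2}{x_1}\right)h(x_2),$$ $$h(x_1)e(x_2)=\tfrac{q+x_1-x_2}{-q+x_1-x_2}\,e(x_2)h(x_1),\quad h(x_1)h(x_2)=h(x_2)h(x_1),\quad h(x_1)f(x_2)=\tfrac{-q+x_1-x_2}{q+x_1-x_2}\,f(x_2)h(x_1),$$ where $(\pm q+x_1-x_2)^{-1}$ is expanded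 in $\mathbb C[[x_1,x_2]]$. It is a *vacuum module* with vacuum vector $w_0$ if $a(n)w_0=0$ for all $a$ and all $n\ge 0$ and $w_0$ generates $W$. For a $T$-module $W$ with a vector $w_0$, let $E_n$ be the span of the vectors $u^{(1)}(m_1)\cdots u^{(r)}(m_r)w_0$ with $0\le r\le n$, $u^{(i)}\in\{e,f,h\}$, $m_i\in\mathbb Z$. The *normal monomials with at most $n$ factors* are the vectors $$e(-m_1)\cdots e(-m_r)f(-n_1)\cdots f(-n_s)h(-k_1)\cdots h(-k_l)w_0$$ with $r,s,l\ge 0$ and positive integers $m_1>\cdots>m_r$, $n_1>\cdots>n_s$, $k_1\ge\cdots\ge k_l$, $r+s+l\le n$. Let $\mathfrak g$ be the Lie superalgebra with odd basis elements $\bar e,\bar f$, even basis element $\bar h$, and only nonzero brackets of basis elements $[\bar e,\bar f]=[\bar f,\bar e]=\bar h$. Let $L(\mathfrak g)=\mathfrak g\otimes\mathbb C[t,t^{-1}]$ and $V=V_{L(\mathfrak g)}=U(L(\mathfrak g))\otimes_{U(\mathfrak g\otimes\mathbb C[t])}\mathbb C$ with vacuum vector $\mathbf 1=1\otimes 1$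 and with its vertex operator map $Y$, for which $Y(\bar u(-1)\mathbf 1,x)=\bar u(x)$ for $\bar u\in\{\bar e,\bar f,\bar h\}$; let $\mathcal D v=v_{-2}\mathbf 1$, where $Y(v,x)=\sum_{n}v_nx^{-n-1}$. Identify $\bar u\in\mathfrak g$ with $\bar u(-1)\mathbf 1\in V$. **Statement.** (1) There is a unique linear map $\Phi(t):V\to V\otimes\mathbb C[t]$ with $\Phi(t)\mathbf 1=\mathbf 1$, $\Phi(t)\bar e=\bar e\otimes t$, $\Phi(t)\bar f=\bar f\otimes t$, $\Phi(t)\bar h=\bar h\otimes t^2$ and $\Phi(t)Y(v,x)=Y(\Phi(t-x)v,x)\Phi(t)$ for all $v\in V$. (2) With this $\Phi$, the assignment $$e(x)=\bar e(x)\Phi(q+x),\qquad f(x)=\bar f(x)\Phi(-q+x),\qquad h(x)=q\,\bar h(x)\Phi(q+x)\Phi(-q+x)$$ defines a unique $T$-module structure on $V$. With it $V$ is a vacuum $DY_q(sl_2)$-module with generating vacuum vector $\mathbf 1$, and $[\mathcal D,u(x)]=\frac{d}{dx}u(x)$ for $u\in\{e,f,h\}$. The subspaces $E_n$ (for $w_0=\mathbf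 1$) form an increasing filtration of $V$ with $\bigcup_nE_n=V$, and for every $n\ge 0$ the normal monomials with at most $n$ factors are a basis of $E_n$ (distinct index sequences giving distinct vectors). (3) Let $T=\coprod_nT_n$ be graded by $\deg a(n)=n$, let $d$ be the derivation of $T$ with $d(a(n))=-n\,a(n-1)$, let $T_+=\sum_{n\ge1}T_n$ and $J=T\,\mathbb C[d]\,T_+$, and let $V_q$ be the quotient of the $T$-module $T/J$ by the submodule generated by all the above defining relations, with $\mathbf 1\in V_q$ the image of $1$. Then $(V_q,\mathbf 1)$ is a vacuum $DY_q(sl_2)$-module, the subspaces $E_n$ (for $w_0=\mathbf 1$) form an increasing filtration of $V_q$ with $\bigcup_nE_n=V_q$, and for every $n\ge0$ the normal monomials with at most $n$ factors are a basis of $E_n$. -/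

import Mathlib

namespace DoubleYangian

open Finset

/-- Labels of the three generators. They name the basis `e, f, h` of `sl₂` as well as
the basis `ē, f̄, h̄` of the Lie superalgebra `𝔤`. -/
inductive Gen where
  | e
  | f
  | h
  deriving DecidableEq

instance : Fintype Gen := ⟨{.e, .f, .h}, fun a => by cases a <;> simp⟩

/-- The tensor algebra `T` over `sl₂ ⊗ ℂ[t, t⁻¹]`, presented as the free associative algebra on
the basis vectors `a(n) = a ⊗ tⁿ` with `a ∈ {e, f, h}` and `n ∈ ℤ`. -/
abbrev Tensor : Type := FreeAlgebra ℂ (Gen × ℤ)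

/-- The element `a(n) = a ⊗ tⁿ` of the tensor algebra. -/
noncomputable def tgen (a : Gen) (n : ℤ) : Tensor := FreeAlgebra.ι ℂ (a, n)

/-! ### The Lie superalgebra `𝔤` and the induced module `V` of its loop algebra -/

/-- Parity in the Lie superalgebra `𝔤`: `ē` and `f̄` are odd, `h̄` is even. -/
def Gen.parity : Gen → ℕ
  | .e => 1
  | .f => 1
  | .h => 0

/-- Structure constants of `𝔤`: the only nonzero superbrackets of basis vectors are
`[ē, f̄] = [f̄, ē] = h̄`. The coefficient of `c` in `[a, b]` is `structConst a b c`. -/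
def structConst : Gen → Gen → Gen → ℂ
  | .e, .f, .h => 1
  | .f, .e, .h => 1
  | _, _, _ => 0

/-- The relations `a(m) b(n) - (-1)^{|a||b|} b(n) a(m) = [a, b](m + n)` of the universal enveloping
algebra of the loop superalgebra `L(𝔤) = 𝔤 ⊗ ℂ[t, t⁻¹]`. -/
inductive LoopRel : FreeAlgebra ℂ (Gen × ℤ) → FreeAlgebra ℂ (Gen × ℤ) → Prop
  | bracket (a b : Gen) (m n : ℤ) :
      LoopRel (FreeAlgebra.ι ℂ (a, m) * FreeAlgebra.ι ℂ (b, n))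
        ((-1 : ℂ) ^ (a.parity * b.parity) • (FreeAlgebra.ι ℂ (b, n) * FreeAlgebra.ι ℂ (a, m))
          + ∑ c : Gen, structConst a b c • FreeAlgebra.ι ℂ (c, m + n))

/-- The universal enveloping algebra `U(L(𝔤))`. -/
def ULoop : Type := RingQuot LoopRel

noncomputable instance : Ring ULoop := inferInstanceAs (Ring (RingQuot LoopRel))

noncomputable instance : Algebra ℂ ULoop := inferInstanceAs (Algebra ℂ (RingQuot LoopRel))

/-- The quotient map from the free algebra to `U(L(𝔤))`. -/
noncomputable def ULoop.mk : FreeAlgebra ℂ (Gen × ℤ) →ₐ[ℂ] ULoop := RingQuot.mkAlgHom ℂ LoopRel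

/-- The element `ā(n) = ā ⊗ tⁿ` of `U(L(𝔤))`. -/
noncomputable def ugen (a : Gen) (n : ℤ) : ULoop :=
  ULoop.mk (FreeAlgebra.ι ℂ (a, n))

/-- The left ideal of `U(L(𝔤))` generated by `𝔤 ⊗ ℂ[t]`. -/
noncomputable def posIdeal : Submodule ULoop ULoop :=
  Submodule.span ULoop {x | ∃ (a : Gen) (n : ℤ), 0 ≤ n ∧ x = ugen a n}

/-- The induced module `V = U(L(𝔤)) ⊗_{U(𝔤 ⊗ ℂ[t])} ℂ` of the trivial module `ℂ`, that is, the
quotient of `U(L(𝔤))` by the left ideal generated by `𝔤 ⊗ ℂ[t]`. -/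
def VL : Type := ULoop ⧸ posIdeal

noncomputable instance : AddCommGroup VL := inferInstanceAs (AddCommGroup (ULoop ⧸ posIdeal))

noncomputable instance : Module ULoop VL := inferInstanceAs (Module ULoop (ULoop ⧸ posIdeal))

noncomputable instance : Module ℂ VL := inferInstanceAs (Module ℂ (ULoop ⧸ posIdeal))

instance : IsScalarTower ℂ ULoop VL := inferInstanceAs (IsScalarTower ℂ ULoop (ULoop ⧸ posIdeal))

/-- The quotient map from `U(L(𝔤))` to `V`. -/
noncomputable def VL.mk : ULoop →ₗ[ULoop] VL := posIdeal.mkQ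

theorem VL.mk_surjective : Function.Surjective VL.mk := posIdeal.mkQ_surjective

/-- The vacuum vector `1 ⊗ 1` of `V`. -/
noncomputable def vac : VL := VL.mk 1

/-- The operator `ā(n)` on `V`; the field `ā(x)` is `∑ₙ ā(n) x^{-n-1}`. -/
noncomputable def loopOp (a : Gen) (n : ℤ) : Module.End ℂ VL := Algebra.lsmul ℂ ℂ VL (ugen a n)

theorem ugen_mul (a b : Gen) (m n : ℤ) :
    ugen a m * ugen b n = (-1 : ℂ) ^ (a.parity * b.parity) • (ugen b n * ugen a m)
      + ∑ c : Gen, structConst a b c • ugen c (m + n) := by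
  have : ULoop.mk _ = ULoop.mk _ := RingQuot.mkAlgHom_rel ℂ (LoopRel.bracket a b m n)
  simpa [ugen, map_mul, map_add, map_smul, map_sum] using this

theorem loopOp_loopOp (a b : Gen) (m n : ℤ) (w : VL) :
    loopOp a m (loopOp b n w) = (-1 : ℂ) ^ (a.parity * b.parity) • loopOp b n (loopOp a m w)
      + ∑ c : Gen, structConst a b c • loopOp c (m + n) w := by
  have := congrArg (fun u : ULoop => u • w) (ugen_mul a b m n)
  simpa [loopOp, mul_smul, add_smul, Finset.sum_smul, smul_assoc] using this

theorem loopOp_vac (a : Gen) (n : ℤ) (hn : 0 ≤ n) : loopOp a n vac = 0 := by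
  have : ugen a n ∈ posIdeal := Submodule.subset_span ⟨a, n, hn, rfl⟩
  change ugen a n • VL.mk 1 = 0
  rw [← map_smul, smul_eq_mul, mul_one]
  exact (Submodule.Quotient.mk_eq_zero _).2 this

theorem uloop_induction {C : ULoop → Prop} (h1 : ∀ r : ℂ, C (algebraMap ℂ ULoop r))
    (hg : ∀ a n, C (ugen a n)) (hm : ∀ x y, C x → C y → C (x * y))
    (ha : ∀ x y, C x → C y → C (x + y)) (x : ULoop) : C x := by
  obtain ⟨y, rfl⟩ : ∃ y, ULoop.mk y = x := RingQuot.mkAlgHom_surjective ℂ LoopRel x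
  induction y using FreeAlgebra.induction with
  | grade0 r => simpa using h1 r
  | grade1 p => exact hg p.1 p.2
  | mul a b iha ihb => simpa using hm _ _ iha ihb
  | add a b iha ihb => simpa using ha _ _ iha ihb

theorem VL_induction {C : VL → Prop} (h0 : C vac) (ha : ∀ v w, C v → C w → C (v + w))
    (hs : ∀ (r : ℂ) v, C v → C (r • v)) (hg : ∀ a n v, C v → C (loopOp a n v)) (v : VL) : C v := by
  obtain ⟨x, rfl⟩ := VL.mk_surjective v
  have key : ∀ x : ULoop, ∀ v, C v → C (x • v) := by
    intro x
    induction x using uloop_induction with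
    | h1 r => intro v hv; simpa [algebraMap_smul] using hs r v hv
    | hg a n => intro v hv; exact hg a n v hv
    | hm x y hx hy => intro v hv; rw [mul_smul]; exact hx _ (hy _ hv)
    | ha x y hx hy => intro v hv; rw [add_smul]; exact ha _ _ (hx _ hv) (hy _ hv)
  have := key x vac h0
  rwa [vac, ← map_smul, smul_eq_mul, mul_one] at this

theorem loopOp_trunc (w : VL) : ∃ N : ℕ, ∀ (a : Gen) (n : ℤ), (N : ℤ) ≤ n → loopOp a n w = 0 := by
  induction w using VL_induction with
  | h0 => exact ⟨0, fun a n hn => loopOp_vac a n (by simpa using hn)⟩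
  | ha v w hv hw =>
    obtain ⟨N, hN⟩ := hv
    obtain ⟨M, hM⟩ := hw
    refine ⟨N + M, fun a n hn => ?_⟩
    rw [map_add, hN a n (by push_cast at hn; omega), hM a n (by push_cast at hn; omega), add_zero]
  | hs r v hv =>
    obtain ⟨N, hN⟩ := hv
    exact ⟨N, fun a n hn => by rw [map_smul, hN a n hn, smul_zero]⟩
  | hg b k v hv =>
    obtain ⟨N, hN⟩ := hv
    refine ⟨N + k.natAbs, fun a n hn => ?_⟩
    push_cast at hn
    have h1 := neg_abs_le k
    have h2 := abs_nonneg k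
    rw [loopOp_loopOp, hN a n (by omega), map_zero, smul_zero, zero_add]
    exact Finset.sum_eq_zero fun c _ => by rw [hN c _ (by omega), smul_zero]

/-- The universal property of `V`: a representation of `U(L(𝔤))` on `M` and a vector of `M` that
is annihilated by `𝔤 ⊗ ℂ[t]` determine a linear map `V → M`. -/
noncomputable def liftVL {M : Type} [AddCommGroup M] [Module ℂ M]
    (φ : ULoop →ₐ[ℂ] Module.End ℂ M) (m₀ : M)
    (hm : ∀ (a : Gen) (n : ℤ), 0 ≤ n → φ (ugen a n) m₀ = 0) : VL →ₗ[ℂ] M :=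
  let f : ULoop →ₛₗ[(φ : ULoop →+* Module.End ℂ M)] M :=
    { toFun := fun x => φ x m₀
      map_add' := fun x y => by simp
      map_smul' := fun x y => by simp }
  let g : VL →ₛₗ[(φ : ULoop →+* Module.End ℂ M)] M :=
    posIdeal.liftQ f (Submodule.span_le.2 (by rintro _ ⟨a, n, hn, rfl⟩; exact hm a n hn))
  { toFun := g
    map_add' := g.map_add
    map_smul' := fun r v => by
      have h := g.map_smulₛₗ (algebraMap ℂ ULoop r) v
      rw [algebraMap_smul] at h
      rw [h]
      simp }

theorem liftVL_vac {M : Type} [AddCommGroup M] [Module ℂ M]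
    (φ : ULoop →ₐ[ℂ] Module.End ℂ M) (m₀ : M)
    (hm : ∀ (a : Gen) (n : ℤ), 0 ≤ n → φ (ugen a n) m₀ = 0) : liftVL φ m₀ hm vac = m₀ := by
  change φ 1 m₀ = m₀
  simp

theorem liftVL_loopOp {M : Type} [AddCommGroup M] [Module ℂ M]
    (φ : ULoop →ₐ[ℂ] Module.End ℂ M) (m₀ : M)
    (hm : ∀ (a : Gen) (n : ℤ), 0 ≤ n → φ (ugen a n) m₀ = 0) (a : Gen) (n : ℤ) (v : VL) :
    liftVL φ m₀ hm (loopOp a n v) = φ (ugen a n) (liftVL φ m₀ hm v) := by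
  obtain ⟨x, rfl⟩ := VL.mk_surjective v
  rw [show loopOp a n (VL.mk x) = VL.mk (ugen a n * x) from rfl]
  change φ (ugen a n * x) m₀ = φ (ugen a n) (φ x m₀)
  simp

/-- A family of operators `a(n)` on `M` that satisfies the relations of `L(𝔤)` extends to a
representation of `U(L(𝔤))`. -/
noncomputable def liftULoop {A : Type} [Ring A] [Algebra ℂ A] (F : Gen → ℤ → A)
    (hF : ∀ a b m n, F a m * F b n = (-1 : ℂ) ^ (a.parity * b.parity) • (F b n * F a m)
      + ∑ c : Gen, structConst a b c • F c (m + n)) : ULoop →ₐ[ℂ] A :=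
  RingQuot.liftAlgHom ℂ ⟨FreeAlgebra.lift ℂ fun p => F p.1 p.2, by
    rintro _ _ ⟨a, b, m, n⟩
    simpa using hF a b m n⟩

theorem liftULoop_ugen {A : Type} [Ring A] [Algebra ℂ A] (F : Gen → ℤ → A)
    (hF : ∀ a b m n, F a m * F b n = (-1 : ℂ) ^ (a.parity * b.parity) • (F b n * F a m)
      + ∑ c : Gen, structConst a b c • F c (m + n)) (a : Gen) (n : ℤ) :
    liftULoop F hF (ugen a n) = F a n := by
  change RingQuot.liftAlgHom ℂ _ (RingQuot.mkAlgHom ℂ LoopRel (FreeAlgebra.ι ℂ (a, n))) = F a n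
  rw [RingQuot.liftAlgHom_mkAlgHom_apply, FreeAlgebra.lift_ι_apply]

/-- The parity operator `(-1)^{|v|}` on `V`. -/
noncomputable def parityOp : Module.End ℂ VL :=
  liftVL (liftULoop (fun a n => (-1 : ℂ) ^ a.parity • loopOp a n) (by
    intro a b m n
    ext w
    have h := loopOp_loopOp a b m n w
    have hc : ∀ c : Gen, (-1 : ℂ) ^ a.parity * (-1 : ℂ) ^ b.parity * structConst a b c
        = structConst a b c * (-1 : ℂ) ^ c.parity := by
      intro c; cases a <;> cases b <;> cases c <;> simp [structConst, Gen.parity]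
    simp only [Module.End.mul_apply, LinearMap.smul_apply, LinearMap.add_apply, map_smul,
      LinearMap.sum_apply, smul_smul, h, smul_add, Finset.smul_sum]
    congr 1
    · congr 1; ring
    · exact Finset.sum_congr rfl fun c _ => by rw [← hc]; congr 1; ring))
    vac (by intro a n hn; simp [liftULoop_ugen, loopOp_vac a n hn])

theorem parityOp_vac : parityOp vac = vac := liftVL_vac _ _ _

theorem parityOp_loopOp (a : Gen) (n : ℤ) (v : VL) :
    parityOp (loopOp a n v) = (-1 : ℂ) ^ a.parity • loopOp a n (parityOp v) := by
  rw [parityOp, liftVL_loopOp, liftULoop_ugen]; rfl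

theorem parityOp_parityOp (v : VL) : parityOp (parityOp v) = v := by
  induction v using VL_induction with
  | h0 => rw [parityOp_vac, parityOp_vac]
  | ha v w hv hw => simp [hv, hw]
  | hs r v hv => simp [hv]
  | hg a n v hv =>
    rw [parityOp_loopOp, map_smul, parityOp_loopOp, hv, smul_smul, ← mul_pow]; simp


/-! ### The vertex operator map of `V` -/

/-- The space `Hom(V, V((x)))` of fields `B(x) = ∑ₘ B(m) x^{-m-1}` on `V`. -/
def FieldSpace : Submodule ℂ (ℤ → Module.End ℂ VL) where
  carrier := {B | ∀ w, ∃ N : ℤ, ∀ m, N ≤ m → B m w = 0}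
  add_mem' := by
    intro A B hA hB w
    obtain ⟨N, hN⟩ := hA w
    obtain ⟨M, hM⟩ := hB w
    refine ⟨max N M, fun m hm => ?_⟩
    simp [hN m (le_of_max_le_left hm), hM m (le_of_max_le_right hm)]
  zero_mem' := fun w => ⟨0, fun m _ => rfl⟩
  smul_mem' := by
    intro r B hB w
    obtain ⟨N, hN⟩ := hB w
    exact ⟨N, fun m hm => by simp [hN m hm]⟩

/-- The coefficient `(-1)ʲ (n choose j)` of `y^{n-j} xʲ` in `(y - x)ⁿ`. -/
noncomputable def binCoeff (n : ℤ) (j : ℕ) : ℂ := (-1) ^ j * ((Ring.choose n j : ℤ) : ℂ)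

theorem binCoeff_add (m n : ℤ) (l : ℕ) :
    ∑ ij ∈ antidiagonal l, binCoeff m ij.1 * binCoeff n ij.2 = binCoeff (m + n) l := by
  simp only [binCoeff]
  rw [Ring.add_choose_eq l (Commute.all m n)]
  push_cast
  rw [Finset.mul_sum]
  refine Finset.sum_congr rfl fun ij hij => ?_
  rw [← mem_antidiagonal.1 hij, pow_add]
  ring

theorem finsum_range {M : Type} [AddCommGroup M] (f : ℕ → M) (N : ℕ) (h : ∀ j, N ≤ j → f j = 0) :
    ∑ᶠ j, f j = ∑ j ∈ range N, f j := by
  refine finsum_eq_sum_of_support_subset _ fun j hj => ?_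
  by_contra hc
  exact hj (h j (by simpa using hc))

theorem box_sum {M : Type} [AddCommGroup M] [Module ℂ M] (m n : ℤ) (g : ℕ → M) (N : ℕ)
    (hg : ∀ l, N ≤ l → g l = 0) :
    ∑ i ∈ range N, ∑ j ∈ range N, (binCoeff m i * binCoeff n j) • g (i + j)
      = ∑ l ∈ range N, binCoeff (m + n) l • g l := by
  have h1 : ∀ l ∈ range N, binCoeff (m + n) l • g l
      = ∑ ij ∈ antidiagonal l, (binCoeff m ij.1 * binCoeff n ij.2) • g (ij.1 + ij.2) := by
    intro l _
    rw [← binCoeff_add, Finset.sum_smul]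
    exact Finset.sum_congr rfl fun ij hij => by rw [mem_antidiagonal.1 hij]
  rw [Finset.sum_congr rfl h1, ← Finset.sum_product', Finset.sum_sigma']
  symm
  refine Finset.sum_of_injOn (fun x => x.2) ?_ ?_ ?_ ?_
  · rintro ⟨a, x⟩ hx ⟨b, y⟩ hy hxy
    simp only [Finset.coe_sigma, Set.mem_sigma_iff, Finset.mem_coe, HasAntidiagonal.mem_antidiagonal] at hx hy hxy
    obtain rfl := hxy
    obtain rfl : a = b := hx.2.symm.trans hy.2
    rfl
  · rintro ⟨a, x⟩ hx
    simp only [Finset.coe_sigma, Set.mem_sigma_iff, Finset.mem_coe, HasAntidiagonal.mem_antidiagonal,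
      Finset.mem_range] at hx
    simp only [Finset.coe_product, Set.mem_prod, Finset.mem_coe, Finset.mem_range]
    omega
  · rintro ⟨i, j⟩ hx hn
    rw [hg, smul_zero]
    by_contra hc
    exact hn ⟨⟨i + j, (i, j)⟩, by simp at hc ⊢; omega, rfl⟩
  · rintro _ _; rfl

/-- `Res_y (y - x)ⁿ ā(y) B(x)`. -/
noncomputable def leftOp (a : Gen) (n : ℤ) : FieldSpace →ₗ[ℂ] FieldSpace where
  toFun B := ⟨fun m =>
    { toFun := fun w => ∑ᶠ j : ℕ, binCoeff n j • loopOp a (n - j) (B.1 (m + j) w)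
      map_add' := by
        intro v w
        obtain ⟨N, hN⟩ := B.2 v
        obtain ⟨M, hM⟩ := B.2 w
        have hv : ∀ j, (N - m).toNat + (M - m).toNat ≤ j → B.1 (m + j) v = 0 :=
          fun j hj => hN _ (by omega)
        have hw : ∀ j, (N - m).toNat + (M - m).toNat ≤ j → B.1 (m + j) w = 0 :=
          fun j hj => hM _ (by omega)
        rw [finsum_range _ _ fun j hj => by rw [map_add, hv j hj, hw j hj]; simp,
          finsum_range _ _ fun j hj => by rw [hv j hj]; simp,
          finsum_range _ _ fun j hj => by rw [hw j hj]; simp, ← Finset.sum_add_distrib]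
        simp
      map_smul' := by
        intro r v
        obtain ⟨N, hN⟩ := B.2 v
        have hv : ∀ j, (N - m).toNat ≤ j → B.1 (m + j) v = 0 := fun j hj => hN _ (by omega)
        rw [finsum_range _ _ fun j hj => by rw [map_smul, hv j hj]; simp,
          finsum_range _ _ fun j hj => by rw [hv j hj]; simp, RingHom.id_apply, Finset.smul_sum]
        exact Finset.sum_congr rfl fun j _ => by rw [map_smul, map_smul, smul_comm] },
    by
      intro w
      obtain ⟨N, hN⟩ := B.2 w
      refine ⟨N, fun m hm => ?_⟩
      change ∑ᶠ j : ℕ, binCoeff n j • loopOp a (n - j) (B.1 (m + j) w) = 0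
      rw [finsum_range _ 0 fun j _ => by rw [hN _ (by omega)]; simp, Finset.sum_range_zero]⟩
  map_add' A B := by
    ext m w
    obtain ⟨N, hN⟩ := A.2 w
    obtain ⟨M, hM⟩ := B.2 w
    have hv : ∀ j, (N - m).toNat + (M - m).toNat ≤ j → A.1 (m + j) w = 0 :=
      fun j hj => hN _ (by omega)
    have hw : ∀ j, (N - m).toNat + (M - m).toNat ≤ j → B.1 (m + j) w = 0 :=
      fun j hj => hM _ (by omega)
    change ∑ᶠ j : ℕ, binCoeff n j • loopOp a (n - j) (A.1 (m + j) w + B.1 (m + j) w)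
      = (∑ᶠ j : ℕ, binCoeff n j • loopOp a (n - j) (A.1 (m + j) w))
        + ∑ᶠ j : ℕ, binCoeff n j • loopOp a (n - j) (B.1 (m + j) w)
    rw [finsum_range _ _ fun j hj => by rw [hv j hj, hw j hj]; simp,
      finsum_range _ _ fun j hj => by rw [hv j hj]; simp,
      finsum_range _ _ fun j hj => by rw [hw j hj]; simp, ← Finset.sum_add_distrib]
    simp
  map_smul' r B := by
    ext m w
    obtain ⟨N, hN⟩ := B.2 w
    have hv : ∀ j, (N - m).toNat ≤ j → B.1 (m + j) w = 0 := fun j hj => hN _ (by omega)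
    change ∑ᶠ j : ℕ, binCoeff n j • loopOp a (n - j) (r • B.1 (m + j) w)
      = r • ∑ᶠ j : ℕ, binCoeff n j • loopOp a (n - j) (B.1 (m + j) w)
    rw [finsum_range _ _ fun j hj => by rw [hv j hj]; simp,
      finsum_range _ _ fun j hj => by rw [hv j hj]; simp, Finset.smul_sum]
    exact Finset.sum_congr rfl fun j _ => by rw [map_smul, smul_comm]

/-- `(-1)^{|a||B|} Res_y (-x + y)ⁿ B(x) ā(y)`; the sign `(-1)^{|a||B|}` is produced by conjugation
with the parity operator. -/
noncomputable def rightOp (a : Gen) (n : ℤ) : FieldSpace →ₗ[ℂ] FieldSpace where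
  toFun B := ⟨fun m =>
    { toFun := fun w => (-1 : ℂ) ^ n • ∑ᶠ j : ℕ, binCoeff n j •
        (parityOp ^ a.parity) (B.1 (m + n - j) ((parityOp ^ a.parity) (loopOp a j w)))
      map_add' := by
        intro v w
        obtain ⟨N, hN⟩ := loopOp_trunc v
        obtain ⟨M, hM⟩ := loopOp_trunc w
        have hv : ∀ j : ℕ, N + M ≤ j → loopOp a j v = 0 := fun j hj => hN _ _ (by omega)
        have hw : ∀ j : ℕ, N + M ≤ j → loopOp a j w = 0 := fun j hj => hM _ _ (by omega)
        rw [finsum_range _ _ fun j hj => by rw [map_add, hv j hj, hw j hj]; simp,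
          finsum_range _ _ fun j hj => by rw [hv j hj]; simp,
          finsum_range _ _ fun j hj => by rw [hw j hj]; simp, ← smul_add,
          ← Finset.sum_add_distrib]
        simp
      map_smul' := by
        intro r v
        obtain ⟨N, hN⟩ := loopOp_trunc v
        have hv : ∀ j : ℕ, N ≤ j → loopOp a j v = 0 := fun j hj => hN _ _ (by omega)
        rw [finsum_range _ _ fun j hj => by rw [map_smul, hv j hj]; simp,
          finsum_range _ _ fun j hj => by rw [hv j hj]; simp, RingHom.id_apply,
          smul_comm r ((-1 : ℂ) ^ n)]
        refine congrArg _ ?_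
        rw [Finset.smul_sum]
        exact Finset.sum_congr rfl fun j _ => by simp only [map_smul]; rw [smul_comm] },
    by
      intro w
      obtain ⟨N, hN⟩ := loopOp_trunc w
      have hv : ∀ j : ℕ, N ≤ j → loopOp a j w = 0 := fun j hj => hN _ _ (by omega)
      choose K hK using fun j : ℕ => B.2 ((parityOp ^ a.parity) (loopOp a j w))
      refine ⟨(∑ j ∈ range N, |K j|) + N - n, fun m hm => ?_⟩
      change (-1 : ℂ) ^ n • ∑ᶠ j : ℕ, binCoeff n j •
        (parityOp ^ a.parity) (B.1 (m + n - j) ((parityOp ^ a.parity) (loopOp a j w))) = 0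
      rw [finsum_range _ _ fun j hj => by rw [hv j hj]; simp, Finset.sum_eq_zero, smul_zero]
      intro j hj
      rw [hK j, map_zero, smul_zero]
      have h1 := Finset.single_le_sum (f := fun j => |K j|) (fun i _ => abs_nonneg _) hj
      have h2 := le_abs_self (K j)
      have h3 := Finset.mem_range.1 hj
      omega⟩
  map_add' A B := by
    ext m w
    obtain ⟨N, hN⟩ := loopOp_trunc w
    have hv : ∀ j : ℕ, N ≤ j → loopOp a j w = 0 := fun j hj => hN _ _ (by omega)
    change (-1 : ℂ) ^ n • (∑ᶠ j : ℕ, binCoeff n j • (parityOp ^ a.parity)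
        (A.1 (m + n - j) ((parityOp ^ a.parity) (loopOp a j w))
          + B.1 (m + n - j) ((parityOp ^ a.parity) (loopOp a j w))))
      = (-1 : ℂ) ^ n • (∑ᶠ j : ℕ, binCoeff n j • (parityOp ^ a.parity)
        (A.1 (m + n - j) ((parityOp ^ a.parity) (loopOp a j w))))
      + (-1 : ℂ) ^ n • (∑ᶠ j : ℕ, binCoeff n j • (parityOp ^ a.parity)
        (B.1 (m + n - j) ((parityOp ^ a.parity) (loopOp a j w))))
    rw [finsum_range _ _ fun j hj => by rw [hv j hj]; simp,
      finsum_range _ _ fun j hj => by rw [hv j hj]; simp,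
      finsum_range _ _ fun j hj => by rw [hv j hj]; simp, ← smul_add, ← Finset.sum_add_distrib]
    simp
  map_smul' r B := by
    ext m w
    obtain ⟨N, hN⟩ := loopOp_trunc w
    have hv : ∀ j : ℕ, N ≤ j → loopOp a j w = 0 := fun j hj => hN _ _ (by omega)
    change (-1 : ℂ) ^ n • (∑ᶠ j : ℕ, binCoeff n j • (parityOp ^ a.parity)
        (r • B.1 (m + n - j) ((parityOp ^ a.parity) (loopOp a j w))))
      = r • (-1 : ℂ) ^ n • (∑ᶠ j : ℕ, binCoeff n j • (parityOp ^ a.parity)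
        (B.1 (m + n - j) ((parityOp ^ a.parity) (loopOp a j w))))
    rw [finsum_range _ _ fun j hj => by rw [hv j hj]; simp,
      finsum_range _ _ fun j hj => by rw [hv j hj]; simp, smul_comm r ((-1 : ℂ) ^ n)]
    refine congrArg _ ?_
    rw [Finset.smul_sum]
    exact Finset.sum_congr rfl fun j _ => by rw [map_smul, smul_comm]

theorem leftOp_apply (a : Gen) (n m : ℤ) (B : FieldSpace) (w : VL) (N : ℕ)
    (h : ∀ j : ℕ, N ≤ j → B.1 (m + j) w = 0) :
    (leftOp a n B).1 m w = ∑ j ∈ range N, binCoeff n j • loopOp a (n - j) (B.1 (m + j) w) :=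
  finsum_range _ N fun j hj => by rw [h j hj]; simp

theorem rightOp_apply (a : Gen) (n m : ℤ) (B : FieldSpace) (w : VL) (N : ℕ)
    (h : ∀ j : ℕ, N ≤ j → loopOp a j w = 0) :
    (rightOp a n B).1 m w = (-1 : ℂ) ^ n • ∑ j ∈ range N, binCoeff n j •
      (parityOp ^ a.parity) (B.1 (m + n - j) ((parityOp ^ a.parity) (loopOp a j w))) :=
  congrArg _ (finsum_range _ N fun j hj => by rw [h j hj]; simp)

/-- The `n`-th product `ā(x)ₙ B(x) = Res_y ((y - x)ⁿ ā(y) B(x) - (-1)^{|a||B|} (-x + y)ⁿ B(x) ā(y))`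
of the field `ā(x)` and a field `B(x)`. -/
noncomputable def nthProd (a : Gen) (n : ℤ) : Module.End ℂ FieldSpace := leftOp a n - rightOp a n


theorem parityOp_pow_loopOp (p : ℕ) (a : Gen) (n : ℤ) (v : VL) :
    (parityOp ^ p) (loopOp a n v) = (-1 : ℂ) ^ (p * a.parity) • loopOp a n ((parityOp ^ p) v) := by
  induction p with
  | zero => simp
  | succ p ih =>
    rw [pow_succ', Module.End.mul_apply, ih, map_smul, parityOp_loopOp, smul_smul, ← pow_add,
      Module.End.mul_apply]
    congr 2; ring

theorem parityOp_sq : parityOp * parityOp = 1 := LinearMap.ext parityOp_parityOp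

theorem neg_one_pow_mul_self (k : ℕ) : ((-1 : ℂ) ^ k) * (-1 : ℂ) ^ k = 1 := by
  rw [← mul_pow]; simp

theorem sum_loopOp_le (a b : Gen) (B : VL) (N : ℕ) (h : ∀ c (n : ℤ), N ≤ n → loopOp c n B = 0)
    (l : ℤ) (hl : N ≤ l) : ∑ c : Gen, structConst a b c • loopOp c l B = 0 :=
  Finset.sum_eq_zero fun c _ => by rw [h c l hl, smul_zero]

theorem left_left (a b : Gen) (m n : ℤ) (B : FieldSpace) :
    leftOp a m (leftOp b n B) = (-1 : ℂ) ^ (a.parity * b.parity) • leftOp b n (leftOp a m B)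
      + ∑ c : Gen, structConst a b c • leftOp c (m + n) B := by
  ext k w
  obtain ⟨K, hK⟩ := B.2 w
  set N := (K - k).toNat with hN
  have hB : ∀ j : ℕ, N ≤ j → B.1 (k + j) w = 0 := fun j hj => hK _ (by omega)
  have h1 : ∀ (c : Gen) (s : ℤ) (i : ℕ), (leftOp c s B).1 (k + i) w
      = ∑ j ∈ range N, binCoeff s j • loopOp c (s - j) (B.1 (k + i + j) w) :=
    fun c s i => leftOp_apply c s _ B w N fun j hj => hK _ (by omega)
  have h1' : ∀ (c : Gen) (s : ℤ) (i : ℕ), N ≤ i → (leftOp c s B).1 (k + i) w = 0 := by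
    intro c s i hi
    rw [h1]
    exact Finset.sum_eq_zero fun j _ => by rw [hK _ (by omega)]; simp
  have h2 : ∀ (c d : Gen) (s r : ℤ), (leftOp c s (leftOp d r B)).1 k w
      = ∑ i ∈ range N, ∑ j ∈ range N, (binCoeff s i * binCoeff r j) •
        loopOp c (s - i) (loopOp d (r - j) (B.1 (k + i + j) w)) := by
    intro c d s r
    rw [leftOp_apply c s k _ w N (h1' d r)]
    refine Finset.sum_congr rfl fun i _ => ?_
    rw [h1, map_sum, Finset.smul_sum]
    exact Finset.sum_congr rfl fun j _ => by rw [map_smul, smul_smul]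
  have h3 : ∀ c : Gen, (leftOp c (m + n) B).1 k w
      = ∑ i ∈ range N, ∑ j ∈ range N, (binCoeff m i * binCoeff n j) •
        loopOp c (m + n - (i + j : ℕ)) (B.1 (k + (i + j : ℕ)) w) := by
    intro c
    rw [leftOp_apply c (m + n) k B w N hB]
    exact (box_sum m n (fun l : ℕ => loopOp c (m + n - l) (B.1 (k + l) w)) N
      fun l hl => by rw [hB l hl, map_zero]).symm
  have e : ((-1 : ℂ) ^ (a.parity * b.parity) • leftOp b n (leftOp a m B)
      + ∑ c : Gen, structConst a b c • leftOp c (m + n) B).1 k w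
      = (-1 : ℂ) ^ (a.parity * b.parity) • (leftOp b n (leftOp a m B)).1 k w
      + ∑ c : Gen, structConst a b c • (leftOp c (m + n) B).1 k w := by
    simp
  rw [e, h2, h2, Finset.sum_comm (s := range N) (t := range N)
    (f := fun i j => (binCoeff n i * binCoeff m j) • _)]
  simp only [h3, Finset.smul_sum]
  rw [Finset.sum_comm (s := univ), ← Finset.sum_add_distrib]
  refine Finset.sum_congr rfl fun i _ => ?_
  rw [Finset.sum_comm (s := univ), ← Finset.sum_add_distrib]
  refine Finset.sum_congr rfl fun j _ => ?_
  rw [loopOp_loopOp, smul_add, Finset.smul_sum]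
  congr 1
  · rw [smul_comm, mul_comm (binCoeff n j), show k + (j : ℤ) + i = k + i + j by ring]
  · refine Finset.sum_congr rfl fun c _ => ?_
    rw [smul_comm, show m - (i : ℤ) + (n - j) = m + n - (i + j : ℕ) by push_cast; ring,
      show k + (i : ℤ) + j = k + (i + j : ℕ) by push_cast; ring]

theorem left_right (a b : Gen) (m n : ℤ) (B : FieldSpace) :
    leftOp a m (rightOp b n B)
      = (-1 : ℂ) ^ (a.parity * b.parity) • rightOp b n (leftOp a m B) := by
  ext k w
  obtain ⟨M, hM⟩ := loopOp_trunc w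
  have hM' : ∀ (c : Gen) (j : ℕ), M ≤ j → loopOp c j w = 0 := fun c j hj => hM c _ (by omega)
  choose K hK using fun j : ℕ => B.2 ((parityOp ^ b.parity) (loopOp b j w))
  set N := (∑ j ∈ range M, |K j|).toNat + M + n.natAbs + k.natAbs with hN
  have hB : ∀ j < M, ∀ i : ℕ, N ≤ i →
      B.1 (k + i + n - j) ((parityOp ^ b.parity) (loopOp b j w)) = 0 := by
    intro j hj i hi
    refine hK j _ ?_
    have h1 := Finset.single_le_sum (f := fun j => |K j|) (fun i _ => abs_nonneg _)
      (Finset.mem_range.2 hj)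
    have h2 := le_abs_self (K j)
    have h4 : (N : ℤ) ≤ i := by exact_mod_cast hi
    have h5 := Int.self_le_toNat (∑ j ∈ range M, |K j|)
    have h6 := neg_abs_le n
    have h7 := neg_abs_le k
    rw [hN] at h4
    push_cast at h4
    omega
  have h1 : ∀ i : ℕ, (rightOp b n B).1 (k + i) w = (-1 : ℂ) ^ n • ∑ j ∈ range M, binCoeff n j •
      (parityOp ^ b.parity)
        (B.1 (k + i + n - j) ((parityOp ^ b.parity) (loopOp b j w))) :=
    fun i => rightOp_apply b n _ B w M (hM' b)
  rw [leftOp_apply a m k _ w N (by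
    intro i hi
    rw [h1, Finset.sum_eq_zero, smul_zero]
    intro j hj
    rw [hB j (Finset.mem_range.1 hj) i hi, map_zero, smul_zero])]
  have e : ((-1 : ℂ) ^ (a.parity * b.parity) • rightOp b n (leftOp a m B)).1 k w
    = (-1 : ℂ) ^ (a.parity * b.parity) • (rightOp b n (leftOp a m B)).1 k w := rfl
  rw [e, rightOp_apply b n k _ w M (hM' b)]
  simp only [h1, map_smul, map_sum, Finset.smul_sum]
  rw [Finset.sum_comm]
  refine Finset.sum_congr rfl fun j hj => ?_
  rw [leftOp_apply a m _ B _ N (by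
    intro i hi
    rw [show k + n - (j : ℤ) + i = k + i + n - j by ring]
    exact hB j (Finset.mem_range.1 hj) i hi)]
  simp only [map_smul, map_sum, Finset.smul_sum]
  refine Finset.sum_congr rfl fun i _ => ?_
  rw [parityOp_pow_loopOp b.parity a (m - i), show k + n - (j : ℤ) + i = k + i + n - j by ring]
  simp only [smul_smul]
  congr 1
  rw [mul_comm b.parity]
  linear_combination (-(binCoeff m i * (-1 : ℂ) ^ n * binCoeff n j)) *
    neg_one_pow_mul_self (a.parity * b.parity)

theorem right_right (a b : Gen) (m n : ℤ) (B : FieldSpace) :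
    rightOp a m (rightOp b n B) + ∑ c : Gen, structConst a b c • rightOp c (m + n) B
      = (-1 : ℂ) ^ (a.parity * b.parity) • rightOp b n (rightOp a m B) := by
  ext k w
  obtain ⟨M, hM⟩ := loopOp_trunc w
  have hM' : ∀ (c : Gen) (j : ℕ), M ≤ j → loopOp c j w = 0 := fun c j hj => hM c _ (by omega)
  choose K hK using fun v : VL => loopOp_trunc v
  set N := M + (∑ i ∈ range M, (K (loopOp a i w) + K (loopOp b i w))) with hN
  have hMN : M ≤ N := by omega
  have hKN : ∀ (c d : Gen) (i j : ℕ), (c = a ∨ c = b) → N ≤ j →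
      loopOp d j (loopOp c i w) = 0 := by
    intro c d i j hc hj
    by_cases hi : i < M
    · have h1 := Finset.single_le_sum
        (f := fun i : ℕ => K (loopOp a i w) + K (loopOp b i w)) (fun i _ => Nat.zero_le _)
        (Finset.mem_range.2 hi)
      refine hK _ d _ ?_
      rcases hc with rfl | rfl <;> omega
    · rw [hM' c i (by omega), map_zero]
  have h2 : ∀ (c d : Gen) (s r : ℤ), (c = a ∨ c = b) → (rightOp c s (rightOp d r B)).1 k w
      = ∑ i ∈ range N, ∑ j ∈ range N,
        ((-1 : ℂ) ^ (s + r) * (-1 : ℂ) ^ (c.parity * d.parity) * (binCoeff s i * binCoeff r j)) •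
        (parityOp ^ (c.parity + d.parity)) (B.1 (k + s + r - i - j)
          ((parityOp ^ (c.parity + d.parity)) (loopOp d j (loopOp c i w)))) := by
    intro c d s r hc
    rw [rightOp_apply c s k _ w N fun j hj => hM' c j (by omega), Finset.smul_sum]
    refine Finset.sum_congr rfl fun i _ => ?_
    rw [rightOp_apply d r _ B _ N (by
      intro j hj
      have := parityOp_pow_loopOp c.parity d j (loopOp c i w)
      rw [hKN c d i j hc hj, map_zero] at this
      have hne : (-1 : ℂ) ^ (c.parity * d.parity) ≠ 0 := by simp
      exact (smul_eq_zero.1 this.symm).resolve_left hne)]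
    simp only [map_smul, map_sum, Finset.smul_sum]
    refine Finset.sum_congr rfl fun j _ => ?_
    have h3 : loopOp d j ((parityOp ^ c.parity) (loopOp c i w))
        = (-1 : ℂ) ^ (c.parity * d.parity) • (parityOp ^ c.parity) (loopOp d j (loopOp c i w)) := by
      rw [parityOp_pow_loopOp c.parity d j, smul_smul, neg_one_pow_mul_self, one_smul]
    rw [h3, zpow_add₀ (by simp), show k + s - (i : ℤ) + r - j = k + s + r - i - j by ring]
    simp only [map_smul, smul_smul]
    rw [← Module.End.mul_apply (parityOp ^ c.parity), ← pow_add,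
      ← Module.End.mul_apply (parityOp ^ d.parity) (parityOp ^ c.parity), ← pow_add,
      add_comm d.parity]
    congr 1
    ring
  have h3 : ∀ c : Gen, (rightOp c (m + n) B).1 k w
      = ∑ i ∈ range N, ∑ j ∈ range N, ((-1 : ℂ) ^ (m + n) * (binCoeff m i * binCoeff n j)) •
        (parityOp ^ c.parity) (B.1 (k + m + n - i - j)
          ((parityOp ^ c.parity) (loopOp c (i + j) w))) := by
    intro c
    rw [rightOp_apply c (m + n) k B w N fun j hj => hM' c j (by omega)]
    rw [← box_sum m n (fun l : ℕ => (parityOp ^ c.parity) (B.1 (k + (m + n) - l)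
      ((parityOp ^ c.parity) (loopOp c l w)))) N fun l hl => by
        rw [hM' c l (by omega)]; simp]
    simp only [Finset.smul_sum, smul_smul]
    refine Finset.sum_congr rfl fun i _ => Finset.sum_congr rfl fun j _ => ?_
    rw [show k + (m + n) - ((i + j : ℕ) : ℤ) = k + m + n - i - j by push_cast; ring]
    push_cast
    rfl
  have hpar : ∀ (c : Gen) (s : ℤ) (v : VL), structConst a b c •
      (parityOp ^ c.parity) (B.1 s ((parityOp ^ c.parity) v))
      = structConst a b c • (parityOp ^ (a.parity + b.parity))
        (B.1 s ((parityOp ^ (a.parity + b.parity)) v)) := by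
    intro c s v
    cases a <;> cases b <;> cases c <;> simp [structConst, Gen.parity, pow_two, parityOp_sq]
  have e : (rightOp a m (rightOp b n B)
      + ∑ c : Gen, structConst a b c • rightOp c (m + n) B).1 k w
      = (rightOp a m (rightOp b n B)).1 k w
      + ∑ c : Gen, structConst a b c • (rightOp c (m + n) B).1 k w := by
    simp
  have e' : ((-1 : ℂ) ^ (a.parity * b.parity) • rightOp b n (rightOp a m B)).1 k w
    = (-1 : ℂ) ^ (a.parity * b.parity) • (rightOp b n (rightOp a m B)).1 k w := rfl
  rw [e, e', h2 a b m n (Or.inl rfl), h2 b a n m (Or.inr rfl),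
    Finset.sum_comm (s := range N) (t := range N)
      (f := fun i j => ((-1 : ℂ) ^ (n + m) * (-1 : ℂ) ^ (b.parity * a.parity)
        * (binCoeff n i * binCoeff m j)) • _)]
  simp only [h3, Finset.smul_sum]
  rw [Finset.sum_comm (s := univ), ← Finset.sum_add_distrib]
  refine Finset.sum_congr rfl fun i _ => ?_
  rw [Finset.sum_comm (s := univ), ← Finset.sum_add_distrib]
  refine Finset.sum_congr rfl fun j _ => ?_
  have h4 := loopOp_loopOp a b i j w
  rw [h4, add_comm b.parity, add_comm n, mul_comm b.parity,
    show k + n + m - (j : ℤ) - i = k + m + n - i - j by ring]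
  have h5 : ∀ c : Gen, structConst a b c • ((-1 : ℂ) ^ (m + n) * (binCoeff m i * binCoeff n j)) •
      (parityOp ^ c.parity) (B.1 (k + m + n - i - j)
          ((parityOp ^ c.parity) (loopOp c (i + j) w)))
      = ((-1 : ℂ) ^ (m + n) * (binCoeff m i * binCoeff n j)) • (parityOp ^ (a.parity + b.parity))
        (B.1 (k + m + n - i - j) ((parityOp ^ (a.parity + b.parity))
          (structConst a b c • loopOp c (i + j) w))) := by
    intro c
    rw [smul_comm, hpar]
    simp only [map_smul]
  simp only [h5]
  simp only [map_add, map_sum, map_smul, smul_add, Finset.smul_sum, smul_smul]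
  have hs := neg_one_pow_mul_self (a.parity * b.parity)
  congr 1
  · congr 1
    linear_combination (-((-1 : ℂ) ^ (m + n) * binCoeff m i * binCoeff n j *
      (-1 : ℂ) ^ (a.parity * b.parity))) * hs
  · refine Finset.sum_congr rfl fun c _ => ?_
    congr 1
    linear_combination (-((-1 : ℂ) ^ (m + n) * binCoeff m i * binCoeff n j *
      structConst a b c)) * hs

theorem nthProd_relation (a b : Gen) (m n : ℤ) :
    nthProd a m * nthProd b n = (-1 : ℂ) ^ (a.parity * b.parity) • (nthProd b n * nthProd a m)
      + ∑ c : Gen, structConst a b c • nthProd c (m + n) := by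
  ext1 B
  have h1 := left_left a b m n B
  have h2 := left_right a b m n B
  have h3 := left_right b a n m B
  have h4 := right_right a b m n B
  have hs := neg_one_pow_mul_self (a.parity * b.parity)
  rw [mul_comm b.parity] at h3
  have h3' : (-1 : ℂ) ^ (a.parity * b.parity) • leftOp b n (rightOp a m B)
      = rightOp a m (leftOp b n B) := by rw [h3, smul_smul, hs, one_smul]
  simp only [nthProd, Module.End.mul_apply, LinearMap.sub_apply, LinearMap.add_apply,
    LinearMap.smul_apply, LinearMap.sum_apply, map_sub, smul_sub, Finset.sum_sub_distrib]
  rw [h1, h2, h3', ← h4]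
  abel

/-- The identity field `1_V`. -/
noncomputable def idField : FieldSpace :=
  ⟨fun m => if m = -1 then 1 else 0, fun w => ⟨0, fun m hm => by simp [show m ≠ -1 by omega]⟩⟩

theorem leftOp_idField (a : Gen) (n m : ℤ) (w : VL) : (leftOp a n idField).1 m w
    = if m ≤ -1 then binCoeff n (-1 - m).toNat • loopOp a (n + 1 + m) w else 0 := by
  change ∑ᶠ j : ℕ, binCoeff n j • loopOp a (n - j)
    ((if m + j = -1 then 1 else 0 : Module.End ℂ VL) w) = _
  split_ifs with hm
  · rw [finsum_eq_single _ (-1 - m).toNat fun j hj => by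
      rw [if_neg (by omega), LinearMap.zero_apply, map_zero, smul_zero]]
    rw [if_pos (by omega), Module.End.one_apply,
      show n - ((-1 - m).toNat : ℤ) = n + 1 + m by omega]
  · rw [finsum_congr (g := fun _ : ℕ => (0 : VL)) fun j => by
      rw [if_neg (by omega), LinearMap.zero_apply, map_zero, smul_zero], finsum_zero]

theorem rightOp_idField (a : Gen) (n m : ℤ) (w : VL) : (rightOp a n idField).1 m w
    = if 0 ≤ n + 1 + m then
        ((-1 : ℂ) ^ n * binCoeff n (n + 1 + m).toNat) • loopOp a (n + 1 + m) w else 0 := by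
  have hp : ∀ v : VL, (parityOp ^ a.parity) ((parityOp ^ a.parity) v) = v := by
    intro v
    rw [← Module.End.mul_apply, ← pow_add, ← two_mul, pow_mul, pow_two, parityOp_sq, one_pow,
      Module.End.one_apply]
  change (-1 : ℂ) ^ n • ∑ᶠ j : ℕ, binCoeff n j • (parityOp ^ a.parity)
    ((if m + n - j = -1 then 1 else 0 : Module.End ℂ VL)
      ((parityOp ^ a.parity) (loopOp a j w))) = _
  split_ifs with hm
  · rw [finsum_eq_single _ (n + 1 + m).toNat fun j hj => by
      rw [if_neg (by omega), LinearMap.zero_apply, map_zero, smul_zero]]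
    rw [if_pos (by omega), Module.End.one_apply, hp, Int.toNat_of_nonneg hm, smul_smul]
  · rw [finsum_congr (g := fun _ : ℕ => (0 : VL)) fun j => by
      rw [if_neg (by omega), LinearMap.zero_apply, map_zero, smul_zero], finsum_zero, smul_zero]

theorem nthProd_idField (a : Gen) (n : ℤ) (hn : 0 ≤ n) : nthProd a n idField = 0 := by
  ext m w
  have e : (nthProd a n idField).1 m w
      = (leftOp a n idField).1 m w - (rightOp a n idField).1 m w := rfl
  rw [e, leftOp_idField, rightOp_idField]
  obtain ⟨N, rfl⟩ := Int.eq_ofNat_of_zero_le hn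
  have hb : ∀ j : ℕ, binCoeff (N : ℤ) j = (-1) ^ j * (N.choose j : ℂ) := fun j => by
    simp [binCoeff, Ring.choose_natCast]
  simp only [hb, zpow_natCast]
  change _ = (0 : VL)
  split_ifs with h1 h2 h2
  · obtain ⟨i, rfl⟩ : ∃ i : ℕ, m = -1 - i := ⟨(-1 - m).toNat, by omega⟩
    have hi : i ≤ N := by omega
    rw [show (-1 - (-1 - (i : ℤ))).toNat = i by omega,
      show ((N : ℤ) + 1 + (-1 - i)).toNat = N - i by omega, Nat.choose_symm hi, ← sub_smul]
    obtain ⟨k, rfl⟩ := Nat.exists_eq_add_of_le hi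
    have := neg_one_pow_mul_self k
    rw [Nat.add_sub_cancel_left, pow_add]
    rw [show (-1 : ℂ) ^ i * ((i + k).choose i : ℂ)
      - (-1) ^ i * (-1) ^ k * ((-1) ^ k * ((i + k).choose i : ℂ)) = 0 by
        linear_combination (-((-1 : ℂ) ^ i * ((i + k).choose i : ℂ))) * this, zero_smul]
  · rw [Nat.choose_eq_zero_of_lt (by omega)]; simp
  · rw [Nat.choose_eq_zero_of_lt (by omega)]; simp
  · simp

/-- The vertex operator map `Y(·, x) : V → Hom(V, V((x)))` of the vertex superalgebra `V`. It is
the unique linear map with `Y(𝟏, x) = 1` and `Y(ā(n) v, x) = ā(x)ₙ Y(v, x)` for all `n ∈ ℤ`; in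
particular `Y(ā(-1)𝟏, x) = ā(x)`. The operator `vₙ` is `(vertexOp v).1 n`. -/
noncomputable def vertexOp : VL →ₗ[ℂ] FieldSpace :=
  liftVL (liftULoop nthProd nthProd_relation) idField fun a n hn => by
    rw [liftULoop_ugen]; exact nthProd_idField a n hn

theorem vertexOp_vac : vertexOp vac = idField := liftVL_vac _ _ _

theorem vertexOp_loopOp (a : Gen) (n : ℤ) (v : VL) :
    vertexOp (loopOp a n v) = nthProd a n (vertexOp v) := by
  rw [vertexOp, liftVL_loopOp, liftULoop_ugen]

theorem vertexOp_gen (a : Gen) (n : ℤ) : (vertexOp (loopOp a (-1) vac)).1 n = loopOp a n := by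
  rw [vertexOp_loopOp, vertexOp_vac]
  ext w
  have e : (nthProd a (-1) idField).1 n w
      = (leftOp a (-1) idField).1 n w - (rightOp a (-1) idField).1 n w := rfl
  have hb : ∀ j : ℕ, binCoeff (-1) j = 1 := fun j => by
    rw [binCoeff]
    induction j with
    | zero => simp
    | succ j ih =>
      have h := Ring.choose_succ_succ (-1 : ℤ) j
      rw [neg_add_cancel, Ring.choose_zero_succ] at h
      rw [show Ring.choose (-1 : ℤ) (j + 1) = -Ring.choose (-1 : ℤ) j by linarith, pow_succ]
      push_cast
      linear_combination ih
  rw [e, leftOp_idField, rightOp_idField, hb, hb]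
  split_ifs with h1 h2 h2
  · omega
  · simp
  · simp
  · omega

/-- The operator `𝒟 v = v₋₂ 𝟏` on `V`. -/
noncomputable def transOp : Module.End ℂ VL where
  toFun v := (vertexOp v).1 (-2) vac
  map_add' v w := by simp
  map_smul' r v := by simp

/-! ### The map `Φ(t)` -/

/-- The characterization of `Φ(t) ∈ Hom(V, V ⊗ ℂ[t])`. An element `∑ₖ vₖ tᵏ` of `V ⊗ ℂ[t]` is the
finitely supported function `k ↦ vₖ`. The last condition is the coefficient of `x^{-n-1}` in
`Φ(t) Y(v, x) w = Y(Φ(t - x) v, x) Φ(t) w`, where `(t - x)ᵏ` has been expanded as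
`∑ᵢ (-1)ⁱ (k choose i) t^{k-i} xⁱ`. -/
structure IsPhi (Φ : VL →ₗ[ℂ] (ℕ →₀ VL)) : Prop where
  map_vac : Φ vac = Finsupp.single 0 vac
  map_e : Φ (loopOp .e (-1) vac) = Finsupp.single 1 (loopOp .e (-1) vac)
  map_f : Φ (loopOp .f (-1) vac) = Finsupp.single 1 (loopOp .f (-1) vac)
  map_h : Φ (loopOp .h (-1) vac) = Finsupp.single 2 (loopOp .h (-1) vac)
  map_vertexOp : ∀ (v w : VL) (n : ℤ), Φ ((vertexOp v).1 n w) =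
    (Φ v).sum fun k vk => (Φ w).sum fun l wl => ∑ i ∈ range (k + 1),
      Finsupp.single (k - i + l) (((-1 : ℂ) ^ i * (k.choose i : ℂ)) • (vertexOp vk).1 (n + i) wl)

/-- The polynomial `Φ(c + x) P(x) ∈ V[x]` for `P(x) = ∑ⱼ pⱼ xʲ ∈ V[x]`, with
`(c + x)ᵏ = ∑ᵢ (k choose i) c^{k-i} xⁱ`. -/
noncomputable def phiShift (Φ : VL →ₗ[ℂ] (ℕ →₀ VL)) (c : ℂ) (P : ℕ →₀ VL) : ℕ →₀ VL :=
  P.sum fun j p => (Φ p).sum fun k v => ∑ i ∈ range (k + 1),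
    Finsupp.single (i + j) (((k.choose i : ℂ) * c ^ (k - i)) • v)

/-- The coefficient of `x^{-n-1}` in `ā(x) P(x)` for `P(x) ∈ V[x]`. -/
noncomputable def fieldMul (a : Gen) (P : ℕ →₀ VL) (n : ℤ) : VL :=
  P.sum fun i v => loopOp a (n + i) v

/-- The coefficient of `x^{-n-1}` in `e(x) w = ē(x) Φ(q + x) w`, `f(x) w = f̄(x) Φ(-q + x) w`,
`h(x) w = q h̄(x) Φ(q + x) Φ(-q + x) w`. -/
noncomputable def newField (q : ℂ) (Φ : VL →ₗ[ℂ] (ℕ →₀ VL)) : Gen → ℤ → VL → VL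
  | .e, n, w => fieldMul .e (phiShift Φ q (Finsupp.single 0 w)) n
  | .f, n, w => fieldMul .f (phiShift Φ (-q) (Finsupp.single 0 w)) n
  | .h, n, w => q • fieldMul .h (phiShift Φ q (phiShift Φ (-q) (Finsupp.single 0 w))) n

/-- The `T`-module structure `ρ` on `V` is the one given by the assignment of `e(x), f(x), h(x)`. -/
def IsAssignment (q : ℂ) (Φ : VL →ₗ[ℂ] (ℕ →₀ VL)) (ρ : Tensor →ₐ[ℂ] Module.End ℂ VL) : Prop :=
  ∀ (a : Gen) (n : ℤ) (w : VL), ρ (tgen a n) w = newField q Φ a n w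

/-! ### Modules for `DY_q(sl₂)` -/

/-- The six defining relations of `DY_q(sl₂)`; the label `ab` stands for the relation that begins
with `a(x₁) b(x₂)`:
* `e(x₁) e(x₂) = (q + x₁ - x₂) / (-q + x₁ - x₂) e(x₂) e(x₁)`,
* `f(x₁) f(x₂) = (-q + x₁ - x₂) / (q + x₁ - x₂) f(x₂) f(x₁)`,
* `e(x₁) f(x₂) - f(x₂) e(x₁) = x₁⁻¹ δ(x₂ / x₁) h(x₂)`,
* `h(x₁) e(x₂) = (q + x₁ - x₂) / (-q + x₁ - x₂) e(x₂) h(x₁)`,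
* `h(x₁) h(x₂) = h(x₂) h(x₁)`,
* `h(x₁) f(x₂) = (-q + x₁ - x₂) / (q + x₁ - x₂) f(x₂) h(x₁)`,

with all fractions expanded in `ℂ[[x₁, x₂]]`. -/
inductive DYRel where
  | ee
  | ff
  | ef
  | he
  | hh
  | hf

/-- The first generator in a relation. -/
def DYRel.fst : DYRel → Gen
  | .ee => .e
  | .ff => .f
  | .ef => .e
  | .he => .h
  | .hh => .h
  | .hf => .h

/-- The second generator in a relation. -/
def DYRel.snd : DYRel → Gen
  | .ee => .e
  | .ff => .f
  | .ef => .f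
  | .he => .e
  | .hh => .h
  | .hf => .f

/-- The expansion in `ℂ[[x₁, x₂]]` of `(c + x₁ - x₂) / (-c + x₁ - x₂)`. -/
noncomputable def exchange (c : ℂ) : MvPowerSeries (Fin 2) ℂ :=
  (MvPowerSeries.C c + MvPowerSeries.X 0 - MvPowerSeries.X 1)
    * (MvPowerSeries.C (-c) + MvPowerSeries.X 0 - MvPowerSeries.X 1)⁻¹

/-- The series `g` in the relation `a(x₁) b(x₂) = g(x₁, x₂) b(x₂) a(x₁) + ⋯`. -/
noncomputable def DYRel.series (q : ℂ) : DYRel → MvPowerSeries (Fin 2) ℂ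
  | .ee => exchange q
  | .ff => exchange (-q)
  | .ef => 1
  | .he => exchange q
  | .hh => 1
  | .hf => exchange (-q)

/-- The coefficient of the term `x₁⁻¹ δ(x₂ / x₁) h(x₂)`; this term occurs only in
`[e(x₁), f(x₂)]`. -/
def DYRel.delta : DYRel → ℂ
  | .ef => 1
  | _ => 0

/-- The difference of the two sides of a defining relation, applied to a vector `w`: the coefficient
of `x₁^{-m-1} x₂^{-n-1}` in
`a(x₁) b(x₂) w - g(x₁, x₂) b(x₂) a(x₁) w - δ_{ab, ef} x₁⁻¹ δ(x₂ / x₁) h(x₂) w`.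
The sum is finite when `a(k)` annihilates each vector for all large `k`. -/
noncomputable def relDefect {W : Type*} [AddCommGroup W] [Module ℂ W] (q : ℂ)
    (ρ : Tensor →ₐ[ℂ] Module.End ℂ W) (r : DYRel) (m n : ℤ) (w : W) : W :=
  ρ (tgen r.fst m) (ρ (tgen r.snd n) w)
    - (∑ᶠ d : Fin 2 →₀ ℕ, MvPowerSeries.coeff d (r.series q) •
        ρ (tgen r.snd (n + d 1)) (ρ (tgen r.fst (m + d 0)) w))
    - r.delta • ρ (tgen .h (m + n)) w

/-- A `DY_q(sl₂)`-module: a `T`-module `W` such that `sl₂(n) w = 0` for every `w` and all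
sufficiently large `n`, on which the defining relations of `DY_q(sl₂)` hold. -/
structure IsDYModule {W : Type*} [AddCommGroup W] [Module ℂ W] (q : ℂ)
    (ρ : Tensor →ₐ[ℂ] Module.End ℂ W) : Prop where
  trunc : ∀ w : W, ∃ N : ℤ, ∀ n, N ≤ n → ∀ a : Gen, ρ (tgen a n) w = 0
  rel : ∀ (r : DYRel) (m n : ℤ) (w : W), relDefect q ρ r m n w = 0

/-- A vacuum `DY_q(sl₂)`-module: a module with a vacuum vector that generates it. -/
structure IsVacuumModule {W : Type*} [AddCommGroup W] [Module ℂ W] (q : ℂ)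
    (ρ : Tensor →ₐ[ℂ] Module.End ℂ W) (w₀ : W) : Prop extends IsDYModule q ρ where
  vacuum : ∀ (a : Gen) (n : ℤ), 0 ≤ n → ρ (tgen a n) w₀ = 0
  generates : ∀ w : W, ∃ x : Tensor, ρ x w₀ = w

/-- The span `Eₙ` of the vectors `u⁽¹⁾(m₁) ⋯ u⁽ʳ⁾(mᵣ) w₀` with `r ≤ n`. -/
def wordSpan {W : Type*} [AddCommGroup W] [Module ℂ W]
    (ρ : Tensor →ₐ[ℂ] Module.End ℂ W) (w₀ : W) (n : ℕ) : Submodule ℂ W :=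
  Submodule.span ℂ {v | ∃ L : List (Gen × ℤ), L.length ≤ n ∧
    v = ρ ((L.map fun p => tgen p.1 p.2).prod) w₀}

/-- The `Eₙ` form an increasing filtration of `W` (and exhaust `W`). -/
def IsIncreasingFiltration {W : Type*} [AddCommGroup W] [Module ℂ W] (E : ℕ → Submodule ℂ W) : Prop :=
  Monotone E ∧ ⨆ n, E n = ⊤

/-- The index set of the normal monomials with at most `n` factors: triples of finite sequences of
positive integers `m₁ > ⋯ > mᵣ`, `n₁ > ⋯ > nₛ`, `k₁ ≥ ⋯ ≥ kₗ` with `r + s + l ≤ n`. -/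
def normalIndex (n : ℕ) : Set (List ℕ × List ℕ × List ℕ) :=
  {p | p.1.Pairwise (· > ·) ∧ p.2.1.Pairwise (· > ·) ∧ p.2.2.Pairwise (· ≥ ·) ∧
    (∀ m ∈ p.1, 1 ≤ m) ∧ (∀ m ∈ p.2.1, 1 ≤ m) ∧ (∀ k ∈ p.2.2, 1 ≤ k) ∧
    p.1.length + p.2.1.length + p.2.2.length ≤ n}

/-- The vector `e(-m₁) ⋯ e(-mᵣ) f(-n₁) ⋯ f(-nₛ) h(-k₁) ⋯ h(-kₗ) w₀`. -/
noncomputable def normalVector {W : Type*} [AddCommGroup W] [Module ℂ W]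
    (ρ : Tensor →ₐ[ℂ] Module.End ℂ W) (w₀ : W) (p : List ℕ × List ℕ × List ℕ) : W :=
  ρ ((p.1.map fun m => tgen .e (-(m : ℤ))).prod * (p.2.1.map fun m => tgen .f (-(m : ℤ))).prod
    * (p.2.2.map fun k => tgen .h (-(k : ℤ))).prod) w₀

/-- For each `n` the normal monomial vectors with at most `n` factors form a basis of `Eₙ`. -/
def HasNormalBasis {W : Type*} [AddCommGroup W] [Module ℂ W]
    (ρ : Tensor →ₐ[ℂ] Module.End ℂ W) (w₀ : W) : Prop :=
  ∀ n : ℕ, ∃ b : Module.Basis (normalIndex n) ℂ (wordSpan ρ w₀ n),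
    ∀ p : normalIndex n, (b p : W) = normalVector ρ w₀ p.1

/-! ### The universal vacuum module `V_q` -/

/-- The homogeneous component `Tₙ` of the tensor algebra, where `deg a(k) = k`. -/
def tensorDeg (n : ℤ) : Submodule ℂ Tensor :=
  Submodule.span ℂ {x | ∃ L : List (Gen × ℤ), (L.map Prod.snd).sum = n ∧
    x = (L.map fun p => tgen p.1 p.2).prod}

/-- The algebra homomorphism `x ↦ x + d(x) ε` to the dual numbers over the tensor algebra. -/
noncomputable def tensorDual : Tensor →ₐ[ℂ] TrivSqZeroExt Tensor Tensor :=
  FreeAlgebra.lift ℂ fun p : Gen × ℤ =>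
    TrivSqZeroExt.inl (tgen p.1 p.2) + TrivSqZeroExt.inr ((-(p.2 : ℂ)) • tgen p.1 (p.2 - 1))

/-- The derivation `d` of the tensor algebra with `d(a(n)) = -n a(n - 1)`. -/
noncomputable def tensorD : Tensor →ₗ[ℂ] Tensor where
  toFun x := (tensorDual x).snd
  map_add' x y := by simp
  map_smul' r x := by simp

theorem tensorDual_fst (x : Tensor) : (tensorDual x).fst = x := by
  have h : (TrivSqZeroExt.fstHom ℂ Tensor Tensor).comp tensorDual = AlgHom.id ℂ Tensor := by
    ext p
    simp [tensorDual, tgen]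
  exact congrArg (fun φ : Tensor →ₐ[ℂ] Tensor => φ x) h

theorem tensorD_mul (x y : Tensor) : tensorD (x * y) = x * tensorD y + tensorD x * y := by
  change (tensorDual (x * y)).snd = x * (tensorDual y).snd + (tensorDual x).snd * y
  rw [map_mul, TrivSqZeroExt.snd_mul, tensorDual_fst, tensorDual_fst]
  simp

theorem tensorD_tgen (a : Gen) (n : ℤ) : tensorD (tgen a n) = (-(n : ℂ)) • tgen a (n - 1) := by
  change (tensorDual (FreeAlgebra.ι ℂ (a, n))).snd = _
  simp [tensorDual]

/-- The left ideal `J = T ℂ[d] T₊` with `T₊ = ∑_{n ≥ 1} Tₙ`. -/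
noncomputable def vacIdeal : Submodule Tensor Tensor :=
  Submodule.span Tensor {y | ∃ (k : ℕ) (n : ℤ) (x : Tensor), 1 ≤ n ∧ x ∈ tensorDeg n ∧
    y = (tensorD ^ k) x}

/-- The `T`-module `T / J`. -/
def TJ : Type := Tensor ⧸ vacIdeal

noncomputable instance : AddCommGroup TJ := inferInstanceAs (AddCommGroup (Tensor ⧸ vacIdeal))

noncomputable instance : Module Tensor TJ := inferInstanceAs (Module Tensor (Tensor ⧸ vacIdeal))

noncomputable instance : Module ℂ TJ := inferInstanceAs (Module ℂ (Tensor ⧸ vacIdeal))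

instance : IsScalarTower ℂ Tensor TJ := inferInstanceAs (IsScalarTower ℂ Tensor (Tensor ⧸ vacIdeal))

/-- The quotient map `T → T / J`. -/
noncomputable def TJ.mk : Tensor →ₗ[Tensor] TJ := vacIdeal.mkQ

/-- The submodule of `T / J` generated by all defining relations of `DY_q(sl₂)`. -/
noncomputable def relSubmodule (q : ℂ) : Submodule Tensor TJ :=
  Submodule.span Tensor {v | ∃ (r : DYRel) (m n : ℤ) (w : TJ),
    v = relDefect q (Algebra.lsmul ℂ ℂ TJ) r m n w}

/-- The `T`-module `V_q`, the quotient of `T / J` modulo all defining relations of `DY_q(sl₂)`. -/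
def Vq (q : ℂ) : Type := TJ ⧸ relSubmodule q

noncomputable instance (q : ℂ) : AddCommGroup (Vq q) :=
  inferInstanceAs (AddCommGroup (TJ ⧸ relSubmodule q))

noncomputable instance (q : ℂ) : Module Tensor (Vq q) :=
  inferInstanceAs (Module Tensor (TJ ⧸ relSubmodule q))

noncomputable instance (q : ℂ) : Module ℂ (Vq q) :=
  inferInstanceAs (Module ℂ (TJ ⧸ relSubmodule q))

instance (q : ℂ) : IsScalarTower ℂ Tensor (Vq q) :=
  inferInstanceAs (IsScalarTower ℂ Tensor (TJ ⧸ relSubmodule q))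

/-- The quotient map `T / J → V_q`. -/
noncomputable def Vq.mk (q : ℂ) : TJ →ₗ[Tensor] Vq q := (relSubmodule q).mkQ

/-- The action of `T` on `V_q`. -/
noncomputable def vqRep (q : ℂ) : Tensor →ₐ[ℂ] Module.End ℂ (Vq q) := Algebra.lsmul ℂ ℂ (Vq q)

/-- The vacuum vector of `V_q`, the image of `1`. -/
noncomputable def vqVac (q : ℂ) : Vq q := Vq.mk q (TJ.mk 1)

end DoubleYangian

open DoubleYangian

/-! The module `V` is universal for representations of `L(𝔤)` with a vector killed by `𝔤 ⊗ ℂ[t]`. On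
`V[t]` the fields `(t - x)ē(x)`, `(t - x)f̄(x)`, `(t - x)²h̄(x)` again satisfy the brackets of
`L(𝔤)`, because the delta function turns `(t - x₁)(t - x₂)` into `(t - x)²` (`twist_twist`,
`phiTwist_relation`). This produces `phi`. Its compatibility with all vertex operators follows by
induction from the identity `(t - x)(y - x)ᵖ - (y - x)ᵖ⁺¹ = (t - y)(y - x)ᵖ` (`phi_vertexOp`).
Conversely, the compatibility for the three generators prescribes how `Φ(t)` passes every mode,
which gives uniqueness (`IsPhi.eq_phi`).

For the relations, move `Φ(c + x₁)` to the right through `b̄(x₂)`. This costs a factor `c + x₁ - x₂`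
for odd `b̄` and its square for `h̄` (`mixed_mul_phiAt`, `mixed_mul_phiAt_h`). Every product
`a(x₁)b(x₂)` is thus a product of linear factors with `ā(x₁)b̄(x₂)Ψ_a(x₁)Ψ_b(x₂)`, called `core`,
where the series `Ψ` commute. The super-commutation of the loop fields then compares the two orders
of `core`, and the linear factors give the quotients of `DY_q(sl₂)`; denominators are cleared by
letting power series act on distributions with a finiteness property (`act_mul`, `act_exchange`). In
`[e(x₁), f(x₂)]` the factor `q + x₁ - x₂` meets a delta function and becomes `q`.

Spanning holds in any vacuum module. Since `q ≠ 0`, the exchange series have constant term `±1`, so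
modes commute up to a nonzero scalar, modulo words of smaller weight or smaller length
(`IsDYModule.isExchange`). A word can therefore be sorted, and a word with a repeated mode of `e` or
`f` is lower because the scalar there is `-1` (`IsExchange.mem_normal`). The length bound survives
all these moves, which gives the statement for each `Eₙ`.

Independence is proved for the loop superalgebra in a Fock space, an exterior algebra over a
polynomial ring, where normal monomials become distinct basis vectors
(`linearIndependent_loop_normal`). It passes to the new modes by triangularity: the constant term of
`Φ(c + x)` acts on a word by a power of `c`, up to smaller weight, so new and old words agree up to
a nonzero scalar and smaller weight (`wordVec_newOp_sub_mem`). The same triangularity shows that the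
vacuum generates `V`.

Finally `𝒟` implements the derivation `d` and kills the vacuum, and words of negative weight kill
the vacuum; hence `J` acts by zero on it and there is a homomorphism `ofVq` from `V_q` to `V` that
preserves normal monomials. Their independence in `V_q` follows from that in `V`. -/

namespace DoubleYangian

open Finset

/-! ### Polynomials with coefficients in a module -/

section PolyModule

variable {M M' M'' : Type} [AddCommGroup M] [Module ℂ M] [AddCommGroup M'] [Module ℂ M']
  [AddCommGroup M''] [Module ℂ M'']

/-- Multiplication by the variable on `M[x]`. -/
noncomputable def mulX : Module.End ℂ (ℕ →₀ M) := Finsupp.lmapDomain M ℂ (· + 1)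

/-- A linear map applied to the coefficients of a polynomial. -/
noncomputable def coeffMap (A : M →ₗ[ℂ] M') : (ℕ →₀ M) →ₗ[ℂ] (ℕ →₀ M') :=
  Finsupp.mapRange.linearMap A

@[simp] theorem mulX_single (k : ℕ) (v : M) :
    mulX (Finsupp.single k v) = Finsupp.single (k + 1) v := by
  simp [mulX, Finsupp.mapDomain_single]

@[simp] theorem coeffMap_single (A : M →ₗ[ℂ] M') (k : ℕ) (v : M) :
    coeffMap A (Finsupp.single k v) = Finsupp.single k (A v) := by
  simp [coeffMap]

theorem coeffMap_apply (A : M →ₗ[ℂ] M') (P : ℕ →₀ M) (k : ℕ) : coeffMap A P k = A (P k) := rfl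

theorem mulX_apply_zero (P : ℕ →₀ M) : mulX P 0 = 0 := by
  induction P using Finsupp.induction_linear with
  | zero => simp
  | add f g hf hg => simp [hf, hg]
  | single k v => simp

theorem mulX_apply_succ (P : ℕ →₀ M) (k : ℕ) : mulX P (k + 1) = P k := by
  induction P using Finsupp.induction_linear with
  | zero => simp
  | add f g hf hg => simp [hf, hg]
  | single j v => simp [Finsupp.single_apply]

theorem mulX_pow_single (i k : ℕ) (v : M) :
    (mulX ^ i) (Finsupp.single k v) = Finsupp.single (i + k) v := by
  induction i with
  | zero => simp
  | succ i ih => rw [pow_succ', Module.End.mul_apply, ih, mulX_single]; congr 1; omega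

theorem coeffMap_mulX (A : M →ₗ[ℂ] M') (P : ℕ →₀ M) : coeffMap A (mulX P) = mulX (coeffMap A P) := by
  induction P using Finsupp.induction_linear with
  | zero => simp
  | add f g hf hg => simp [hf, hg]
  | single k v => simp

theorem coeffMap_add (A B : M →ₗ[ℂ] M') (P : ℕ →₀ M) :
    coeffMap (A + B) P = coeffMap A P + coeffMap B P := by ext k; rfl

theorem coeffMap_smul (r : ℂ) (A : M →ₗ[ℂ] M') (P : ℕ →₀ M) :
    coeffMap (r • A) P = r • coeffMap A P := by ext k; rfl

theorem coeffMap_zero_left (P : ℕ →₀ M) : coeffMap (0 : M →ₗ[ℂ] M') P = 0 := by ext k; rfl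

end PolyModule

/-! ### The loop operators by matrix elements -/

theorem loopOp_odd (a b : Gen) (ha : a.parity = 1) (hb : b.parity = 1) (m n : ℤ) (w : VL) :
    loopOp a m (loopOp b n w) + loopOp b n (loopOp a m w) = structConst a b .h • loopOp .h (m + n) w := by
  rw [loopOp_loopOp, ha, hb]
  have : (univ : Finset Gen) = {.e, .f, .h} := rfl
  rw [this]
  cases a <;> cases b <;> simp [structConst, Gen.parity] at *

/-- As a bracket of odd modes, the even field needs no separate treatment in inductions over `V`. -/
theorem loopOp_h_eq (n : ℤ) (w : VL) :
    loopOp .h n w = loopOp .e n (loopOp .f 0 w) + loopOp .f 0 (loopOp .e n w) := by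
  rw [loopOp_odd .e .f rfl rfl]; simp [structConst]

theorem loopOp_h_comm (b : Gen) (m n : ℤ) (w : VL) :
    loopOp .h m (loopOp b n w) = loopOp b n (loopOp .h m w) := by
  rw [loopOp_loopOp]
  cases b <;> simp [structConst, Gen.parity]

/-- The space `V` is generated from the vacuum by the modes of the two odd fields. -/
theorem VL_induction_odd {C : VL → Prop} (h0 : C vac) (ha : ∀ v w, C v → C w → C (v + w))
    (hs : ∀ (r : ℂ) v, C v → C (r • v))
    (hg : ∀ a n v, a.parity = 1 → C v → C (loopOp a n v)) (v : VL) : C v := by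
  refine VL_induction h0 ha hs (fun a n v hv => ?_) v
  cases a
  · exact hg _ _ _ rfl hv
  · exact hg _ _ _ rfl hv
  · rw [loopOp_h_eq]
    exact ha _ _ (hg _ _ _ rfl (hg _ _ _ rfl hv)) (hg _ _ _ rfl (hg _ _ _ rfl hv))

/-! ### The map `Φ(t)` -/

/-- The operator `(t - S) ā(n)` on `V[t]`, with `S ā(n) = ā(n + 1)`; it is the coefficient of
`(t - x) ā(x)`. -/
noncomputable def twist (D : Module.End ℂ (ℕ →₀ VL)) (a : Gen) (n : ℤ) : Module.End ℂ (ℕ →₀ VL) :=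
  D * coeffMap (loopOp a n) - coeffMap (loopOp a (n + 1))

/-- The operator `(t - S)² h̄(n)` on `V[t]`. -/
noncomputable def twistTwo (D : Module.End ℂ (ℕ →₀ VL)) (a : Gen) (n : ℤ) :
    Module.End ℂ (ℕ →₀ VL) :=
  D * D * coeffMap (loopOp a n) - (2 : ℂ) • (D * coeffMap (loopOp a (n + 1)))
    + coeffMap (loopOp a (n + 2))

/-- The operator through which `Φ(t) ā(n)` factors over `Φ(t)`. -/
noncomputable def phiTwist (D : Module.End ℂ (ℕ →₀ VL)) : Gen → ℤ → Module.End ℂ (ℕ →₀ VL)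
  | .e => twist D .e
  | .f => twist D .f
  | .h => twistTwo D .h

theorem phiTwist_odd (D : Module.End ℂ (ℕ →₀ VL)) (a : Gen) (ha : a.parity = 1) :
    phiTwist D a = twist D a := by
  cases a
  · rfl
  · rfl
  · simp [Gen.parity] at ha

theorem coeffMap_loopOp_odd (a b : Gen) (ha : a.parity = 1) (hb : b.parity = 1) (m n : ℤ)
    (P : ℕ →₀ VL) : coeffMap (loopOp a m) (coeffMap (loopOp b n) P)
      = structConst a b .h • coeffMap (loopOp .h (m + n)) P
        - coeffMap (loopOp b n) (coeffMap (loopOp a m) P) := by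
  ext k
  exact eq_sub_of_add_eq (loopOp_odd a b ha hb m n (P k))

theorem coeffMap_loopOp_h_comm (b : Gen) (m n : ℤ) (P : ℕ →₀ VL) :
    coeffMap (loopOp .h m) (coeffMap (loopOp b n) P)
      = coeffMap (loopOp b n) (coeffMap (loopOp .h m) P) := by
  ext k
  exact loopOp_h_comm b m n (P k)

/-- The bracket contains a delta function in `x₁, x₂`, on which `(t - x₁)(t - x₂)` equals `(t -
x)²`. In modes, the four shifted brackets depend only on the sum of the indices and combine into a
square. -/
theorem twist_twist (a b : Gen) (ha : a.parity = 1) (hb : b.parity = 1) (m n : ℤ)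
    (D : Module.End ℂ (ℕ →₀ VL)) (hD : ∀ A : Module.End ℂ VL, ∀ P, coeffMap A (D P) = D (coeffMap A P))
    (P : ℕ →₀ VL) :
    twist D a m (twist D b n P) + twist D b n (twist D a m P)
      = structConst a b .h • twistTwo D .h (m + n) P := by
  simp only [twist, twistTwo, LinearMap.sub_apply, Module.End.mul_apply, map_sub, hD,
    LinearMap.add_apply, LinearMap.smul_apply, coeffMap_loopOp_odd a b ha hb, map_smul]
  rw [show m + 1 + (n + 1) = m + n + 2 by ring, show m + 1 + n = m + n + 1 by ring,
    show m + (n + 1) = m + n + 1 by ring]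
  module

/-- These are the relations needed to apply the universal property of `U(L(𝔤))`. Two odd fields are
handled by `twist_twist`; a product involving `h̄` needs only that `h̄` is central. -/
theorem phiTwist_relation (a b : Gen) (m n : ℤ) :
    phiTwist mulX a m * phiTwist mulX b n
      = (-1 : ℂ) ^ (a.parity * b.parity) • (phiTwist mulX b n * phiTwist mulX a m)
      + ∑ c : Gen, structConst a b c • phiTwist mulX c (m + n) := by
  have hu : (univ : Finset Gen) = {.e, .f, .h} := rfl
  have key : ∀ a b : Gen, a.parity = 1 → b.parity = 1 → phiTwist mulX a m * phiTwist mulX b n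
      = (-1 : ℂ) ^ (a.parity * b.parity) • (phiTwist mulX b n * phiTwist mulX a m)
      + structConst a b .h • phiTwist mulX .h (m + n) := by
    intro a b ha hb
    refine LinearMap.ext fun P => ?_
    rw [phiTwist_odd _ a ha, phiTwist_odd _ b hb, ha, hb]
    have := twist_twist a b ha hb m n mulX (fun A P => coeffMap_mulX A P) P
    simp only [Module.End.mul_apply, LinearMap.add_apply, LinearMap.smul_apply, phiTwist]
    rw [← this]
    module
  have hcomm : ∀ b, ∀ m n : ℤ, phiTwist mulX .h m * phiTwist mulX b n
      = phiTwist mulX b n * phiTwist mulX .h m := by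
    intro b m n
    refine LinearMap.ext fun P => ?_
    cases b <;>
    simp only [phiTwist, twist, twistTwo, LinearMap.sub_apply, Module.End.mul_apply, map_sub,
      coeffMap_mulX, LinearMap.add_apply, LinearMap.smul_apply, coeffMap_loopOp_h_comm .e,
      coeffMap_loopOp_h_comm .f, coeffMap_loopOp_h_comm .h, map_smul, map_add] <;> module
  rw [hu]
  cases a <;> cases b
  all_goals first
    | (rw [key _ _ rfl rfl]; simp [structConst])
    | (rw [hcomm]; simp [structConst, Gen.parity])

/-- The twist only raises mode indices, so non-negative modes stay annihilating. -/
theorem phiTwist_vac (a : Gen) (n : ℤ) (hn : 0 ≤ n) :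
    phiTwist mulX a n (Finsupp.single 0 vac) = 0 := by
  have h : ∀ a, ∀ m : ℤ, 0 ≤ m → loopOp a m vac = 0 := loopOp_vac
  cases a <;> simp [phiTwist, twist, twistTwo, h _ n hn, h _ (n + 1) (by omega),
    h _ (n + 2) (by omega)]

/-- The map `Φ(t)`. -/
noncomputable def phi : VL →ₗ[ℂ] (ℕ →₀ VL) :=
  liftVL (liftULoop (phiTwist mulX) phiTwist_relation) (Finsupp.single 0 vac) fun a n hn => by
    rw [liftULoop_ugen]; exact phiTwist_vac a n hn

theorem phi_vac : phi vac = Finsupp.single 0 vac := liftVL_vac _ _ _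

theorem phi_loopOp (a : Gen) (n : ℤ) (v : VL) : phi (loopOp a n v) = phiTwist mulX a n (phi v) := by
  rw [phi, liftVL_loopOp, liftULoop_ugen]

/-- Both terms of an odd twist carry the same parity sign. The statement is needed because `rightOp`
produces its sign by conjugation with the parity operator. -/
theorem coeffMap_parityOp_phi (v : VL) : phi (parityOp v) = coeffMap parityOp (phi v) := by
  induction v using VL_induction_odd with
  | h0 => simp [parityOp_vac, phi_vac]
  | ha v w hv hw => simp [hv, hw]
  | hs r v hv => simp [hv]
  | hg a n v ha hv =>
    have : ∀ n P, coeffMap parityOp (coeffMap (loopOp a n) P)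
        = (-1 : ℂ) ^ a.parity • coeffMap (loopOp a n) (coeffMap parityOp P) := by
      intro n P; ext k; exact parityOp_loopOp a n (P k)
    rw [parityOp_loopOp, map_smul, phi_loopOp, phi_loopOp, phiTwist_odd _ _ ha, hv]
    simp only [twist, LinearMap.sub_apply, Module.End.mul_apply, map_sub, coeffMap_mulX, this,
      map_smul]
    module

/-! ### Substitution of `t - x` and compatibility of `Φ(t)` with vertex operators -/

/-- The `x^{-n-1}`-coefficient of a field as a linear function of the field. -/
noncomputable def fieldCoeff (n : ℤ) : FieldSpace →ₗ[ℂ] Module.End ℂ (ℕ →₀ VL) where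
  toFun B := coeffMap (B.1 n)
  map_add' A B := LinearMap.ext fun P => coeffMap_add (A.1 n) (B.1 n) P
  map_smul' r B := LinearMap.ext fun P => coeffMap_smul r (B.1 n) P

/-- The coefficient of `x^{-n-1}` in `(t - x)ᵏ B(x)`. -/
noncomputable def substTerm : ℕ → ℤ → FieldSpace →ₗ[ℂ] Module.End ℂ (ℕ →₀ VL)
  | 0, n => fieldCoeff n
  | k + 1, n => LinearMap.mulLeft ℂ mulX ∘ₗ substTerm k n - substTerm k (n + 1)

/-- The coefficient of `x^{-n-1}` in `B(t - x, x)` for a polynomial `B(t, x)` in `t` with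
coefficients that are fields. -/
noncomputable def substField (n : ℤ) : (ℕ →₀ FieldSpace) →ₗ[ℂ] Module.End ℂ (ℕ →₀ VL) :=
  Finsupp.lsum ℂ fun k => substTerm k n

theorem substField_single (n : ℤ) (k : ℕ) (B : FieldSpace) :
    substField n (Finsupp.single k B) = substTerm k n B := by simp [substField]

theorem substTerm_succ (k : ℕ) (n : ℤ) (B : FieldSpace) :
    substTerm (k + 1) n B = mulX * substTerm k n B - substTerm k (n + 1) B := rfl

theorem substField_mulX (n : ℤ) (P : ℕ →₀ FieldSpace) :
    substField n (mulX P) = mulX * substField n P - substField (n + 1) P := by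
  induction P using Finsupp.induction_linear with
  | zero => simp
  | add f g hf hg => simp only [map_add, hf, hg, mul_add]; abel
  | single k B => rw [mulX_single]; simp only [substField_single]; rfl

theorem substTerm_apply_mulX (k : ℕ) (n : ℤ) (B : FieldSpace) (Q : ℕ →₀ VL) :
    substTerm k n B (mulX Q) = mulX (substTerm k n B Q) := by
  induction k generalizing n with
  | zero => exact coeffMap_mulX _ _
  | succ k ih => simp only [substTerm_succ, LinearMap.sub_apply, Module.End.mul_apply, ih, map_sub]

theorem substField_apply_mulX (n : ℤ) (P : ℕ →₀ FieldSpace) (Q : ℕ →₀ VL) :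
    substField n P (mulX Q) = mulX (substField n P Q) := by
  induction P using Finsupp.induction_linear with
  | zero => simp
  | add f g hf hg => simp [map_add, LinearMap.add_apply, hf, hg]
  | single k B => rw [substField_single, substTerm_apply_mulX]

/-- The recursive definition is multiplication by one factor `t - x` at a time, and Pascal's rule
turns it into the explicit binomial expansion used in `IsPhi`. -/
theorem substTerm_eq_sum (k : ℕ) (n : ℤ) (B : FieldSpace) (l : ℕ) (w : VL) :
    substTerm k n B (Finsupp.single l w) = ∑ i ∈ range (k + 1),
      Finsupp.single (k - i + l) (((-1 : ℂ) ^ i * (k.choose i : ℂ)) • B.1 (n + i) w) := by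
  induction k generalizing n with
  | zero => simp [substTerm, fieldCoeff]
  | succ k ih =>
    rw [substTerm_succ, LinearMap.sub_apply, Module.End.mul_apply, ih, ih, map_sum,
      Finset.sum_range_succ', Finset.sum_range_succ' _ (k + 1), Finset.sum_range_succ _ k]
    have h1 : ∀ i ∈ range k, (Finsupp.single (k + 1 - (i + 1) + l)
        (((-1 : ℂ) ^ (i + 1) * ((k + 1).choose (i + 1) : ℂ)) • B.1 (n + ((i + 1 : ℕ) : ℤ)) w))
        = mulX (Finsupp.single (k - (i + 1) + l)
          (((-1 : ℂ) ^ (i + 1) * (k.choose (i + 1) : ℂ)) • B.1 (n + ((i + 1 : ℕ) : ℤ)) w))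
          - Finsupp.single (k - i + l) (((-1 : ℂ) ^ i * (k.choose i : ℂ)) • B.1 (n + 1 + i) w) := by
      intro i hi
      have := Finset.mem_range.1 hi
      rw [mulX_single, show k - (i + 1) + l + 1 = k - i + l by omega,
        show k + 1 - (i + 1) + l = k - i + l by omega, ← Finsupp.single_sub,
        show n + 1 + (i : ℤ) = n + ((i + 1 : ℕ) : ℤ) by push_cast; ring, ← sub_smul,
        Nat.choose_succ_succ]
      congr 2
      push_cast
      ring
    rw [Finset.sum_range_succ _ k, Finset.sum_congr rfl h1, Finset.sum_sub_distrib]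
    simp only [mulX_single, Nat.choose_self, Nat.choose_zero_right, pow_zero, Nat.sub_self,
      Nat.sub_zero, Nat.cast_one, mul_one, one_smul, Nat.cast_zero, add_zero, zero_add]
    rw [show n + 1 + (k : ℤ) = n + ((k + 1 : ℕ) : ℤ) by push_cast; ring,
      show k + l + 1 = k + 1 + l by omega]
    have h2 : Finsupp.single l ((-1 : ℂ) ^ (k + 1) • B.1 (n + ((k + 1 : ℕ) : ℤ)) w)
        = - Finsupp.single l ((-1 : ℂ) ^ k • B.1 (n + ((k + 1 : ℕ) : ℤ)) w) := by
      rw [← Finsupp.single_neg, pow_succ]; congr 1; module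
    rw [h2]
    abel

theorem substField_apply_eq_sum (n : ℤ) (P Q : ℕ →₀ VL) :
    substField n (coeffMap vertexOp P) Q = P.sum fun k vk => Q.sum fun l wl =>
      ∑ i ∈ range (k + 1), Finsupp.single (k - i + l)
        (((-1 : ℂ) ^ i * (k.choose i : ℂ)) • (vertexOp vk).1 (n + i) wl) := by
  have h1 : ∀ (k : ℕ) (B : FieldSpace), substTerm k n B Q = Q.sum fun l wl =>
      ∑ i ∈ range (k + 1), Finsupp.single (k - i + l)
        (((-1 : ℂ) ^ i * (k.choose i : ℂ)) • B.1 (n + i) wl) := by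
    intro k B
    conv_lhs => rw [← Finsupp.sum_single Q]
    rw [map_finsuppSum]
    exact Finsupp.sum_congr fun l _ => substTerm_eq_sum k n B l (Q l)
  simp only [← h1]
  conv_lhs => rw [← Finsupp.sum_single P]
  rw [map_finsuppSum, map_finsuppSum]
  simp only [coeffMap_single, substField_single]
  simp [Finsupp.sum, LinearMap.sum_apply]

open Filter in
/-- A truncated form of `Res_y (y - x)ᵖ ā(y) B(t - x, x)`. -/
theorem substField_leftOp (a : Gen) (p n : ℤ) (P : ℕ →₀ FieldSpace) (Q : ℕ →₀ VL) :
    ∀ᶠ N : ℕ in atTop, substField n (coeffMap (leftOp a p) P) Q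
      = ∑ j ∈ range N, binCoeff p j • coeffMap (loopOp a (p - j)) (substField (n + j) P Q) := by
  induction P using Finsupp.induction_linear with
  | zero => simp
  | add f g hf hg =>
    filter_upwards [hf, hg] with N h1 h2
    simp only [map_add, LinearMap.add_apply, h1, h2, smul_add, sum_add_distrib]
  | single k B =>
    simp only [coeffMap_single, substField_single]
    induction k generalizing n with
    | zero =>
      induction Q using Finsupp.induction_linear with
      | zero => simp
      | add f g hf hg =>
        filter_upwards [hf, hg] with N h1 h2
        simp only [map_add, h1, h2, smul_add, sum_add_distrib]
      | single l w =>
        obtain ⟨K, hK⟩ := B.2 w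
        filter_upwards [eventually_ge_atTop (K - n).toNat] with N hN
        change coeffMap ((leftOp a p B).1 n) (Finsupp.single l w) = _
        rw [coeffMap_single, leftOp_apply a p n B w N fun j hj => hK _ (by omega),
          ← Finsupp.singleAddHom_apply, map_sum]
        refine sum_congr rfl fun j _ => ?_
        change _ = _ • coeffMap _ (coeffMap (B.1 (n + j)) (Finsupp.single l w))
        rw [coeffMap_single, coeffMap_single, Finsupp.smul_single]
        rfl
    | succ k ih =>
      filter_upwards [ih n, ih (n + 1)] with N h1 h2
      simp only [substTerm_succ, LinearMap.sub_apply, Module.End.mul_apply, h1, h2, map_sum,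
        ← sum_sub_distrib, map_sub, map_smul, coeffMap_mulX, smul_sub]
      refine sum_congr rfl fun j _ => ?_
      rw [show n + 1 + (j : ℤ) = n + j + 1 by ring]

open Filter in
/-- A truncated form of `(-1)^{|a||B|} Res_y (-x + y)ᵖ B(t - x, x) ā(y)`. -/
theorem substField_rightOp (a : Gen) (p n : ℤ) (P : ℕ →₀ FieldSpace) (Q : ℕ →₀ VL) :
    ∀ᶠ N : ℕ in atTop, substField n (coeffMap (rightOp a p) P) Q
      = (-1 : ℂ) ^ p • ∑ j ∈ range N, binCoeff p j • coeffMap (parityOp ^ a.parity)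
        (substField (n + p - j) P
          (coeffMap (parityOp ^ a.parity) (coeffMap (loopOp a j) Q))) := by
  induction P using Finsupp.induction_linear with
  | zero => simp
  | add f g hf hg =>
    filter_upwards [hf, hg] with N h1 h2
    simp only [map_add, LinearMap.add_apply, h1, h2, smul_add, sum_add_distrib]
  | single k B =>
    simp only [coeffMap_single, substField_single]
    induction k generalizing n with
    | zero =>
      induction Q using Finsupp.induction_linear with
      | zero => simp
      | add f g hf hg =>
        filter_upwards [hf, hg] with N h1 h2
        simp only [map_add, h1, h2, smul_add, sum_add_distrib]
      | single l w =>
        obtain ⟨K, hK⟩ := loopOp_trunc w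
        filter_upwards [eventually_ge_atTop K] with N hN
        change coeffMap ((rightOp a p B).1 n) (Finsupp.single l w) = _
        rw [coeffMap_single, rightOp_apply a p n B w N fun j hj => hK _ _ (by omega),
          ← Finsupp.smul_single]
        rw [← Finsupp.singleAddHom_apply, map_sum]
        refine congrArg _ (sum_congr rfl fun j _ => ?_)
        change _ = _ • coeffMap _ (coeffMap (B.1 (n + p - j)) (coeffMap _ (coeffMap _ (Finsupp.single l w))))
        simp only [coeffMap_single, Finsupp.smul_single]
        rfl
    | succ k ih =>
      filter_upwards [ih n, ih (n + 1)] with N h1 h2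
      simp only [substTerm_succ, LinearMap.sub_apply, Module.End.mul_apply, h1, h2, map_sum,
        ← sum_sub_distrib, map_sub, map_smul, coeffMap_mulX, ← smul_sub]
      refine congrArg _ (sum_congr rfl fun j _ => ?_)
      rw [show n + 1 + p - (j : ℤ) = n + p - j + 1 by ring]

theorem binCoeff_succ (p : ℤ) (j : ℕ) :
    binCoeff p (j + 1) = binCoeff (p + 1) (j + 1) + binCoeff p j := by
  simp only [binCoeff, Ring.choose_succ_succ]
  push_cast
  ring

theorem binCoeff_zero (p : ℤ) : binCoeff p 0 = 1 := by simp [binCoeff]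

/-- This is `y(y - x)ᵖ = (y - x)ᵖ⁺¹ + x(y - x)ᵖ` on coefficients. The last sum has one term fewer
because multiplication by `x` shifts its index. -/
theorem sum_binCoeff_succ {M : Type} [AddCommGroup M] [Module ℂ M] (p : ℤ) (G : ℕ → M) (N : ℕ) :
    ∑ j ∈ range (N + 1), binCoeff p j • G j
      = ∑ j ∈ range (N + 1), binCoeff (p + 1) j • G j + ∑ j ∈ range N, binCoeff p j • G (j + 1) := by
  rw [sum_range_succ', sum_range_succ']
  rw [sum_congr rfl fun j _ => by rw [binCoeff_succ p j, add_smul], sum_add_distrib,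
    binCoeff_zero, binCoeff_zero]
  abel

-- Induction on `v` through odd modes. Commuting `Φ(t)` past `ā(y)` inside the residue for the
-- `p`-th product gives a factor `t - y`, while the twist of `ā(p)v` gives `(t - x)(y - x)ᵖ - (y -
-- x)ᵖ⁺¹`; the two agree. The parts with `ā(y)` on the left and on the right of the field are
-- compared separately.
open Filter in
theorem phi_vertexOp (v w : VL) (n : ℤ) :
    phi ((vertexOp v).1 n w) = substField n (coeffMap vertexOp (phi v)) (phi w) := by
  induction v using VL_induction_odd generalizing w n with
  | h0 =>
    rw [vertexOp_vac, phi_vac, coeffMap_single, substField_single, vertexOp_vac]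
    change phi ((if n = -1 then 1 else 0 : Module.End ℂ VL) w)
      = coeffMap (if n = -1 then 1 else 0 : Module.End ℂ VL) (phi w)
    split_ifs
    · ext k; rfl
    · simp [coeffMap_zero_left]
  | ha v v' hv hv' => simp [hv, hv']
  | hs r v hv => simp [hv]
  | hg a p v ha hv =>
    obtain ⟨K, hK⟩ := (vertexOp v).2 w
    obtain ⟨K', hK'⟩ := loopOp_trunc w
    have hY : ∀ s : ℤ, coeffMap vertexOp (coeffMap (loopOp a s) (phi v))
        = coeffMap (leftOp a s) (coeffMap vertexOp (phi v))
          - coeffMap (rightOp a s) (coeffMap vertexOp (phi v)) := by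
      intro s
      ext k : 1
      exact vertexOp_loopOp a s (phi v k)
    set C := coeffMap vertexOp (phi v) with hC
    -- One truncation serves all residues. The lengths `N` and `N + 1` are distributed so that they
    -- match the ranges in `sum_binCoeff_succ`, on the left for `G` built from `ā(p + 1 - j)` and on
    -- the right for `G` built from `ā(j)`.
    obtain ⟨N, h0, hL0, hR0, hL1, hR1, hL2, hR2⟩ :=
      ((eventually_ge_atTop ((K - n).toNat + K')).and <|
      ((tendsto_add_atTop_nat 1).eventually (substField_leftOp a p n C (phi w))).and <|
      (substField_rightOp a p n C (phi w)).and <|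
      (substField_leftOp a p (n + 1) C (phi w)).and <|
      ((tendsto_add_atTop_nat 1).eventually (substField_rightOp a p (n + 1) C (phi w))).and <|
      ((tendsto_add_atTop_nat 1).eventually (substField_leftOp a (p + 1) n C (phi w))).and <|
      ((tendsto_add_atTop_nat 1).eventually (substField_rightOp a (p + 1) n C (phi w)))).exists
    have hpar : ∀ u : VL, phi ((parityOp ^ a.parity) u) = coeffMap (parityOp ^ a.parity) (phi u) := by
      intro u; rw [ha, pow_one]; exact coeffMap_parityOp_phi u
    have hL := sum_binCoeff_succ p
      (fun j : ℕ => coeffMap (loopOp a (p + 1 - j)) (substField (n + j) C (phi w))) N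
    have hR := sum_binCoeff_succ p (fun j : ℕ => coeffMap (parityOp ^ a.parity)
        (substField (n + p + 1 - j) C
          (coeffMap (parityOp ^ a.parity) (coeffMap (loopOp a j) (phi w))))) N
    have e : ((vertexOp (loopOp a p v)).1 n) w
        = (leftOp a p (vertexOp v)).1 n w - (rightOp a p (vertexOp v)).1 n w := by
      rw [vertexOp_loopOp]; rfl
    rw [e, leftOp_apply a p n _ w (N + 1) fun j hj => hK _ (by omega),
      rightOp_apply a p n _ w N fun j hj => hK' _ _ (by omega), phi_loopOp, phiTwist_odd _ _ ha]
    simp only [twist, LinearMap.sub_apply, Module.End.mul_apply, map_sub, coeffMap_mulX, hY,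
      substField_mulX, map_sum, map_smul, phi_loopOp, phiTwist_odd _ _ ha, hv, hpar,
      substField_apply_mulX, smul_sub, sum_sub_distrib]
    rw [map_sub (substField n), LinearMap.sub_apply, hL0, hR0, hL1, hR1, hL2, hR2]
    simp only [map_sum, map_smul]
    have e1 : ∀ j : ℕ, coeffMap (loopOp a (p - j + 1)) (substField (n + j) C (phi w))
      = coeffMap (loopOp a (p + 1 - j)) (substField (n + j) C (phi w)) := fun j => by
        rw [show p - (j : ℤ) + 1 = p + 1 - j by ring]
    have e2 : ∀ j : ℕ, coeffMap (loopOp a (p - j)) (substField (n + 1 + j) C (phi w))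
      = coeffMap (loopOp a (p + 1 - (j + 1 : ℕ))) (substField (n + (j + 1 : ℕ)) C (phi w)) :=
      fun j => by
        rw [show p + 1 - ((j + 1 : ℕ) : ℤ) = p - j by push_cast; ring,
          show n + ((j + 1 : ℕ) : ℤ) = n + 1 + j by push_cast; ring]
    have e3 : ∀ j : ℕ, coeffMap (parityOp ^ a.parity) (substField (n + p - j) C
        (coeffMap (parityOp ^ a.parity) (coeffMap (loopOp a (j + 1)) (phi w))))
      = coeffMap (parityOp ^ a.parity) (substField (n + p + 1 - (j + 1 : ℕ)) C
        (coeffMap (parityOp ^ a.parity) (coeffMap (loopOp a ((j + 1 : ℕ) : ℤ)) (phi w)))) :=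
      fun j => by
        rw [show n + p + 1 - ((j + 1 : ℕ) : ℤ) = n + p - j by push_cast; ring]
        push_cast; rfl
    have e4 : ∀ j : ℕ, n + 1 + p - (j : ℤ) = n + p + 1 - j := fun j => by ring
    have e5 : ∀ j : ℕ, n + (p + 1) - (j : ℤ) = n + p + 1 - j := fun j => by ring
    simp only [e1, e2, e3, e4, e5]
    -- In the right-hand parts the prefactor changes from `(-1)ᵖ` to `(-1)ᵖ⁺¹`, so the same
    -- recursion is used there with two of its terms interchanged.
    rw [hL, zpow_add_one₀ (by norm_num)]
    rw [← sub_eq_iff_eq_add'] at hR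
    rw [← hR]
    module

theorem isPhi_phi : IsPhi phi where
  map_vac := phi_vac
  map_e := by
    rw [phi_loopOp, phi_vac]; simp [phiTwist, twist, loopOp_vac]
  map_f := by
    rw [phi_loopOp, phi_vac]; simp [phiTwist, twist, loopOp_vac]
  map_h := by
    rw [phi_loopOp, phi_vac]; simp [phiTwist, twistTwo, loopOp_vac]
  map_vertexOp v w n := by rw [phi_vertexOp, substField_apply_eq_sum]

/-- The compatibility with `Y(ā(-1)𝟏, x) = ā(x)` already determines how `Φ(t)` passes each mode,
since the values of `Φ(t)` on the generators are prescribed. Uniqueness then follows because these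
modes generate `V` from the vacuum. -/
theorem IsPhi.map_loopOp {Φ : VL →ₗ[ℂ] (ℕ →₀ VL)} (h : IsPhi Φ) (a : Gen) (n : ℤ) (w : VL) :
    Φ (loopOp a n w) = phiTwist mulX a n (Φ w) := by
  have key : Φ (loopOp a n w)
      = substField n (coeffMap vertexOp (Φ (loopOp a (-1) vac))) (Φ w) := by
    rw [substField_apply_eq_sum, ← h.map_vertexOp, vertexOp_gen]
  have hv : ∀ m, coeffMap ((vertexOp (loopOp a (-1) vac)).1 m) = coeffMap (loopOp a m) := fun m => by
    rw [vertexOp_gen]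
  rw [key]
  cases a
  · rw [h.map_e, coeffMap_single, substField_single, substTerm_succ, phiTwist, twist, ← hv, ← hv]
    rfl
  · rw [h.map_f, coeffMap_single, substField_single, substTerm_succ, phiTwist, twist, ← hv, ← hv]
    rfl
  · rw [h.map_h, coeffMap_single, substField_single, substTerm_succ, substTerm_succ, substTerm_succ,
      phiTwist, twistTwo, ← hv, ← hv, ← hv]
    simp only [LinearMap.sub_apply, LinearMap.add_apply, LinearMap.smul_apply,
      Module.End.mul_apply, map_sub, substTerm, fieldCoeff, LinearMap.coe_mk, AddHom.coe_mk,
      show n + 1 + 1 = n + 2 by ring]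
    module

theorem IsPhi.eq_phi {Φ : VL →ₗ[ℂ] (ℕ →₀ VL)} (h : IsPhi Φ) : Φ = phi := by
  refine LinearMap.ext fun v => ?_
  induction v using VL_induction with
  | h0 => rw [h.map_vac, phi_vac]
  | ha v w hv hw => rw [map_add, map_add, hv, hw]
  | hs r v hv => rw [map_smul, map_smul, hv]
  | hg a n v hv => rw [h.map_loopOp, phi_loopOp, hv]

/-! ### Words in the modes of quadratically related fields -/

section Words

variable {W : Type*} [AddCommGroup W] [Module ℂ W]

/-- The vector `u⁽¹⁾(m₁) ⋯ u⁽ʳ⁾(mᵣ) w₀`. -/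
def wordVec (A : Gen → ℤ → Module.End ℂ W) (w₀ : W) (L : List (Gen × ℤ)) : W :=
  L.foldr (fun p v => A p.1 p.2 v) w₀

/-- The conformal weight of a word. -/
def wordWt (L : List (Gen × ℤ)) : ℤ := -(L.map Prod.snd).sum

/-- All modes of the word are creation modes. -/
def IsNegWord (L : List (Gen × ℤ)) : Prop := ∀ p ∈ L, p.2 < 0

@[simp] theorem wordVec_nil (A : Gen → ℤ → Module.End ℂ W) (w₀ : W) : wordVec A w₀ [] = w₀ := rfl

@[simp] theorem wordVec_cons (A : Gen → ℤ → Module.End ℂ W) (w₀ : W) (p : Gen × ℤ)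
    (L : List (Gen × ℤ)) : wordVec A w₀ (p :: L) = A p.1 p.2 (wordVec A w₀ L) := rfl

@[simp] theorem wordWt_nil : wordWt [] = 0 := rfl

@[simp] theorem wordWt_cons (p : Gen × ℤ) (L : List (Gen × ℤ)) :
    wordWt (p :: L) = wordWt L - p.2 := by simp [wordWt]; ring

theorem wordWt_perm {L L' : List (Gen × ℤ)} (h : L.Perm L') : wordWt L = wordWt L' := by
  rw [wordWt, wordWt, (h.map Prod.snd).sum_eq]

theorem IsNegWord.of_cons {p : Gen × ℤ} {L : List (Gen × ℤ)} (h : IsNegWord (p :: L)) :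
    IsNegWord L := fun x hx => h x (List.mem_cons_of_mem _ hx)

theorem IsNegWord.cons {p : Gen × ℤ} {L : List (Gen × ℤ)} (hp : p.2 < 0) (h : IsNegWord L) :
    IsNegWord (p :: L) := fun x hx => by
  rcases List.mem_cons.1 hx with rfl | hx
  · exact hp
  · exact h x hx

theorem IsNegWord.length_le {L : List (Gen × ℤ)} (h : IsNegWord L) : (L.length : ℤ) ≤ wordWt L := by
  induction L with
  | nil => simp
  | cons p L ih =>
    have := h p (by simp)
    have := ih h.of_cons
    rw [wordWt_cons, List.length_cons]
    push_cast
    omega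

/-- The correction terms in the exchange of `a(m)` and `b(n)`. -/
def lowerTerms (A : Gen → ℤ → Module.End ℂ W) (a b : Gen) (m n : ℤ) (w : W) : Submodule ℂ W :=
  Submodule.span ℂ ({x | ∃ i j : ℕ, 0 < i + j ∧ x = A b (n + j) (A a (m + i) w)}
    ∪ {A .h (m + n) w})

/-- A system of fields which commute up to nonzero scalars `ε` and lower terms, with a vacuum
vector. -/
structure IsExchange (A : Gen → ℤ → Module.End ℂ W) (w₀ : W) (ε : Gen → Gen → ℂ) : Prop where
  rel : ∀ a b m n w, A a m (A b n w) - ε a b • A b n (A a m w) ∈ lowerTerms A a b m n w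
  vac : ∀ a n, 0 ≤ n → A a n w₀ = 0
  ne_zero : ∀ a b, ε a b ≠ 0
  odd_e : ε .e .e = -1
  odd_f : ε .f .f = -1

/-- The span of the words in creation modes of length at most `r` and weight at most `N`. -/
def wordFil (A : Gen → ℤ → Module.End ℂ W) (w₀ : W) (r N : ℤ) : Submodule ℂ W :=
  Submodule.span ℂ {v | ∃ L, IsNegWord L ∧ (L.length : ℤ) ≤ r ∧ wordWt L ≤ N ∧ v = wordVec A w₀ L}

variable {A : Gen → ℤ → Module.End ℂ W} {w₀ : W} {ε : Gen → Gen → ℂ}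

theorem wordVec_mem_wordFil {L : List (Gen × ℤ)} (hL : IsNegWord L) {r N : ℤ}
    (hr : (L.length : ℤ) ≤ r) (hN : wordWt L ≤ N) : wordVec A w₀ L ∈ wordFil A w₀ r N :=
  Submodule.subset_span ⟨L, hL, hr, hN, rfl⟩

theorem wordFil_mono {r r' N N' : ℤ} (hr : r ≤ r') (hN : N ≤ N') :
    wordFil A w₀ r N ≤ wordFil A w₀ r' N' := by
  refine Submodule.span_mono ?_
  rintro _ ⟨L, h1, h2, h3, rfl⟩
  exact ⟨L, h1, h2.trans hr, h3.trans hN, rfl⟩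

theorem wordFil_neg {r N : ℤ} (hN : N < 0) : wordFil A w₀ r N = ⊥ := by
  rw [wordFil, Submodule.span_eq_bot]
  rintro _ ⟨L, h1, h2, h3, rfl⟩
  have := h1.length_le
  omega

/-- A creation mode just lengthens the word. A mode with `m ≥ 0` is exchanged with the first letter
`b(n)`; as `n < 0`, the remaining word has smaller weight, so the main term and all corrections are
covered by induction on the weight. The induction starts because words in creation modes have
non-negative weight. -/
theorem IsExchange.map_wordFil (h : IsExchange A w₀ ε) (k : ℕ) :
    ∀ N : ℤ, N < k → ∀ (r : ℤ) (a : Gen) (m : ℤ), ∀ v ∈ wordFil A w₀ r N,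
      A a m v ∈ wordFil A w₀ (r + 1) (N - m) := by
  induction k with
  | zero =>
    intro N hN r a m v hv
    rw [wordFil_neg (by exact_mod_cast hN), Submodule.mem_bot] at hv
    rw [hv, map_zero]; exact Submodule.zero_mem _
  | succ k ih =>
    intro N hN r a m v hv
    push_cast at hN
    induction hv using Submodule.span_induction with
    | zero => rw [map_zero]; exact Submodule.zero_mem _
    | add x y _ _ hx hy => rw [map_add]; exact Submodule.add_mem _ hx hy
    | smul c x _ hx => rw [map_smul]; exact Submodule.smul_mem _ _ hx
    | mem v hv =>
      obtain ⟨L, hneg, hlen, hwt, rfl⟩ := hv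
      rcases lt_or_ge m 0 with hm | hm
      · rw [← wordVec_cons A w₀ (a, m) L]
        exact wordVec_mem_wordFil (hneg.cons hm) (by simp; omega) (by simp; omega)
      · cases L with
        | nil => rw [wordVec_nil, h.vac a m hm]; exact Submodule.zero_mem _
        | cons p L =>
          obtain ⟨b, n⟩ := p
          have hn : n < 0 := hneg (b, n) (by simp)
          simp only [List.length_cons, wordWt_cons, wordVec_cons] at hlen hwt ⊢
          push_cast at hlen
          have hw : wordVec A w₀ L ∈ wordFil A w₀ (r - 1) (N + n) :=
            wordVec_mem_wordFil hneg.of_cons (by omega) (by omega)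
          have hba : ∀ i j : ℕ, A b (n + j) (A a (m + i) (wordVec A w₀ L))
              ∈ wordFil A w₀ (r + 1) (N - m - i - j) := by
            intro i j
            have h1 := ih (N + n) (by omega) (r - 1) a (m + i) _ hw
            rw [sub_add_cancel] at h1
            have h2 := ih (N + n - (m + i)) (by omega) r b (n + j) _ h1
            exact wordFil_mono le_rfl (by omega) h2
          have hlow : lowerTerms A a b m n (wordVec A w₀ L) ≤ wordFil A w₀ (r + 1) (N - m) := by
            rw [lowerTerms, Submodule.span_le]
            rintro _ (⟨i, j, _, rfl⟩ | rfl)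
            · exact wordFil_mono le_rfl (by omega) (hba i j)
            · have := ih (N + n) (by omega) (r - 1) .h (m + n) _ hw
              exact wordFil_mono (by omega) (by omega) this
          have h1 := hlow (h.rel a b m n (wordVec A w₀ L))
          have h2 := hba 0 0
          simp only [Nat.cast_zero, add_zero, sub_zero] at h2
          rw [← sub_add_cancel (A a m (A b n (wordVec A w₀ L)))
            (ε a b • A b n (A a m (wordVec A w₀ L)))]
          exact Submodule.add_mem _ h1 (Submodule.smul_mem _ _ h2)

theorem IsExchange.apply_mem (h : IsExchange A w₀ ε) {r N : ℤ} (a : Gen) (m : ℤ) {v : W}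
    (hv : v ∈ wordFil A w₀ r N) : A a m v ∈ wordFil A w₀ (r + 1) (N - m) :=
  h.map_wordFil (N.toNat + 1) N (by push_cast; omega) r a m v hv

theorem IsExchange.wordVec_mem (h : IsExchange A w₀ ε) (L : List (Gen × ℤ)) :
    wordVec A w₀ L ∈ wordFil A w₀ L.length (wordWt L) := by
  induction L with
  | nil => exact wordVec_mem_wordFil (fun _ h => by simp at h) le_rfl le_rfl
  | cons p L ih =>
    have := h.apply_mem p.1 p.2 ih
    simpa using this

/-- Words of negative weight vanish. -/
theorem IsExchange.wordVec_eq_zero (h : IsExchange A w₀ ε) {L : List (Gen × ℤ)}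
    (hL : wordWt L < 0) : wordVec A w₀ L = 0 := by
  have := h.wordVec_mem L
  rwa [wordFil_neg hL, Submodule.mem_bot] at this

/-- The words which are shorter or of lower weight. -/
def lowFil (A : Gen → ℤ → Module.End ℂ W) (w₀ : W) (r N : ℤ) : Submodule ℂ W :=
  wordFil A w₀ r (N - 1) ⊔ wordFil A w₀ (r - 1) N

theorem IsExchange.apply_mem_lowFil (h : IsExchange A w₀ ε) {r N : ℤ} (a : Gen) (m : ℤ) {v : W}
    (hv : v ∈ lowFil A w₀ r N) : A a m v ∈ lowFil A w₀ (r + 1) (N - m) := by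
  obtain ⟨x, hx, y, hy, rfl⟩ := Submodule.mem_sup.1 hv
  rw [map_add]
  refine Submodule.add_mem _ (Submodule.mem_sup_left ?_) (Submodule.mem_sup_right ?_)
  · exact wordFil_mono le_rfl (by omega) (h.apply_mem a m hx)
  · exact wordFil_mono (by omega) le_rfl (h.apply_mem a m hy)

/-- In a correction term either some mode index is raised, which lowers the weight, or two letters
are merged into one mode of `h`, which lowers the length. -/
theorem IsExchange.swap_mem (h : IsExchange A w₀ ε) (a b : Gen) (m n : ℤ) (L : List (Gen × ℤ)) :
    wordVec A w₀ ((a, m) :: (b, n) :: L) - ε a b • wordVec A w₀ ((b, n) :: (a, m) :: L)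
      ∈ lowFil A w₀ (L.length + 2) (wordWt L - n - m) := by
  refine (?_ : lowerTerms A a b m n (wordVec A w₀ L) ≤ _) (h.rel a b m n _)
  rw [lowerTerms, Submodule.span_le]
  rintro _ (⟨i, j, hij, rfl⟩ | rfl)
  · refine Submodule.mem_sup_left ?_
    have := h.apply_mem b (n + j) (h.apply_mem a (m + i) (h.wordVec_mem L))
    exact wordFil_mono (by omega) (by omega) this
  · refine Submodule.mem_sup_right ?_
    have := h.apply_mem .h (m + n) (h.wordVec_mem L)
    exact wordFil_mono (by omega) (by omega) this

/-- Adjacent transpositions suffice, since lower terms stay lower when a letter is put in front of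
them. The scalars multiply and remain nonzero. -/
theorem IsExchange.perm_mem (h : IsExchange A w₀ ε) {L L' : List (Gen × ℤ)} (hp : L.Perm L') :
    ∃ c : ℂ, c ≠ 0 ∧ wordVec A w₀ L - c • wordVec A w₀ L' ∈ lowFil A w₀ L.length (wordWt L) := by
  induction hp with
  | nil => exact ⟨1, one_ne_zero, by simp⟩
  | cons p hp ih =>
    obtain ⟨c, hc, hm⟩ := ih
    refine ⟨c, hc, ?_⟩
    have := h.apply_mem_lowFil p.1 p.2 hm
    simpa using this
  | swap x y l =>
    refine ⟨ε y.1 x.1, h.ne_zero _ _, ?_⟩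
    have := h.swap_mem y.1 x.1 y.2 x.2 l
    simpa [add_assoc] using this
  | trans hp hp' ih ih' =>
    obtain ⟨c, hc, hm⟩ := ih
    obtain ⟨c', hc', hm'⟩ := ih'
    refine ⟨c * c', mul_ne_zero hc hc', ?_⟩
    rw [← hp.length_eq, ← wordWt_perm hp] at hm'
    have := Submodule.add_mem _ hm (Submodule.smul_mem _ c hm')
    rwa [smul_sub, smul_smul, sub_add_sub_cancel] at this

/-- Exchanging two equal letters `e` or `f` gives the same word with scalar `-1`, so twice the word
is a lower term. -/
theorem IsExchange.dup_mem (h : IsExchange A w₀ ε) (p : Gen × ℤ) (hp : p.1 ≠ .h)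
    (L : List (Gen × ℤ)) :
    wordVec A w₀ (p :: p :: L) ∈ lowFil A w₀ (p :: p :: L).length (wordWt (p :: p :: L)) := by
  have := h.swap_mem p.1 p.1 p.2 p.2 L
  have hε : ε p.1 p.1 = -1 := by
    obtain ⟨a, m⟩ := p
    cases a
    · exact h.odd_e
    · exact h.odd_f
    · exact absurd rfl hp
  rw [hε] at this
  have h2 := Submodule.smul_mem _ (2⁻¹ : ℂ) this
  have e : (2⁻¹ : ℂ) • (wordVec A w₀ (p :: p :: L) - (-1 : ℂ) • wordVec A w₀ (p :: p :: L))
      = wordVec A w₀ (p :: p :: L) := by module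
  rw [e] at h2
  simpa [add_assoc] using h2

/-! ### Sorting words into normal monomials -/

/-- The word of a normal monomial. -/
def normalWord (p : List ℕ × List ℕ × List ℕ) : List (Gen × ℤ) :=
  p.1.map (fun m : ℕ => (Gen.e, -(m : ℤ))) ++ (p.2.1.map (fun m : ℕ => (Gen.f, -(m : ℤ)))
    ++ p.2.2.map (fun k : ℕ => (Gen.h, -(k : ℤ))))

/-- The index sequences of normal monomials. -/
def IsNormal (p : List ℕ × List ℕ × List ℕ) : Prop :=
  p.1.Pairwise (· > ·) ∧ p.2.1.Pairwise (· > ·) ∧ p.2.2.Pairwise (· ≥ ·) ∧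
    (∀ m ∈ p.1, 1 ≤ m) ∧ (∀ m ∈ p.2.1, 1 ≤ m) ∧ (∀ k ∈ p.2.2, 1 ≤ k)

theorem mem_normalIndex {n : ℕ} {p : List ℕ × List ℕ × List ℕ} :
    p ∈ normalIndex n ↔ IsNormal p ∧ (normalWord p).length ≤ n := by
  simp only [normalIndex, IsNormal, normalWord, Set.mem_ofPred_eq, List.length_append,
    List.length_map, ← add_assoc, and_assoc]

/-- The indices of the letters `g(-m)` of a word, in descending order. -/
def letterIndices (g : Gen) (L : List (Gen × ℤ)) : List ℕ :=
  ((L.filter (·.1 = g)).map fun p => (-p.2).toNat).insertionSort (· ≥ ·)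

theorem letterIndices_map {L : List (Gen × ℤ)} (hL : IsNegWord L) (g : Gen) :
    ((letterIndices g L).map fun m : ℕ => (g, -(m : ℤ))).Perm (L.filter (·.1 = g)) := by
  refine ((List.perm_insertionSort _ _).map _).trans (List.Perm.of_eq ?_)
  rw [List.map_map]
  refine (List.map_congr_left fun p hp => ?_).trans (List.map_id _)
  obtain ⟨hp, hg⟩ := List.mem_filter.1 hp
  have := hL p hp
  have hg : p.1 = g := by simpa using hg
  refine Prod.ext hg.symm ?_
  simp only [Function.comp_apply, id]
  omega

theorem letterIndices_pos {L : List (Gen × ℤ)} (hL : IsNegWord L) (g : Gen) :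
    ∀ m ∈ letterIndices g L, 1 ≤ m := by
  intro m hm
  rw [letterIndices, List.mem_insertionSort, List.mem_map] at hm
  obtain ⟨p, hp, rfl⟩ := hm
  have := hL p (List.mem_filter.1 hp).1
  omega

theorem letterIndices_sorted (L : List (Gen × ℤ)) (g : Gen) :
    (letterIndices g L).Pairwise (· ≥ ·) := List.pairwise_insertionSort _ _

theorem letterIndices_strict {L : List (Gen × ℤ)} (hL : IsNegWord L) (g : Gen)
    (hd : ∀ p : Gen × ℤ, p.1 = g → L.count p ≤ 1) : (letterIndices g L).Pairwise (· > ·) := by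
  have h1 : (L.filter (·.1 = g)).Nodup := by
    rw [List.nodup_iff_count_le_one]
    intro p
    by_cases hp : p.1 = g
    · rw [List.count_filter (by simpa using hp)]; exact hd p hp
    · rw [List.count_eq_zero_of_not_mem (fun h => hp (by simpa using (List.mem_filter.1 h).2))]
      exact Nat.zero_le _
  have h2 : (letterIndices g L).Nodup := ((letterIndices_map hL g).nodup_iff.2 h1).of_map _
  exact ((letterIndices_sorted L g).and h2).imp fun {a b} h => lt_of_le_of_ne h.1 (Ne.symm h.2)

/-- A word in creation modes in which no odd mode is repeated can be sorted. -/
theorem exists_normal_perm {L : List (Gen × ℤ)} (hL : IsNegWord L)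
    (hd : ∀ p : Gen × ℤ, p.1 ≠ .h → L.count p ≤ 1) :
    ∃ p, IsNormal p ∧ L.Perm (normalWord p) := by
  refine ⟨(letterIndices .e L, letterIndices .f L, letterIndices .h L),
    ⟨letterIndices_strict hL _ fun p hp => hd p (by simp [hp]),
      letterIndices_strict hL _ fun p hp => hd p (by simp [hp]), letterIndices_sorted L _,
      letterIndices_pos hL _, letterIndices_pos hL _, letterIndices_pos hL _⟩, ?_⟩
  refine List.Perm.trans ?_ ((letterIndices_map hL .e).append
    ((letterIndices_map hL .f).append (letterIndices_map hL .h))).symm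
  clear hd hL
  rw [List.perm_iff_count]
  intro p
  simp only [List.count_append]
  obtain ⟨a, m⟩ := p
  have h0 : ∀ g, g ≠ a → (L.filter (·.1 = g)).count (a, m) = 0 := fun g hg =>
    List.count_eq_zero_of_not_mem fun h => hg (by simpa using (List.mem_filter.1 h).2 : a = g).symm
  have h1 : (L.filter (·.1 = a)).count (a, m) = L.count (a, m) := List.count_filter (by simp)
  cases a
  · rw [h1, h0 .f (by simp), h0 .h (by simp)]; omega
  · rw [h1, h0 .e (by simp), h0 .h (by simp)]; omega
  · rw [h1, h0 .e (by simp), h0 .f (by simp)]; omega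

/-- Induction on `r + N`, which drops whenever the length or the weight drops. A word without
repeated odd letters is sorted by a permutation, and any other word is itself a lower term. -/
theorem IsExchange.mem_normal (h : IsExchange A w₀ ε) (k : ℕ) :
    ∀ r N : ℤ, r + N < k → wordFil A w₀ r N ≤ Submodule.span ℂ
      {v | ∃ p, IsNormal p ∧ ((normalWord p).length : ℤ) ≤ r ∧ wordWt (normalWord p) ≤ N
        ∧ v = wordVec A w₀ (normalWord p)} := by
  induction k with
  | zero =>
    intro r N hk
    refine Submodule.span_le.2 ?_
    rintro _ ⟨L, hneg, hlen, hwt, rfl⟩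
    have := hneg.length_le
    push_cast at hk
    omega
  | succ k ih =>
    intro r N hk
    push_cast at hk
    refine Submodule.span_le.2 ?_
    rintro _ ⟨L, hneg, hlen, hwt, rfl⟩
    set S := Submodule.span ℂ {v | ∃ p, IsNormal p ∧ ((normalWord p).length : ℤ) ≤ r ∧
      wordWt (normalWord p) ≤ N ∧ v = wordVec A w₀ (normalWord p)} with hS
    have hmono : ∀ r' N' : ℤ, r' ≤ r → N' ≤ N → r' + N' < k → wordFil A w₀ r' N' ≤ S := by
      intro r' N' hr hN hk'
      refine (ih r' N' hk').trans (Submodule.span_mono ?_)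
      rintro _ ⟨p, h1, h2, h3, rfl⟩
      exact ⟨p, h1, h2.trans hr, h3.trans hN, rfl⟩
    have hlow : lowFil A w₀ L.length (wordWt L) ≤ S :=
      sup_le (hmono _ _ hlen (by omega) (by omega)) (hmono _ _ (by omega) hwt (by omega))
    by_cases hd : ∀ p : Gen × ℤ, p.1 ≠ .h → L.count p ≤ 1
    · obtain ⟨p, hp, hLp⟩ := exists_normal_perm hneg hd
      obtain ⟨c, hc, hm⟩ := h.perm_mem hLp
      rw [SetLike.mem_coe, ← sub_add_cancel (wordVec A w₀ L) (c • wordVec A w₀ (normalWord p))]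
      refine Submodule.add_mem _ (hlow hm) (Submodule.smul_mem _ _ (Submodule.subset_span
        ⟨p, hp, ?_, ?_, rfl⟩))
      · rwa [← hLp.length_eq]
      · rwa [← wordWt_perm hLp]
    -- A repeated odd letter can be permuted to the front twice, where `dup_mem` applies.
    · push Not at hd
      obtain ⟨p, hp, hc⟩ := hd
      have h2 : [p, p].Sublist L := by
        have : List.replicate 2 p = [p, p] := rfl
        rw [← this]
        exact List.replicate_sublist_iff.2 hc
      obtain ⟨L', hL'⟩ := h2.exists_perm_append
      have hL'' : L.Perm (p :: p :: L') := hL'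
      obtain ⟨c, _, hm⟩ := h.perm_mem hL''
      have h3 := h.dup_mem p hp L'
      rw [← hL''.length_eq, ← wordWt_perm hL''] at h3
      rw [SetLike.mem_coe, ← sub_add_cancel (wordVec A w₀ L) (c • wordVec A w₀ (p :: p :: L'))]
      exact hlow (Submodule.add_mem _ hm (Submodule.smul_mem _ _ h3))

theorem IsExchange.wordFil_le (h : IsExchange A w₀ ε) (r N : ℤ) :
    wordFil A w₀ r N ≤ Submodule.span ℂ
      {v | ∃ p, IsNormal p ∧ ((normalWord p).length : ℤ) ≤ r ∧ wordWt (normalWord p) ≤ N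
        ∧ v = wordVec A w₀ (normalWord p)} :=
  h.mem_normal ((r + N).toNat + 1) r N (by push_cast; omega)

end Words

/-! ### A Fock space model of `V` -/

section Exterior

variable {R M I : Type*} [CommRing R] [AddCommGroup M] [Module R M] [LinearOrder I]

/-- The basis vector of a finite set is the product in increasing order, and a strictly increasing
list is the only increasing enumeration of its entries. -/
theorem exteriorBasis_toFinset (b : Module.Basis I R M) (L : List I) (hL : L.Pairwise (· < ·)) :
    b.ExteriorAlgebra L.toFinset = (L.map fun i => ExteriorAlgebra.ι R (b i)).prod := by
  have hnd : L.Nodup := hL.imp fun h => h.ne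
  have hc : L.toFinset.card = L.length := List.toFinset_card_of_nodup hnd
  have hmono : StrictMono L.get := fun i j hij => List.pairwise_iff_get.1 hL i j hij
  have h := Finset.orderEmbOfFin_unique hc (f := L.get) (fun x => by simp) hmono
  rw [ExteriorAlgebra.basis_apply_ofCard b hc, ExteriorAlgebra.ιMulti_family,
    ExteriorAlgebra.ιMulti_apply]
  have h2 : ∀ i, (Set.powersetCard.ofFinEmbEquiv.symm (Set.powersetCard.ofCard hc)) i = L.get i := by
    intro i
    rw [h]
    rfl
  simp only [Function.comp_apply, h2]
  congr 1
  conv_rhs => rw [← List.ofFn_get L]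
  rw [List.map_ofFn]
  rfl

/-- Exterior multiplication by a vector plus contraction with a functional. -/
noncomputable def wedgeContract (v : M) (d : Module.Dual R M) : Module.End R (ExteriorAlgebra R M) :=
  LinearMap.mulLeft R (ExteriorAlgebra.ι R v) + CliffordAlgebra.contractLeft d

/-- Clifford relations: wedges anticommute, contractions anticommute, and a contraction with a wedge
anticommutes to the pairing. -/
theorem wedgeContract_anticomm (v v' : M) (d d' : Module.Dual R M) (x : ExteriorAlgebra R M) :
    wedgeContract v d (wedgeContract v' d' x) + wedgeContract v' d' (wedgeContract v d x)
      = (d v' + d' v) • x := by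
  have h1 : ∀ (d : Module.Dual R M) (v : M) (x : ExteriorAlgebra R M),
      CliffordAlgebra.contractLeft d (ExteriorAlgebra.ι R v * x)
        = d v • x - ExteriorAlgebra.ι R v * CliffordAlgebra.contractLeft d x :=
    fun d v x => CliffordAlgebra.contractLeft_ι_mul d v x
  have h2 : ExteriorAlgebra.ι R v * ExteriorAlgebra.ι R v' + ExteriorAlgebra.ι R v' *
      ExteriorAlgebra.ι R v = 0 := ExteriorAlgebra.ι_add_mul_swap v v'
  have h3 : ExteriorAlgebra.ι R v * (ExteriorAlgebra.ι R v' * x)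
      = - (ExteriorAlgebra.ι R v' * (ExteriorAlgebra.ι R v * x)) := by
    rw [← mul_assoc, ← mul_assoc, eq_neg_of_add_eq_zero_left h2, neg_mul]
  have h4 : CliffordAlgebra.contractLeft d (CliffordAlgebra.contractLeft d' x)
      = - CliffordAlgebra.contractLeft d' (CliffordAlgebra.contractLeft d x) :=
    CliffordAlgebra.contractLeft_comm d d' x
  simp only [wedgeContract, LinearMap.add_apply, LinearMap.mulLeft_apply, map_add, h1, h3]
  rw [h4]
  module

end Exterior

/-! ### The loop superalgebra acting on the Fock space -/

/-- The index set of the odd creation operators. -/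
abbrev FockIndex : Type := Bool ×ₗ ℕᵒᵈ

/-- The coefficient ring, generated by the modes of `h̄`. -/
abbrev FockRing : Type := MvPolynomial ℕ ℂ

/-- The exterior algebra on the odd creation operators. -/
abbrev Fock : Type := ExteriorAlgebra FockRing (FockIndex →₀ FockRing)

/-- The action of `h̄(n)`. -/
noncomputable def fockScalar (n : ℤ) : FockRing := if n < 0 then MvPolynomial.X (-n).toNat else 0

/-- The creation part of `ē(n)` (for `s = false`) or `f̄(n)` (for `s = true`). -/
noncomputable def fockVec (s : Bool) (n : ℤ) : FockIndex →₀ FockRing :=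
  if n < 0 then Finsupp.single (toLex (s, OrderDual.toDual (-n).toNat)) 1 else 0

/-- The contraction part of `ē(n)` (for `s = false`) or `f̄(n)` (for `s = true`). -/
noncomputable def fockDual (s : Bool) (n : ℤ) : Module.Dual FockRing (FockIndex →₀ FockRing) :=
  Finsupp.linearCombination FockRing fun i : FockIndex =>
    if (ofLex i).1 = s ∨ (s = false ∧ n < 0) then 0
    else fockScalar (n - (OrderDual.ofDual (ofLex i).2 : ℕ))

theorem fockDual_fockVec_self (s : Bool) (m n : ℤ) : fockDual s m (fockVec s n) = 0 := by
  unfold fockDual fockVec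
  split_ifs <;> simp

/-- At most one pairing contributes. When both modes are creation modes the bracket is assigned
entirely to the contraction in `f̄(n)`, so that `ē(m)` with `m < 0` is a pure wedge. This asymmetry
matches the order of normal monomials, with `ē` to the left of `f̄`. -/
theorem fockDual_fockVec (m n : ℤ) :
    fockDual false m (fockVec true n) + fockDual true n (fockVec false m) = fockScalar (m + n) := by
  unfold fockDual fockVec
  split_ifs with hn hm hm
  · simp [hm]; congr 1; omega
  · simp [hm]; congr 1; omega
  · simp; congr 1; omega
  · simp [fockScalar]; omega

/-- The operators of the loop algebra on the Fock space. -/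
noncomputable def fockOp : Gen → ℤ → Module.End ℂ Fock
  | .e, n => (wedgeContract (fockVec false n) (fockDual false n)).restrictScalars ℂ
  | .f, n => (wedgeContract (fockVec true n) (fockDual true n)).restrictScalars ℂ
  | .h, n => (LinearMap.lsmul FockRing Fock (fockScalar n)).restrictScalars ℂ

theorem fockOp_e (n : ℤ) (x : Fock) :
    fockOp .e n x = wedgeContract (fockVec false n) (fockDual false n) x := rfl

theorem fockOp_f (n : ℤ) (x : Fock) :
    fockOp .f n x = wedgeContract (fockVec true n) (fockDual true n) x := rfl

theorem fockOp_h (n : ℤ) (x : Fock) : fockOp .h n x = fockScalar n • x := rfl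

theorem fockOp_relation (a b : Gen) (m n : ℤ) :
    fockOp a m * fockOp b n = (-1 : ℂ) ^ (a.parity * b.parity) • (fockOp b n * fockOp a m)
      + ∑ c : Gen, structConst a b c • fockOp c (m + n) := by
  have hu : (univ : Finset Gen) = {.e, .f, .h} := rfl
  rw [hu]
  refine LinearMap.ext fun x => ?_
  have hee := wedgeContract_anticomm (fockVec false m) (fockVec false n) (fockDual false m)
    (fockDual false n) x
  have hff := wedgeContract_anticomm (fockVec true m) (fockVec true n) (fockDual true m)
    (fockDual true n) x
  have hef := wedgeContract_anticomm (fockVec false m) (fockVec true n) (fockDual false m)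
    (fockDual true n) x
  have hfe := wedgeContract_anticomm (fockVec false n) (fockVec true m) (fockDual false n)
    (fockDual true m) x
  rw [fockDual_fockVec_self, fockDual_fockVec_self, add_zero, zero_smul] at hee hff
  rw [fockDual_fockVec] at hef hfe
  cases a <;> cases b <;>
    simp only [Module.End.mul_apply, LinearMap.add_apply, LinearMap.smul_apply, fockOp_e, fockOp_f,
      fockOp_h, structConst, Gen.parity, sum_insert, mem_insert, mem_singleton, sum_singleton,
      reduceCtorEq, or_self, not_false_eq_true, zero_smul, zero_add, add_zero, one_smul, mul_zero,
      mul_one, pow_zero, pow_one, map_smul, neg_smul]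
  · exact eq_neg_of_add_eq_zero_left hee
  · rw [← hef]; abel
  · rw [add_comm m n, ← hfe]; abel
  · exact eq_neg_of_add_eq_zero_left hff
  · exact smul_comm _ _ _

theorem fockOp_one (a : Gen) (n : ℤ) (hn : 0 ≤ n) : fockOp a n 1 = 0 := by
  have h : ¬ n < 0 := not_lt.2 hn
  cases a
  · rw [fockOp_e]; simp [wedgeContract, fockVec, h]
  · rw [fockOp_f]; simp [wedgeContract, fockVec, h]
  · rw [fockOp_h]; simp [fockScalar, h]

/-- The comparison map from `V` to the Fock space. -/
noncomputable def toFock : VL →ₗ[ℂ] Fock :=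
  liftVL (liftULoop fockOp fockOp_relation) 1 fun a n hn => by
    rw [liftULoop_ugen]; exact fockOp_one a n hn

theorem toFock_wordVec (L : List (Gen × ℤ)) :
    toFock (wordVec loopOp vac L) = wordVec fockOp 1 L := by
  induction L with
  | nil => exact liftVL_vac _ _ _
  | cons p L ih => rw [wordVec_cons, toFock, liftVL_loopOp, liftULoop_ugen, ← toFock, ih]; rfl

/-- The odd vector with label `i`. -/
noncomputable def fockGen (i : FockIndex) : Fock :=
  ExteriorAlgebra.ι FockRing (Finsupp.basisSingleOne i)

theorem fockVec_neg (s : Bool) {m : ℕ} (hm : 1 ≤ m) :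
    ExteriorAlgebra.ι FockRing (fockVec s (-(m : ℤ))) = fockGen (toLex (s, OrderDual.toDual m)) := by
  rw [fockVec, if_pos (by omega), fockGen, Finsupp.coe_basisSingleOne]
  simp

theorem fockOp_e_neg {m : ℕ} (hm : 1 ≤ m) (x : Fock) :
    fockOp .e (-(m : ℤ)) x = fockGen (toLex (false, OrderDual.toDual m)) * x := by
  have : fockDual false (-(m : ℤ)) = 0 := by
    have h : ((-(m : ℤ)) < 0) = True := eq_true (by omega)
    refine LinearMap.ext fun v => ?_
    simp only [fockDual, h, and_self, or_true, if_true]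
    simp [Finsupp.linearCombination_apply]
  rw [fockOp_e, wedgeContract, this, map_zero, add_zero, LinearMap.mulLeft_apply, fockVec_neg _ hm]

/-- The functional in `f̄(n)` vanishes on the vectors that come from `f̄`, so its contraction kills
every product of such vectors. -/
theorem contractLeft_fockDual_prod (n : ℤ) (L : List ℕ) (hL : ∀ m ∈ L, 1 ≤ m) (r : FockRing) :
    CliffordAlgebra.contractLeft (fockDual true n)
      (r • (L.map fun m : ℕ => fockGen (toLex (true, OrderDual.toDual m))).prod) = 0 := by
  rw [map_smul]
  induction L with
  | nil => rw [List.map_nil, List.prod_nil, CliffordAlgebra.contractLeft_one, smul_zero]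
  | cons m L ih =>
    have h1 := fockDual_fockVec_self true n (-(m : ℤ))
    rw [List.map_cons, List.prod_cons, ← fockVec_neg _ (hL m (by simp))]
    have h2 := CliffordAlgebra.contractLeft_ι_mul (fockDual true n) (fockVec true (-(m : ℤ)))
      (Q := 0) (L.map fun m : ℕ => fockGen (toLex (true, OrderDual.toDual m))).prod
    refine (congrArg (r • ·) h2).trans ?_
    simp only [h1, zero_smul, zero_sub, smul_neg, ← mul_smul_comm]
    rw [ih fun x hx => hL x (by simp [hx]), mul_zero, neg_zero]

/-- In normal order no contraction contributes: the `f̄` letters act on products of `f̄` vectors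
only, and the `ē` creation modes have no contraction. -/
theorem wordVec_fockOp (p : List ℕ × List ℕ × List ℕ) (hp : IsNormal p) :
    wordVec fockOp 1 (normalWord p) = (p.2.2.map fun k : ℕ => (MvPolynomial.X k : FockRing)).prod •
      (((p.1.map fun m : ℕ => (toLex (false, OrderDual.toDual m) : FockIndex))
        ++ p.2.1.map fun m : ℕ => (toLex (true, OrderDual.toDual m) : FockIndex)).map fockGen).prod := by
  obtain ⟨E, F, K⟩ := p
  obtain ⟨-, -, -, hE, hF, hK⟩ := hp
  simp only at hE hF hK
  have h1 : wordVec fockOp 1 (K.map fun k : ℕ => (Gen.h, -(k : ℤ)))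
      = (K.map fun k : ℕ => (MvPolynomial.X k : FockRing)).prod • (1 : Fock) := by
    induction K with
    | nil => simp
    | cons k K ih =>
      have := hK k (by simp)
      rw [List.map_cons, wordVec_cons, ih fun x hx => hK x (by simp [hx]), fockOp_h, fockScalar,
        if_pos (by omega), List.map_cons, List.prod_cons, mul_smul]
      simp
  have h2 : wordVec fockOp 1 (F.map (fun m : ℕ => (Gen.f, -(m : ℤ)))
        ++ K.map fun k : ℕ => (Gen.h, -(k : ℤ)))
      = (K.map fun k : ℕ => (MvPolynomial.X k : FockRing)).prod •
        (F.map fun m : ℕ => fockGen (toLex (true, OrderDual.toDual m))).prod := by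
    induction F with
    | nil => simpa using h1
    | cons m F ih =>
      have hF' : ∀ x ∈ F, 1 ≤ x := fun x hx => hF x (by simp [hx])
      rw [List.map_cons, List.cons_append, wordVec_cons, ih hF', fockOp_f, wedgeContract,
        LinearMap.add_apply, contractLeft_fockDual_prod _ _ hF', add_zero, LinearMap.mulLeft_apply,
        fockVec_neg _ (hF m (by simp)), List.map_cons, List.prod_cons, mul_smul_comm]
  rw [normalWord]
  simp only
  clear hK hF
  induction E with
  | nil => rw [List.map_nil, List.nil_append, h2]; simp [List.map_map, Function.comp_def]
  | cons m E ih =>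
    rw [List.map_cons, List.cons_append, wordVec_cons, ih fun x hx => hE x (by simp [hx]),
      fockOp_e_neg (hE m (by simp)), mul_smul_comm]
    simp

/-- The basis of the Fock space over `ℂ`. -/
noncomputable def fockBasis : Module.Basis ((ℕ →₀ ℕ) × Finset FockIndex) ℂ Fock :=
  (MvPolynomial.basisMonomials ℕ ℂ).smulTower Finsupp.basisSingleOne.ExteriorAlgebra

/-- The label of a normal monomial in the basis of the Fock space. -/
noncomputable def fockLabel (p : List ℕ × List ℕ × List ℕ) : (ℕ →₀ ℕ) × Finset FockIndex :=
  (Multiset.toFinsupp (p.2.2 : Multiset ℕ),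
    ((p.1.map fun m : ℕ => (toLex (false, OrderDual.toDual m) : FockIndex))
        ++ p.2.1.map fun m : ℕ => (toLex (true, OrderDual.toDual m) : FockIndex)).toFinset)

theorem toFock_normal (p : List ℕ × List ℕ × List ℕ) (hp : IsNormal p) :
    toFock (wordVec loopOp vac (normalWord p)) = fockBasis (fockLabel p) := by
  rw [toFock_wordVec, wordVec_fockOp p hp, fockBasis, Module.Basis.smulTower_apply, fockLabel,
    exteriorBasis_toFinset]
  · congr 1
    rw [MvPolynomial.coe_basisMonomials]
    induction p.2.2 with
    | nil => simp
    | cons k K ih =>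
      rw [List.map_cons, List.prod_cons, ih, ← Multiset.cons_coe, ← Multiset.singleton_add, map_add,
        Multiset.toFinsupp_singleton]
      simp [MvPolynomial.X, MvPolynomial.monomial_mul]
  -- The lexicographic order with reversed natural numbers makes the letters of a normal monomial
  -- increasing: `ē` precedes `f̄`, and larger mode numbers come first. Hence no sign appears.
  · obtain ⟨h1, h2, -⟩ := hp
    rw [List.pairwise_append, List.pairwise_map, List.pairwise_map]
    refine ⟨h1.imp fun h => ?_, h2.imp fun h => ?_, ?_⟩
    · exact Prod.Lex.toLex_lt_toLex.2 (Or.inr ⟨rfl, h⟩)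
    · exact Prod.Lex.toLex_lt_toLex.2 (Or.inr ⟨rfl, h⟩)
    · intro a ha b hb
      obtain ⟨_, _, rfl⟩ := List.mem_map.1 ha
      obtain ⟨_, _, rfl⟩ := List.mem_map.1 hb
      exact Prod.Lex.toLex_lt_toLex.2 (Or.inl Bool.false_lt_true)

/-- A strictly decreasing list is determined by its set of entries, and a weakly decreasing one by
its multiset. -/
theorem fockLabel_injective {p p' : List ℕ × List ℕ × List ℕ} (hp : IsNormal p) (hp' : IsNormal p')
    (h : fockLabel p = fockLabel p') : p = p' := by
  obtain ⟨E, F, K⟩ := p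
  obtain ⟨E', F', K'⟩ := p'
  obtain ⟨hE, hF, hK, -⟩ := hp
  obtain ⟨hE', hF', hK', -⟩ := hp'
  simp only [fockLabel, Prod.mk.injEq, EmbeddingLike.apply_eq_iff_eq, Multiset.coe_eq_coe] at h hE hF hK hE' hF' hK' ⊢
  obtain ⟨h1, h2⟩ := h
  have key : ∀ l l' : List ℕ, l.Pairwise (· > ·) → l'.Pairwise (· > ·) → (∀ m, m ∈ l ↔ m ∈ l') →
      l = l' := by
    intro l l' hl hl' hm
    refine List.Perm.eq_of_pairwise (le := (· > ·)) (fun a b _ _ h1 h2 => absurd h1 (lt_asymm h2)) hl hl' ?_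
    exact (List.perm_ext_iff_of_nodup (hl.imp fun h => h.ne') (hl'.imp fun h => h.ne')).2 hm
  refine ⟨key _ _ hE hE' fun m => ?_, key _ _ hF hF' fun m => ?_, ?_⟩
  · have := Finset.ext_iff.1 h2 (toLex (false, OrderDual.toDual m))
    simpa using this
  · have := Finset.ext_iff.1 h2 (toLex (true, OrderDual.toDual m))
    simpa using this
  · exact List.Perm.eq_of_pairwise (le := (· ≥ ·)) (fun a b _ _ h1 h2 => le_antisymm h2 h1) hK hK' h1

/-- The normal monomials in the modes of `ē, f̄, h̄` are linearly independent. -/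
theorem linearIndependent_loop_normal : LinearIndependent ℂ
    fun p : {p : List ℕ × List ℕ × List ℕ // IsNormal p} => wordVec loopOp vac (normalWord p.1) := by
  refine LinearIndependent.of_comp toFock ?_
  have h : toFock ∘ (fun p : {p : List ℕ × List ℕ × List ℕ // IsNormal p} =>
      wordVec loopOp vac (normalWord p.1)) = fockBasis ∘ fun p => fockLabel p.1 :=
    funext fun p => toFock_normal p.1 p.2
  rw [h]
  exact fockBasis.linearIndependent.comp _ fun p p' hpp => Subtype.ext
    (fockLabel_injective p.2 p'.2 hpp)

/-! ### Power series acting on two-variable formal distributions -/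

section Action

variable {W : Type*} [AddCommGroup W] [Module ℂ W]

/-- The product of a power series in `x₁, x₂` and a formal distribution `∑ B(m, n) x₁^{-m-1}
x₂^{-n-1}`. -/
noncomputable def act (F : MvPowerSeries (Fin 2) ℂ) (B : ℤ → ℤ → W) (m n : ℤ) : W :=
  ∑ᶠ d : Fin 2 →₀ ℕ, MvPowerSeries.coeff d F • B (m + d 0) (n + d 1)

/-- The products of power series with the distribution are well defined. -/
def IsSummable (B : ℤ → ℤ → W) : Prop :=
  ∀ m n : ℤ, {d : Fin 2 →₀ ℕ | B (m + d 0) (n + d 1) ≠ 0}.Finite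

theorem finite_le_pair (a b : ℕ) : {d : Fin 2 →₀ ℕ | d 0 ≤ a ∧ d 1 ≤ b}.Finite := by
  refine (Set.finite_Iic (Finsupp.single 0 a + Finsupp.single 1 b : Fin 2 →₀ ℕ)).subset ?_
  rintro d ⟨h0, h1⟩ i
  fin_cases i <;> simpa

/-- The uniform bound leaves finitely many first indices, over which the individual bounds for the
second index can be added up. -/
theorem isSummable_of_left {W : Type*} [AddCommGroup W] {B : ℤ → ℤ → W} (h1 : ∃ M : ℤ, ∀ m n, M ≤ m → B m n = 0)
    (h2 : ∀ m, ∃ N : ℤ, ∀ n, N ≤ n → B m n = 0) : IsSummable B := by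
  intro m n
  obtain ⟨M, hM⟩ := h1
  choose N hN using h2
  refine (finite_le_pair (M - m).toNat
    (∑ i ∈ range ((M - m).toNat + 1), (N (m + i) - n).toNat)).subset ?_
  intro d hd
  have h0 : d 0 ≤ (M - m).toNat := by
    by_contra hc
    exact hd (hM _ _ (by omega))
  refine ⟨h0, ?_⟩
  by_contra hc
  refine hd (hN _ _ ?_)
  have := Finset.single_le_sum (f := fun i : ℕ => (N (m + i) - n).toNat) (fun i _ => Nat.zero_le _)
    (Finset.mem_range.2 (Nat.lt_add_one_of_le h0))
  omega

theorem isSummable_of_right {W : Type*} [AddCommGroup W] {B : ℤ → ℤ → W} (h1 : ∃ N : ℤ, ∀ m n, N ≤ n → B m n = 0)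
    (h2 : ∀ n, ∃ M : ℤ, ∀ m, M ≤ m → B m n = 0) : IsSummable B := by
  intro m n
  obtain ⟨N, hN⟩ := h1
  choose M hM using h2
  refine (finite_le_pair (∑ i ∈ range ((N - n).toNat + 1), (M (n + i) - m).toNat)
    (N - n).toNat).subset ?_
  intro d hd
  have h0 : d 1 ≤ (N - n).toNat := by
    by_contra hc
    exact hd (hN _ _ (by omega))
  refine ⟨?_, h0⟩
  by_contra hc
  refine hd (hM _ _ ?_)
  have := Finset.single_le_sum (f := fun i : ℕ => (M (n + i) - m).toNat) (fun i _ => Nat.zero_le _)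
    (Finset.mem_range.2 (Nat.lt_add_one_of_le h0))
  omega

theorem act_eq_sum (F : MvPowerSeries (Fin 2) ℂ) (B : ℤ → ℤ → W) (m n : ℤ) (T : Finset (Fin 2 →₀ ℕ))
    (hT : ∀ d, B (m + d 0) (n + d 1) ≠ 0 → d ∈ T) :
    act F B m n = ∑ d ∈ T, MvPowerSeries.coeff d F • B (m + d 0) (n + d 1) := by
  refine finsum_eq_sum_of_support_subset _ fun d hd => hT d fun h => hd ?_
  change _ • B _ _ = 0
  rw [h, smul_zero]

/-- Without finiteness this associativity can fail for formal distributions. With it, everything is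
a finite double sum that can be regrouped by `p + q`. -/
theorem act_mul (F G : MvPowerSeries (Fin 2) ℂ) {B : ℤ → ℤ → W} (hB : IsSummable B) :
    act (F * G) B = act F (act G B) := by
  classical
  funext m n
  set S := (hB m n).toFinset with hS
  -- The downward closure of the support contains both summands of every exponent that matters, so
  -- one finite set serves all the sums.
  set T := S.biUnion Finset.Iic with hT
  have hST : ∀ d, B (m + d 0) (n + d 1) ≠ 0 → d ∈ T := fun d hd =>
    Finset.mem_biUnion.2 ⟨d, (hB m n).mem_toFinset.2 hd, Finset.mem_Iic.2 le_rfl⟩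
  have hdown : ∀ d ∈ T, ∀ p ≤ d, p ∈ T := by
    intro d hd p hp
    obtain ⟨s, hs, hds⟩ := Finset.mem_biUnion.1 hd
    exact Finset.mem_biUnion.2 ⟨s, hs, Finset.mem_Iic.2 (hp.trans (Finset.mem_Iic.1 hds))⟩
  have hadd : ∀ p q : Fin 2 →₀ ℕ, B (m + p 0 + q 0) (n + p 1 + q 1)
      = B (m + (p + q) 0) (n + (p + q) 1) := by
    intro p q
    simp only [Finsupp.add_apply, Nat.cast_add, add_assoc]
  have hG : ∀ p : Fin 2 →₀ ℕ, act G B (m + p 0) (n + p 1)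
      = ∑ q ∈ T, MvPowerSeries.coeff q G • B (m + (p + q) 0) (n + (p + q) 1) := by
    intro p
    rw [act_eq_sum G B _ _ T fun q hq => hdown _ (hST (p + q) (by rwa [← hadd])) q le_add_self]
    exact Finset.sum_congr rfl fun q _ => by rw [hadd]
  rw [act_eq_sum (F * G) B m n T hST, act_eq_sum F (act G B) m n T]
  · have h1 : ∀ d ∈ T, MvPowerSeries.coeff d (F * G) • B (m + d 0) (n + d 1)
        = ∑ x ∈ (T ×ˢ T).filter (fun x => x.1 + x.2 = d),
          (MvPowerSeries.coeff x.1 F * MvPowerSeries.coeff x.2 G) •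
            B (m + (x.1 + x.2) 0) (n + (x.1 + x.2) 1) := by
      intro d hd
      have : (T ×ˢ T).filter (fun x => x.1 + x.2 = d) = antidiagonal d := by
        ext x
        simp only [Finset.mem_filter, Finset.mem_product, HasAntidiagonal.mem_antidiagonal,
          and_iff_right_iff_imp]
        rintro rfl
        exact ⟨hdown _ hd _ le_self_add, hdown _ hd _ le_add_self⟩
      rw [this, MvPowerSeries.coeff_mul, Finset.sum_smul]
      exact Finset.sum_congr rfl fun x hx => by rw [HasAntidiagonal.mem_antidiagonal.1 hx]
    rw [Finset.sum_congr rfl h1]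
    simp only [hG, Finset.smul_sum, smul_smul]
    rw [← Finset.sum_product' (s := T) (t := T) (f := fun p q =>
      (MvPowerSeries.coeff p F * MvPowerSeries.coeff q G) • B (m + (p + q) 0) (n + (p + q) 1)),
      ← Finset.sum_filter_add_sum_filter_not (T ×ˢ T) (fun x => x.1 + x.2 ∈ T)]
    have h2 : ∑ x ∈ (T ×ˢ T).filter (fun x => ¬ x.1 + x.2 ∈ T),
        (MvPowerSeries.coeff x.1 F * MvPowerSeries.coeff x.2 G) •
          B (m + (x.1 + x.2) 0) (n + (x.1 + x.2) 1) = 0 := by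
      refine Finset.sum_eq_zero fun x hx => ?_
      have : B (m + (x.1 + x.2) 0) (n + (x.1 + x.2) 1) = 0 := by
        by_contra hc
        exact (Finset.mem_filter.1 hx).2 (hST _ hc)
      rw [this, smul_zero]
    rw [h2, add_zero, ← Finset.sum_fiberwise_of_maps_to (s := (T ×ˢ T).filter fun x => x.1 + x.2 ∈ T)
      (t := T) (g := fun x => x.1 + x.2) (fun x hx => (Finset.mem_filter.1 hx).2)]
    refine Finset.sum_congr rfl fun d hd => Finset.sum_congr ?_ fun _ _ => rfl
    ext x
    simp only [Finset.mem_filter, and_assoc]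
    constructor
    · rintro ⟨h, rfl⟩; exact ⟨h, hd, rfl⟩
    · rintro ⟨h, _, h'⟩; exact ⟨h, h'⟩
  · intro p hp
    by_contra hc
    refine hp ?_
    rw [hG]
    refine Finset.sum_eq_zero fun q _ => ?_
    have : B (m + (p + q) 0) (n + (p + q) 1) = 0 := by
      by_contra hc'
      exact hc (hdown _ (hST _ hc') p le_self_add)
    rw [this, smul_zero]

/-- Multiplication of a distribution by `c + x₁ - x₂`. -/
def linArr (c : ℂ) (B : ℤ → ℤ → W) (m n : ℤ) : W := c • B m n + B (m + 1) n - B m (n + 1)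

/-- The power series `c + x₁ - x₂`. -/
noncomputable def linSeries (c : ℂ) : MvPowerSeries (Fin 2) ℂ :=
  MvPowerSeries.C c + MvPowerSeries.X 0 - MvPowerSeries.X 1

theorem act_one (B : ℤ → ℤ → W) : act 1 B = B := by
  funext m n
  rw [act, finsum_eq_single _ 0]
  · simp
  · intro d hd
    rw [MvPowerSeries.coeff_one, if_neg hd, zero_smul]

theorem act_linSeries (c : ℂ) {B : ℤ → ℤ → W} (hB : IsSummable B) :
    act (linSeries c) B = linArr c B := by
  classical
  funext m n
  have h0 : ∑ d ∈ (hB m n).toFinset, (if d = 0 then c else 0) • B (m + d 0) (n + d 1)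
      = c • B m n := by
    rw [Finset.sum_eq_single 0]
    · simp
    · intro d _ hd; simp [hd]
    · intro h
      have : B m n = 0 := by simpa using h
      simp [this]
  have h1 : ∀ i : Fin 2, ∑ d ∈ (hB m n).toFinset, (if d = Finsupp.single i 1 then (1 : ℂ) else 0) •
      B (m + d 0) (n + d 1)
      = B (m + (Finsupp.single i 1 0 : ℕ)) (n + (Finsupp.single i 1 1 : ℕ)) := by
    intro i
    rw [Finset.sum_eq_single (Finsupp.single i 1)]
    · simp
    · intro d _ hd; simp [hd]
    · intro h
      have : B (m + (Finsupp.single i 1 0 : ℕ)) (n + (Finsupp.single i 1 1 : ℕ)) = 0 := by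
        by_contra hc
        exact h ((hB m n).mem_toFinset.2 hc)
      simp [this]
  rw [act_eq_sum _ B m n (hB m n).toFinset fun d hd => (hB m n).mem_toFinset.2 hd]
  simp only [linSeries, map_sub, map_add, MvPowerSeries.coeff_X, MvPowerSeries.coeff_C, sub_smul,
    add_smul, Finset.sum_sub_distrib, Finset.sum_add_distrib, h0, h1]
  simp [linArr]

theorem linSeries_mul_inv {c : ℂ} (hc : c ≠ 0) : linSeries c * (linSeries c)⁻¹ = 1 := by
  refine MvPowerSeries.mul_inv_cancel _ ?_
  simpa [linSeries] using hc

theorem exchange_eq (c : ℂ) : exchange c = linSeries c * (linSeries (-c))⁻¹ := rfl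

theorem exchange_mul_exchange {c : ℂ} (hc : c ≠ 0) : exchange (-c) * exchange c = 1 := by
  have h1 := linSeries_mul_inv hc
  have h2 := linSeries_mul_inv (neg_ne_zero.2 hc)
  rw [exchange_eq, exchange_eq, neg_neg]
  linear_combination linSeries (-c) * (linSeries (-c))⁻¹ * h1 + h2

/-- The constant term is `c / (-c)`. Its value `-1` makes repeated modes of `e` or `f` reducible. -/
theorem constantCoeff_exchange {c : ℂ} (hc : c ≠ 0) :
    MvPowerSeries.constantCoeff (exchange c) = -1 := by
  rw [exchange_eq, map_mul, MvPowerSeries.constantCoeff_inv]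
  simp [linSeries, hc, inv_neg]

/-- Clearing the denominator `-c + x₁ - x₂`, which is legitimate for summable distributions and an
invertible series. -/
theorem act_exchange {c : ℂ} (hc : c ≠ 0) {B : ℤ → ℤ → W} (hB : IsSummable B) :
    act (exchange c) (linArr (-c) B) = linArr c B := by
  rw [← act_linSeries (-c) hB, ← act_mul _ _ hB, ← act_linSeries c hB, exchange_eq, mul_assoc,
    mul_comm (linSeries (-c))⁻¹, linSeries_mul_inv (neg_ne_zero.2 hc), mul_one]

/-- Every non-constant monomial in `x₁, x₂` raises a mode index, so only the constant term is
leading. -/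
theorem act_sub_mem (F : MvPowerSeries (Fin 2) ℂ) {B : ℤ → ℤ → W} (hB : IsSummable B) (m n : ℤ) :
    act F B m n - MvPowerSeries.constantCoeff F • B m n
      ∈ Submodule.span ℂ {x | ∃ i j : ℕ, 0 < i + j ∧ x = B (m + i) (n + j)} := by
  classical
  rw [act_eq_sum F B m n (insert 0 (hB m n).toFinset) fun d hd =>
    Finset.mem_insert_of_mem ((hB m n).mem_toFinset.2 hd),
    ← Finset.add_sum_erase _ _ (Finset.mem_insert_self _ _)]
  have : MvPowerSeries.coeff 0 F • B (m + ((0 : Fin 2 →₀ ℕ) 0 : ℕ)) (n + ((0 : Fin 2 →₀ ℕ) 1 : ℕ))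
      = MvPowerSeries.constantCoeff F • B m n := by simp
  rw [this, add_sub_cancel_left]
  refine Submodule.sum_mem _ fun d hd => Submodule.smul_mem _ _ (Submodule.subset_span
    ⟨d 0, d 1, ?_, rfl⟩)
  by_contra hc
  refine (Finset.mem_erase.1 hd).1 (Finsupp.ext fun i => ?_)
  fin_cases i <;> simp <;> omega

end Action

/-! ### Exchange of modes in the loop module and in `DY_q(sl₂)`-modules -/

theorem isExchange_loopOp :
    IsExchange loopOp vac (fun a b => (-1 : ℂ) ^ (a.parity * b.parity)) where
  rel a b m n w := by
    rw [loopOp_loopOp, add_sub_cancel_left]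
    refine Submodule.sum_mem _ fun c _ => ?_
    have hu : structConst a b c ≠ 0 → c = .h := by
      cases a <;> cases b <;> cases c <;> simp [structConst]
    by_cases hc : structConst a b c = 0
    · rw [hc, zero_smul]; exact Submodule.zero_mem _
    · rw [hu hc]
      exact Submodule.smul_mem _ _ (Submodule.subset_span (Or.inr rfl))
  vac := loopOp_vac
  ne_zero a b := by simp
  odd_e := by simp [Gen.parity]
  odd_f := by simp [Gen.parity]

section DYModule

variable {W : Type*} [AddCommGroup W] [Module ℂ W] {q : ℂ} {ρ : Tensor →ₐ[ℂ] Module.End ℂ W}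

/-- The leading exchange factors of `DY_q(sl₂)`. -/
def dySign : Gen → Gen → ℂ
  | .e, .f => 1
  | .f, .e => 1
  | .h, .h => 1
  | _, _ => -1

theorem relDefect_eq (r : DYRel) (m n : ℤ) (w : W) :
    relDefect q ρ r m n w = ρ (tgen r.fst m) (ρ (tgen r.snd n) w)
      - act (r.series q) (fun m n => ρ (tgen r.snd n) (ρ (tgen r.fst m) w)) m n
      - r.delta • ρ (tgen .h (m + n)) w := rfl

theorem isSummable_of_trunc (h : ∀ w : W, ∃ N : ℤ, ∀ n, N ≤ n → ∀ a : Gen, ρ (tgen a n) w = 0)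
    (a b : Gen) (w : W) : IsSummable fun m n => ρ (tgen b n) (ρ (tgen a m) w) := by
  refine isSummable_of_left ?_ fun m => ?_
  · obtain ⟨M, hM⟩ := h w
    exact ⟨M, fun m n hm => by rw [hM m hm, map_zero]⟩
  · obtain ⟨N, hN⟩ := h (ρ (tgen a m) w)
    exact ⟨N, fun n hn => hN n hn b⟩

theorem isSummable_of_trunc' (h : ∀ w : W, ∃ N : ℤ, ∀ n, N ≤ n → ∀ a : Gen, ρ (tgen a n) w = 0)
    (a b : Gen) (w : W) : IsSummable fun m n => ρ (tgen a m) (ρ (tgen b n) w) := by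
  refine isSummable_of_right ?_ fun m => ?_
  · obtain ⟨M, hM⟩ := h w
    exact ⟨M, fun m n hm => by rw [hM n hm, map_zero]⟩
  · obtain ⟨N, hN⟩ := h (ρ (tgen b m) w)
    exact ⟨N, fun n hn => hN n hn a⟩

theorem IsDYModule.rel_act (h : IsDYModule q ρ) (r : DYRel) (m n : ℤ) (w : W) :
    ρ (tgen r.fst m) (ρ (tgen r.snd n) w)
      = act (r.series q) (fun m n => ρ (tgen r.snd n) (ρ (tgen r.fst m) w)) m n
      + r.delta • ρ (tgen .h (m + n)) w := by
  have := h.rel r m n w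
  rw [relDefect_eq, sub_sub, sub_eq_zero] at this
  exact this

theorem IsDYModule.exchange_fst_snd (h : IsDYModule q ρ) (r : DYRel) (m n : ℤ) (w : W) :
    ρ (tgen r.fst m) (ρ (tgen r.snd n) w)
      - MvPowerSeries.constantCoeff (r.series q) • ρ (tgen r.snd n) (ρ (tgen r.fst m) w)
      ∈ lowerTerms (fun a n => ρ (tgen a n)) r.fst r.snd m n w := by
  have h1 := act_sub_mem (r.series q) (isSummable_of_trunc h.trunc r.fst r.snd w) m n
  rw [h.rel_act, add_sub_right_comm]
  refine Submodule.add_mem _ (Submodule.span_mono ?_ h1)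
    (Submodule.smul_mem _ _ (Submodule.subset_span (Or.inr rfl)))
  exact Set.subset_union_left

/-- The defining relations give one order of each pair. The other order is obtained by applying the
inverse series `F`, and summability justifies the cancellation. -/
theorem IsDYModule.exchange_snd_fst (h : IsDYModule q ρ) (r : DYRel) (F : MvPowerSeries (Fin 2) ℂ)
    (hF : F * r.series q = 1) (hd : r.delta = 0) (m n : ℤ) (w : W) :
    ρ (tgen r.snd m) (ρ (tgen r.fst n) w)
      - MvPowerSeries.constantCoeff F • ρ (tgen r.fst n) (ρ (tgen r.snd m) w)
      ∈ lowerTerms (fun a n => ρ (tgen a n)) r.snd r.fst m n w := by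
  have hs := isSummable_of_trunc h.trunc r.fst r.snd w
  have h2 : (fun m n => ρ (tgen r.fst m) (ρ (tgen r.snd n) w))
      = act (r.series q) (fun m n => ρ (tgen r.snd n) (ρ (tgen r.fst m) w)) := by
    funext m n
    rw [h.rel_act, hd, zero_smul, add_zero]
  have h1 := act_sub_mem F (h2 ▸ isSummable_of_trunc' h.trunc r.fst r.snd w) n m
  rw [← act_mul _ _ hs, hF, act_one, ← h2] at h1
  refine Submodule.span_mono ?_ h1
  rintro _ ⟨i, j, hij, rfl⟩
  exact Or.inl ⟨j, i, by omega, rfl⟩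

theorem IsDYModule.isExchange (hq : q ≠ 0) (h : IsDYModule q ρ) (w₀ : W)
    (hv : ∀ (a : Gen) (n : ℤ), 0 ≤ n → ρ (tgen a n) w₀ = 0) :
    IsExchange (fun a n => ρ (tgen a n)) w₀ dySign where
  rel a b m n w := by
    have hq' := neg_ne_zero.2 hq
    have c1 := constantCoeff_exchange hq
    have c2 := constantCoeff_exchange hq'
    have e1 := exchange_mul_exchange hq
    have e2 := exchange_mul_exchange hq'
    rw [neg_neg] at e2
    cases a <;> cases b
    · simpa [DYRel.series, c1, c2, dySign, DYRel.fst, DYRel.snd] using h.exchange_fst_snd .ee m n w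
    · simpa [DYRel.series, c1, c2, dySign, DYRel.fst, DYRel.snd] using h.exchange_fst_snd .ef m n w
    · simpa [c1, c2, dySign, DYRel.fst, DYRel.snd] using h.exchange_snd_fst .he _ e1 rfl m n w
    -- For `f` before `e` the relation is read backwards; its series is `1`, so the only correction
    -- is the mode of `h`.
    · have h1 := h.rel_act .ef n m w
      simp only [DYRel.fst, DYRel.snd, DYRel.series, act_one, DYRel.delta, one_smul] at h1
      simp only [dySign, one_smul]
      rw [h1, sub_add_cancel_left, add_comm n]
      exact Submodule.neg_mem _ (Submodule.subset_span (Or.inr rfl))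
    · simpa [DYRel.series, c1, c2, dySign, DYRel.fst, DYRel.snd] using h.exchange_fst_snd .ff m n w
    · simpa [c1, c2, dySign, DYRel.fst, DYRel.snd] using h.exchange_snd_fst .hf _ e2 rfl m n w
    · simpa [DYRel.series, c1, c2, dySign, DYRel.fst, DYRel.snd] using h.exchange_fst_snd .he m n w
    · simpa [DYRel.series, c1, c2, dySign, DYRel.fst, DYRel.snd] using h.exchange_fst_snd .hf m n w
    · simpa [DYRel.series, c1, c2, dySign, DYRel.fst, DYRel.snd] using h.exchange_fst_snd .hh m n w
  vac := hv
  ne_zero a b := by cases a <;> cases b <;> simp [dySign]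
  odd_e := rfl
  odd_f := rfl

end DYModule

/-! ### The series `Φ(c + x)` -/

/-- The operator `c + x` on `V[x]`. -/
noncomputable def addX (c : ℂ) : Module.End ℂ (ℕ →₀ VL) := c • 1 + mulX

theorem coeffMap_addX (c : ℂ) (A : Module.End ℂ VL) (P : ℕ →₀ VL) :
    coeffMap A (addX c P) = addX c (coeffMap A P) := by
  simp [addX, coeffMap_mulX]

theorem addX_mulX (c : ℂ) (P : ℕ →₀ VL) : addX c (mulX P) = mulX (addX c P) := by
  simp [addX]

/-- The substitution of `c + x` for `t`. -/
noncomputable def substX (c : ℂ) : Module.End ℂ (ℕ →₀ VL) :=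
  Finsupp.lsum ℂ fun k => (addX c ^ k) ∘ₗ Finsupp.lsingle 0

theorem substX_single (c : ℂ) (k : ℕ) (v : VL) :
    substX c (Finsupp.single k v) = (addX c ^ k) (Finsupp.single 0 v) := by
  simp [substX]

theorem substX_mulX (c : ℂ) (P : ℕ →₀ VL) : substX c (mulX P) = addX c (substX c P) := by
  induction P using Finsupp.induction_linear with
  | zero => simp
  | add f g hf hg => simp [hf, hg]
  | single k v => rw [mulX_single, substX_single, substX_single, pow_succ', Module.End.mul_apply]

theorem coeffMap_addX_pow (c : ℂ) (A : Module.End ℂ VL) (k : ℕ) (P : ℕ →₀ VL) :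
    coeffMap A ((addX c ^ k) P) = (addX c ^ k) (coeffMap A P) := by
  induction k with
  | zero => simp
  | succ k ih => rw [pow_succ', Module.End.mul_apply, coeffMap_addX, ih, Module.End.mul_apply]

theorem substX_coeffMap (c : ℂ) (A : Module.End ℂ VL) (P : ℕ →₀ VL) :
    substX c (coeffMap A P) = coeffMap A (substX c P) := by
  induction P using Finsupp.induction_linear with
  | zero => simp
  | add f g hf hg => simp [hf, hg]
  | single k v =>
    rw [coeffMap_single, substX_single, substX_single, coeffMap_addX_pow, coeffMap_single]

/-- The binomial theorem for the commuting operators multiplication by `x` and by `c`, which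
identifies `phiAt` with the explicit sum in `phiShift`. -/
theorem substX_eq_sum (c : ℂ) (k j : ℕ) (v : VL) :
    (mulX ^ j) (substX c (Finsupp.single k v)) = ∑ i ∈ range (k + 1),
      Finsupp.single (i + j) (((k.choose i : ℂ) * c ^ (k - i)) • v) := by
  have h : addX c = mulX + c • 1 := add_comm _ _
  rw [substX_single, h, (show Commute mulX (c • 1 : Module.End ℂ (ℕ →₀ VL)) from
    (Commute.one_right _).smul_right c).add_pow, LinearMap.sum_apply, map_sum]
  refine sum_congr rfl fun i _ => ?_
  rw [smul_pow, one_pow]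
  have e : (mulX ^ i * c ^ (k - i) • 1 * ((k.choose i : ℕ) : Module.End ℂ (ℕ →₀ VL)) :
      Module.End ℂ (ℕ →₀ VL))
      (Finsupp.single 0 v) = (c ^ (k - i) * (k.choose i : ℂ)) • (mulX ^ i) (Finsupp.single 0 v) := by
    simp only [Module.End.mul_apply, LinearMap.smul_apply, Module.End.one_apply, map_smul,
      Module.End.natCast_apply, mul_smul, map_nsmul, Nat.cast_smul_eq_nsmul]
    exact smul_comm _ _ _
  rw [e, map_smul, ← Module.End.mul_apply, ← pow_add, mulX_pow_single, Finsupp.smul_single, mul_comm,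
    add_zero, add_comm i]

/-- The operator `Φ(c + x)` on `V[x]`. -/
noncomputable def phiAt (c : ℂ) : Module.End ℂ (ℕ →₀ VL) :=
  Finsupp.lsum ℂ fun j => (mulX ^ j) ∘ₗ substX c ∘ₗ phi

theorem phiAt_single (c : ℂ) (j : ℕ) (v : VL) :
    phiAt c (Finsupp.single j v) = (mulX ^ j) (substX c (phi v)) := by simp [phiAt]

theorem phiShift_phi (c : ℂ) (P : ℕ →₀ VL) : phiShift phi c P = phiAt c P := by
  conv_rhs => rw [← Finsupp.sum_single P]
  rw [map_finsuppSum, phiShift]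
  refine Finsupp.sum_congr fun j _ => ?_
  rw [phiAt_single]
  conv_rhs => rw [← Finsupp.sum_single (phi (P j))]
  rw [map_finsuppSum, map_finsuppSum]
  exact Finsupp.sum_congr fun k _ => (substX_eq_sum c k j _).symm

theorem phiAt_mulX (c : ℂ) (P : ℕ →₀ VL) : phiAt c (mulX P) = mulX (phiAt c P) := by
  induction P using Finsupp.induction_linear with
  | zero => simp
  | add f g hf hg => simp [hf, hg]
  | single k v => rw [mulX_single, phiAt_single, phiAt_single, pow_succ', Module.End.mul_apply]

theorem phiAt_vac (c : ℂ) : phiAt c (Finsupp.single 0 vac) = Finsupp.single 0 vac := by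
  rw [phiAt_single, phi_vac, substX_single]; simp

theorem phiAt_single_loopOp (c : ℂ) (a : Gen) (n : ℤ) (v : VL) :
    phiAt c (Finsupp.single 0 (loopOp a n v)) = phiTwist (addX c) a n (phiAt c (Finsupp.single 0 v)) := by
  rw [phiAt_single, phiAt_single, phi_loopOp, pow_zero, Module.End.one_apply, Module.End.one_apply]
  cases a <;>
  simp only [phiTwist, twist, twistTwo, LinearMap.sub_apply, LinearMap.add_apply,
    LinearMap.smul_apply, Module.End.mul_apply, map_sub, map_add, map_smul, substX_mulX,
    substX_coeffMap]

theorem phiTwist_addX_mulX (c : ℂ) (a : Gen) (n : ℤ) (P : ℕ →₀ VL) :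
    phiTwist (addX c) a n (mulX P) = mulX (phiTwist (addX c) a n P) := by
  cases a <;>
  simp only [phiTwist, twist, twistTwo, LinearMap.sub_apply, LinearMap.add_apply,
    LinearMap.smul_apply, Module.End.mul_apply, map_sub, map_add, map_smul, coeffMap_mulX, addX_mulX]

/-- The rule for `Φ(t)` and a mode with `t` replaced by `c + x`, extended to polynomials by
`ℂ[x]`-linearity. -/
theorem phiAt_coeffMap (c : ℂ) (a : Gen) (n : ℤ) (P : ℕ →₀ VL) :
    phiAt c (coeffMap (loopOp a n) P) = phiTwist (addX c) a n (phiAt c P) := by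
  induction P using Finsupp.induction_linear with
  | zero => simp
  | add f g hf hg => simp only [map_add, hf, hg]
  | single k v =>
    induction k with
    | zero => rw [coeffMap_single, phiAt_single_loopOp]
    | succ k ih =>
      rw [← mulX_single, coeffMap_mulX, phiAt_mulX, ih, phiAt_mulX, phiTwist_addX_mulX]

/-! ### Commuting polynomial families of operators -/

/-- An endomorphism of `V[x]` is `ℂ[x]`-linear. -/
def IsXLinear (Ψ : Module.End ℂ (ℕ →₀ VL)) : Prop := ∀ P, Ψ (mulX P) = mulX (Ψ P)

/-- The coefficient operator of an `ℂ[x]`-linear endomorphism of `V[x]`. -/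
noncomputable def coeffOp (Ψ : Module.End ℂ (ℕ →₀ VL)) (i : ℕ) (v : VL) : VL :=
  Ψ (Finsupp.single 0 v) i

/-- The coefficient operators of two endomorphisms commute. -/
def CoeffCommute (Ψ Ψ' : Module.End ℂ (ℕ →₀ VL)) : Prop :=
  ∀ i j v, coeffOp Ψ i (coeffOp Ψ' j v) = coeffOp Ψ' j (coeffOp Ψ i v)

theorem CoeffCommute.symm {Ψ Ψ' : Module.End ℂ (ℕ →₀ VL)} (h : CoeffCommute Ψ Ψ') :
    CoeffCommute Ψ' Ψ := fun i j v => (h j i v).symm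

theorem coeffOp_sum {ι : Type*} (Ψ : Module.End ℂ (ℕ →₀ VL)) (i : ℕ) (s : Finset ι) (f : ι → VL) :
    coeffOp Ψ i (∑ x ∈ s, f x) = ∑ x ∈ s, coeffOp Ψ i (f x) := by
  simp only [coeffOp]
  rw [← Finsupp.lsingle_apply (R := ℂ), map_sum, map_sum, Finsupp.finsetSum_apply]
  rfl

theorem coeffOp_smul (Ψ : Module.End ℂ (ℕ →₀ VL)) (i : ℕ) (r : ℂ) (v : VL) :
    coeffOp Ψ i (r • v) = r • coeffOp Ψ i v := by
  simp only [coeffOp]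
  rw [← Finsupp.smul_single, map_smul, Finsupp.smul_apply]

theorem coeffOp_add (Ψ : Module.End ℂ (ℕ →₀ VL)) (i : ℕ) (v w : VL) :
    coeffOp Ψ i (v + w) = coeffOp Ψ i v + coeffOp Ψ i w := by
  simp only [coeffOp, Finsupp.single_add, map_add, Finsupp.add_apply]

theorem IsXLinear.single {Ψ : Module.End ℂ (ℕ →₀ VL)} (h : IsXLinear Ψ) (j : ℕ) (v : VL) :
    Ψ (Finsupp.single j v) = (mulX ^ j) (Ψ (Finsupp.single 0 v)) := by
  induction j with
  | zero => rfl
  | succ j ih => rw [← mulX_single, h, ih, pow_succ', Module.End.mul_apply]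

theorem mulX_pow_apply (j k : ℕ) (P : ℕ →₀ VL) :
    (mulX ^ j) P k = if j ≤ k then P (k - j) else 0 := by
  induction j generalizing k with
  | zero => simp
  | succ j ih =>
    rw [pow_succ', Module.End.mul_apply]
    cases k with
    | zero => rw [mulX_apply_zero, if_neg (by omega)]
    | succ k =>
      rw [mulX_apply_succ, ih]
      simp

/-- The Cauchy product; linearity over `ℂ[x]` of the left factor is what separates its coefficients
from those of the right factor. -/
theorem coeffOp_mul {Ψ Ψ' : Module.End ℂ (ℕ →₀ VL)} (h : IsXLinear Ψ) (k : ℕ) (v : VL) :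
    coeffOp (Ψ * Ψ') k v = ∑ x ∈ antidiagonal k, coeffOp Ψ x.1 (coeffOp Ψ' x.2 v) := by
  rw [coeffOp, Module.End.mul_apply]
  set Q := Ψ' (Finsupp.single 0 v) with hQ
  have h1 : ∀ Q : ℕ →₀ VL, Ψ Q k = ∑ x ∈ antidiagonal k, coeffOp Ψ x.1 (Q x.2) := by
    intro Q
    induction Q using Finsupp.induction_linear with
    | zero => simp [coeffOp]
    | add f g hf hg => simp only [map_add, Finsupp.add_apply, hf, hg, coeffOp_add, sum_add_distrib]
    | single j w =>
      rw [h.single, mulX_pow_apply]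
      split_ifs with hjk
      · rw [Finset.sum_eq_single (k - j, j)]
        · simp [coeffOp]
        · rintro ⟨i, l⟩ hx hne
          have : l ≠ j := by
            rintro rfl
            exact hne (by rw [Prod.mk.injEq]; exact ⟨by have := HasAntidiagonal.mem_antidiagonal.1 hx; simp at this; omega, rfl⟩)
          simp [coeffOp, this.symm]
        · intro hx; exact absurd (HasAntidiagonal.mem_antidiagonal.2 (by simp; omega)) hx
      · refine (Finset.sum_eq_zero fun x hx => ?_).symm
        have : x.2 ≠ j := by have := HasAntidiagonal.mem_antidiagonal.1 hx; omega
        simp [coeffOp, this.symm]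
  exact h1 Q

theorem CoeffCommute.mul_left {Ψ₁ Ψ₂ Ψ' : Module.End ℂ (ℕ →₀ VL)} (hx : IsXLinear Ψ₁)
    (h1 : CoeffCommute Ψ₁ Ψ') (h2 : CoeffCommute Ψ₂ Ψ') : CoeffCommute (Ψ₁ * Ψ₂) Ψ' := by
  intro i j v
  rw [coeffOp_mul hx, coeffOp_mul hx, coeffOp_sum]
  exact sum_congr rfl fun x _ => by rw [h2, h1]

theorem CoeffCommute.smul_left {Ψ Ψ' : Module.End ℂ (ℕ →₀ VL)} (r : ℂ) (h : CoeffCommute Ψ Ψ') :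
    CoeffCommute (r • Ψ) Ψ' := by
  intro i j v
  have : ∀ v, coeffOp (r • Ψ) i v = r • coeffOp Ψ i v := fun v => rfl
  rw [this, this, coeffOp_smul, h]

/-- The coefficient of `xⁱ` in `Φ(c + x)`, for all integers `i`. -/
noncomputable def phiCoeff (c : ℂ) : ℤ → Module.End ℂ VL
  | .ofNat i => Finsupp.lapply i ∘ₗ phiAt c ∘ₗ Finsupp.lsingle 0
  | .negSucc _ => 0

/-- The coefficient of `xⁱ` in the passage rule with factor `c + x - y`. Integer indices make it
uniform, the coefficients at negative indices being zero. -/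
theorem phiCoeff_loopOp (c : ℂ) (a : Gen) (ha : a.parity = 1) (n i : ℤ) (v : VL) :
    phiCoeff c i (loopOp a n v) = c • loopOp a n (phiCoeff c i v) + loopOp a n (phiCoeff c (i - 1) v)
      - loopOp a (n + 1) (phiCoeff c i v) := by
  cases i with
  | negSucc i =>
    have : (Int.negSucc i) - 1 = Int.negSucc (i + 1) := by omega
    rw [this]; simp [phiCoeff]
  | ofNat i =>
    change phiAt c (Finsupp.single 0 (loopOp a n v)) i = _
    rw [phiAt_single_loopOp, phiTwist_odd _ _ ha, twist, addX]
    simp only [LinearMap.sub_apply, Module.End.mul_apply, LinearMap.add_apply, LinearMap.smul_apply,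
      Module.End.one_apply, Finsupp.sub_apply, Finsupp.add_apply, Finsupp.smul_apply, coeffMap_apply]
    cases i with
    | zero =>
      have : Int.ofNat 0 - 1 = Int.negSucc 0 := rfl
      rw [mulX_apply_zero, this]
      simp [phiCoeff]
    | succ i =>
      rw [mulX_apply_succ]
      have : Int.ofNat (i + 1) - 1 = Int.ofNat i := by simp
      rw [this]
      rfl

/-- Both coefficients act on the vacuum by scalars. Moving both past an odd mode multiplies by two
commuting linear factors, so commutation propagates to all of `V`. -/
theorem phiCoeff_comm (c c' : ℂ) (i j : ℤ) (v : VL) :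
    phiCoeff c i (phiCoeff c' j v) = phiCoeff c' j (phiCoeff c i v) := by
  induction v using VL_induction_odd generalizing i j with
  | h0 =>
    have : ∀ (c : ℂ) (i : ℤ), ∃ r : ℂ, phiCoeff c i vac = r • vac := by
      intro c i
      cases i with
      | negSucc i => exact ⟨0, by simp [phiCoeff]⟩
      | ofNat i =>
        refine ⟨if i = 0 then 1 else 0, ?_⟩
        change phiAt c (Finsupp.single 0 vac) i = _
        rw [phiAt_vac, Finsupp.single_apply]
        simp [eq_comm]
    obtain ⟨r, hr⟩ := this c i
    obtain ⟨s, hs⟩ := this c' j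
    rw [hr, hs, map_smul, map_smul, hr, hs, smul_comm]
  | ha v w hv hw => simp only [map_add, hv, hw]
  | hs r v hv => simp only [map_smul, hv]
  | hg a n v ha hv =>
    simp only [phiCoeff_loopOp _ a ha, map_add, map_sub, map_smul, hv]
    module

theorem isXLinear_phiAt (c : ℂ) : IsXLinear (phiAt c) := phiAt_mulX c

theorem coeffCommute_phiAt (c c' : ℂ) : CoeffCommute (phiAt c) (phiAt c') := fun i j v =>
  phiCoeff_comm c c' i j v

/-! ### The operators of the assignment -/

/-- The series `Φ(q + x)`, `Φ(-q + x)`, `q Φ(q + x) Φ(-q + x)` in `e(x), f(x), h(x)`. -/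
noncomputable def newSeries (q : ℂ) : Gen → Module.End ℂ (ℕ →₀ VL)
  | .e => phiAt q
  | .f => phiAt (-q)
  | .h => q • (phiAt q * phiAt (-q))

/-- The coefficient of `x^{-n-1}` in `ā(x) P(x)` as a linear function of `P`. -/
noncomputable def fieldMulHom (a : Gen) (n : ℤ) : (ℕ →₀ VL) →ₗ[ℂ] VL :=
  Finsupp.lsum ℂ fun i => loopOp a (n + i)

theorem fieldMulHom_apply (a : Gen) (n : ℤ) (P : ℕ →₀ VL) : fieldMulHom a n P = fieldMul a P n := by
  simp [fieldMulHom, fieldMul]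

theorem fieldMulHom_single (a : Gen) (n : ℤ) (i : ℕ) (v : VL) :
    fieldMulHom a n (Finsupp.single i v) = loopOp a (n + i) v := by
  simp [fieldMulHom]

theorem fieldMulHom_mulX (a : Gen) (n : ℤ) (P : ℕ →₀ VL) :
    fieldMulHom a n (mulX P) = fieldMulHom a (n + 1) P := by
  induction P using Finsupp.induction_linear with
  | zero => simp
  | add f g hf hg => simp only [map_add, hf, hg]
  | single k v =>
    rw [mulX_single, fieldMulHom_single, fieldMulHom_single]
    push_cast
    rw [show n + ((k : ℤ) + 1) = n + 1 + k by ring]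

theorem fieldMulHom_mulX_pow (a : Gen) (n : ℤ) (j : ℕ) (P : ℕ →₀ VL) :
    fieldMulHom a n ((mulX ^ j) P) = fieldMulHom a (n + j) P := by
  induction j generalizing n with
  | zero => simp
  | succ j ih =>
    rw [pow_succ', Module.End.mul_apply, fieldMulHom_mulX, ih]
    push_cast
    rw [show n + ((j : ℤ) + 1) = n + 1 + j by ring]

/-- The operator `a(n)` of the assignment. -/
noncomputable def newOp (q : ℂ) (a : Gen) (n : ℤ) : Module.End ℂ VL :=
  fieldMulHom a n ∘ₗ newSeries q a ∘ₗ Finsupp.lsingle 0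

theorem newOp_apply (q : ℂ) (a : Gen) (n : ℤ) (w : VL) :
    newOp q a n w = fieldMulHom a n (newSeries q a (Finsupp.single 0 w)) := rfl

theorem newField_phi (q : ℂ) (a : Gen) (n : ℤ) (w : VL) : newField q phi a n w = newOp q a n w := by
  cases a
  · rw [newField, newOp_apply, phiShift_phi, fieldMulHom_apply]; rfl
  · rw [newField, newOp_apply, phiShift_phi, fieldMulHom_apply]; rfl
  · rw [newField, newOp_apply, phiShift_phi, phiShift_phi, ← fieldMulHom_apply, ← map_smul]; rfl

theorem isXLinear_newSeries (q : ℂ) (a : Gen) : IsXLinear (newSeries q a) := by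
  intro P
  cases a <;> simp [newSeries, phiAt_mulX]

theorem coeffCommute_newSeries (q : ℂ) (a b : Gen) : CoeffCommute (newSeries q a) (newSeries q b) := by
  have h1 : ∀ (a : Gen) (c : ℂ), CoeffCommute (newSeries q a) (phiAt c) := by
    intro a c
    cases a
    · exact coeffCommute_phiAt _ _
    · exact coeffCommute_phiAt _ _
    · exact ((coeffCommute_phiAt _ _).mul_left (isXLinear_phiAt _) (coeffCommute_phiAt _ _)).smul_left _
  cases b
  · exact h1 _ _
  · exact h1 _ _
  · exact (((h1 _ _).symm.mul_left (isXLinear_phiAt _) (h1 _ _).symm).smul_left _).symm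

/-! ### Products of two new fields and their common core -/

/-- The coefficient of `x₁^{-m-1} x₂^{-n-1}` in `ā(x₁) Ψ'(x₁) b̄(x₂) Ψ(x₁) Q(x₂)`. -/
noncomputable def mixed (a b : Gen) (Ψ' Ψ : Module.End ℂ (ℕ →₀ VL)) (Q : ℕ →₀ VL) (m n : ℤ) : VL :=
  Q.sum fun j v => fieldMulHom a m (Ψ' (coeffMap (loopOp b (n + j)) (Ψ (Finsupp.single 0 v))))

theorem newOp_newOp_eq_mixed (q : ℂ) (a b : Gen) (m n : ℤ) (w : VL) :
    newOp q a m (newOp q b n w)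
      = mixed a b (newSeries q a) 1 (newSeries q b (Finsupp.single 0 w)) m n := by
  rw [newOp_apply q b, fieldMulHom_apply, fieldMul, map_finsuppSum, mixed]
  refine Finsupp.sum_congr fun j _ => ?_
  rw [newOp_apply, Module.End.one_apply, coeffMap_single]

theorem mixed_smul (a b : Gen) (r : ℂ) (Ψ' Ψ : Module.End ℂ (ℕ →₀ VL)) (Q : ℕ →₀ VL) :
    mixed a b (r • Ψ') Ψ Q = mixed a b Ψ' (r • Ψ) Q := by
  funext m n
  refine Finsupp.sum_congr fun j _ => ?_
  simp only [LinearMap.smul_apply, map_smul]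

/-- Moving the rightmost factor `Φ(c + x₁)` of `Ψ'` through an odd `b̄(x₂)` costs exactly `c + x₁ -
x₂`. -/
theorem mixed_mul_phiAt (a b : Gen) (hb : b.parity = 1) (c : ℂ) {Ψ' : Module.End ℂ (ℕ →₀ VL)}
    (hΨ : IsXLinear Ψ') (Ψ : Module.End ℂ (ℕ →₀ VL)) (Q : ℕ →₀ VL) :
    mixed a b (Ψ' * phiAt c) Ψ Q = linArr c (mixed a b Ψ' (phiAt c * Ψ) Q) := by
  funext m n
  simp only [mixed, linArr, Finsupp.sum, Finset.smul_sum, ← Finset.sum_add_distrib,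
    ← Finset.sum_sub_distrib]
  refine sum_congr rfl fun j _ => ?_
  rw [Module.End.mul_apply, phiAt_coeffMap, phiTwist_odd _ _ hb, Module.End.mul_apply]
  simp only [twist, addX, LinearMap.sub_apply, LinearMap.add_apply, LinearMap.smul_apply,
    Module.End.mul_apply, Module.End.one_apply, map_sub, map_add, map_smul, hΨ _, fieldMulHom_mulX]
  rw [show n + (j : ℤ) + 1 = n + 1 + j by ring]

/-- The passage through `h̄(x₂)` costs the square, as `h̄` is a bracket of two odd fields. -/
theorem mixed_mul_phiAt_h (a : Gen) (c : ℂ) {Ψ' : Module.End ℂ (ℕ →₀ VL)}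
    (hΨ : IsXLinear Ψ') (Ψ : Module.End ℂ (ℕ →₀ VL)) (Q : ℕ →₀ VL) :
    mixed a .h (Ψ' * phiAt c) Ψ Q = linArr c (linArr c (mixed a .h Ψ' (phiAt c * Ψ) Q)) := by
  funext m n
  simp only [mixed, linArr, Finsupp.sum, Finset.smul_sum, ← Finset.sum_add_distrib,
    ← Finset.sum_sub_distrib]
  refine sum_congr rfl fun j _ => ?_
  rw [Module.End.mul_apply, phiAt_coeffMap, Module.End.mul_apply]
  simp only [phiTwist, twistTwo, addX, LinearMap.sub_apply, LinearMap.add_apply,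
    LinearMap.smul_apply, Module.End.mul_apply, Module.End.one_apply, map_sub, map_add, map_smul,
    hΨ _, fieldMulHom_mulX]
  rw [show n + (j : ℤ) + 1 = n + 1 + j by ring, show n + (j : ℤ) + 2 = n + 1 + 1 + j by ring]
  module

/-- The coefficient of `x₁^{-m-1} x₂^{-n-1}` in `ā(x₁) b̄(x₂) Ψ_a(x₁) Ψ_b(x₂) w`. -/
noncomputable def core (q : ℂ) (a b : Gen) (w : VL) : ℤ → ℤ → VL :=
  mixed a b 1 (newSeries q a) (newSeries q b (Finsupp.single 0 w))

theorem newOp_newOp_e (q : ℂ) (b : Gen) (hb : b.parity = 1) (w : VL) :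
    (fun m n => newOp q .e m (newOp q b n w)) = linArr q (core q .e b w) := by
  funext m n
  rw [newOp_newOp_eq_mixed]
  have := mixed_mul_phiAt .e b hb q (Ψ' := 1) (fun P => rfl) 1 (newSeries q b (Finsupp.single 0 w))
  rw [one_mul, mul_one] at this
  exact congrFun (congrFun this m) n

theorem newOp_newOp_f (q : ℂ) (b : Gen) (hb : b.parity = 1) (w : VL) :
    (fun m n => newOp q .f m (newOp q b n w)) = linArr (-q) (core q .f b w) := by
  funext m n
  rw [newOp_newOp_eq_mixed]
  have := mixed_mul_phiAt .f b hb (-q) (Ψ' := 1) (fun P => rfl) 1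
    (newSeries q b (Finsupp.single 0 w))
  rw [one_mul, mul_one] at this
  exact congrFun (congrFun this m) n

theorem newOp_newOp_e_h (q : ℂ) (w : VL) :
    (fun m n => newOp q .e m (newOp q .h n w)) = linArr q (linArr q (core q .e .h w)) := by
  funext m n
  rw [newOp_newOp_eq_mixed]
  have := mixed_mul_phiAt_h .e q (Ψ' := 1) (fun P => rfl) 1 (newSeries q .h (Finsupp.single 0 w))
  rw [one_mul, mul_one] at this
  exact congrFun (congrFun this m) n

theorem newOp_newOp_f_h (q : ℂ) (w : VL) :
    (fun m n => newOp q .f m (newOp q .h n w)) = linArr (-q) (linArr (-q) (core q .f .h w)) := by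
  funext m n
  rw [newOp_newOp_eq_mixed]
  have := mixed_mul_phiAt_h .f (-q) (Ψ' := 1) (fun P => rfl) 1
    (newSeries q .h (Finsupp.single 0 w))
  rw [one_mul, mul_one] at this
  exact congrFun (congrFun this m) n

theorem newOp_newOp_h (q : ℂ) (b : Gen) (hb : b.parity = 1) (w : VL) :
    (fun m n => newOp q .h m (newOp q b n w)) = linArr (-q) (linArr q (core q .h b w)) := by
  funext m n
  rw [newOp_newOp_eq_mixed]
  set Q := newSeries q b (Finsupp.single 0 w) with hQ
  have h0 : newSeries q .h = q • (phiAt q * phiAt (-q)) := rfl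
  have h1 := mixed_mul_phiAt .h b hb (-q) (isXLinear_phiAt q) (q • 1) Q
  have h2 := mixed_mul_phiAt .h b hb q (Ψ' := 1) (fun P => rfl) (phiAt (-q) * (q • 1)) Q
  rw [one_mul] at h2
  -- The scalar `q` is first carried to the right end; then the factors `Φ(-q + x₁)` and `Φ(q + x₁)`
  -- are moved through one after the other.
  rw [h0, mixed_smul, h1, h2, mul_smul_comm, mul_one, mul_smul_comm]
  rfl

theorem newOp_newOp_h_h (q : ℂ) (w : VL) :
    (fun m n => newOp q .h m (newOp q .h n w))
      = linArr (-q) (linArr (-q) (linArr q (linArr q (core q .h .h w)))) := by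
  funext m n
  rw [newOp_newOp_eq_mixed]
  set Q := newSeries q .h (Finsupp.single 0 w) with hQ
  have h0 : newSeries q .h = q • (phiAt q * phiAt (-q)) := rfl
  have h1 := mixed_mul_phiAt_h .h (-q) (isXLinear_phiAt q) (q • 1) Q
  have h2 := mixed_mul_phiAt_h .h q (Ψ' := 1) (fun P => rfl) (phiAt (-q) * (q • 1)) Q
  rw [one_mul] at h2
  rw [h0, mixed_smul, h1, h2, mul_smul_comm, mul_one, mul_smul_comm]
  rfl

theorem fieldMulHom_eq_sum (a : Gen) (n : ℤ) (P : ℕ →₀ VL) (N : ℕ) (h : ∀ i, N ≤ i → P i = 0) :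
    fieldMulHom a n P = ∑ i ∈ range N, loopOp a (n + i) (P i) := by
  rw [fieldMulHom_apply, fieldMul, Finsupp.sum_of_support_subset P (s := range N)]
  · intro i hi
    by_contra hc
    exact (Finsupp.mem_support_iff.1 hi) (h i (by simpa using hc))
  · simp

theorem core_eq_sum (q : ℂ) (a b : Gen) (w : VL) (m n : ℤ) (N : ℕ)
    (h1 : ∀ j, N ≤ j → coeffOp (newSeries q b) j w = 0)
    (h2 : ∀ i j, N ≤ i → coeffOp (newSeries q a) i (coeffOp (newSeries q b) j w) = 0) :
    core q a b w m n = ∑ j ∈ range N, ∑ i ∈ range N,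
      loopOp a (m + i) (loopOp b (n + j) (coeffOp (newSeries q a) i (coeffOp (newSeries q b) j w))) := by
  rw [core, mixed, Finsupp.sum_of_support_subset _ (s := range N)]
  · refine sum_congr rfl fun j _ => ?_
    rw [Module.End.one_apply, fieldMulHom_eq_sum a m _ N]
    · rfl
    · intro i hi
      rw [coeffMap_apply]
      exact (congrArg _ (h2 i j hi)).trans (map_zero _)
  · intro j hj
    by_contra hc
    exact (Finsupp.mem_support_iff.1 hj) (h1 j (by simpa using hc))
  · intro j _
    simp

theorem exists_bound (Ψ : Module.End ℂ (ℕ →₀ VL)) (v : VL) : ∃ N, ∀ i, N ≤ i → coeffOp Ψ i v = 0 := by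
  refine ⟨(Ψ (Finsupp.single 0 v)).support.sup id + 1, fun i hi => ?_⟩
  by_contra hc
  have := Finset.le_sup (f := id) (Finsupp.mem_support_iff.2 hc)
  simp only [id] at this
  omega

theorem exists_bound_two (Ψ Ψ' : Module.End ℂ (ℕ →₀ VL)) (w : VL) : ∃ N,
    (∀ j, N ≤ j → coeffOp Ψ' j w = 0) ∧ ∀ i j, N ≤ i → coeffOp Ψ i (coeffOp Ψ' j w) = 0 := by
  obtain ⟨N, hN⟩ := exists_bound Ψ' w
  choose K hK using fun j => exists_bound Ψ (coeffOp Ψ' j w)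
  refine ⟨N + ∑ j ∈ range N, K j, fun j hj => hN j (by omega), fun i j hi => ?_⟩
  by_cases hj : j < N
  · have := Finset.single_le_sum (f := K) (fun i _ => Nat.zero_le _) (Finset.mem_range.2 hj)
    exact hK j i (by omega)
  · rw [hN j (by omega)]
    simp [coeffOp]

/-- Since the coefficients of the two series commute, both orders can be written with the same
family of vectors. A common truncation reduces super-commutation of fields to that of single modes,
termwise. -/
theorem core_swap_aux (q : ℂ) (a b : Gen) (w : VL) : ∃ N : ℕ,
    (∀ m n : ℤ, core q a b w m n = ∑ j ∈ range N, ∑ i ∈ range N, loopOp a (m + i)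
      (loopOp b (n + j) (coeffOp (newSeries q a) i (coeffOp (newSeries q b) j w)))) ∧
    (∀ m n : ℤ, core q b a w n m = ∑ j ∈ range N, ∑ i ∈ range N, loopOp b (n + j)
      (loopOp a (m + i) (coeffOp (newSeries q a) i (coeffOp (newSeries q b) j w)))) ∧
    (∀ k : ℤ, fieldMulHom .h k (newSeries q a (newSeries q b (Finsupp.single 0 w)))
      = ∑ j ∈ range N, ∑ i ∈ range N,
        loopOp .h (k + i + j) (coeffOp (newSeries q a) i (coeffOp (newSeries q b) j w))) := by
  obtain ⟨N₁, h1, h2⟩ := exists_bound_two (newSeries q a) (newSeries q b) w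
  obtain ⟨N₂, h3, h4⟩ := exists_bound_two (newSeries q b) (newSeries q a) w
  refine ⟨N₁ + N₂, fun m n => ?_, fun m n => ?_, fun k => ?_⟩
  · exact core_eq_sum q a b w m n _ (fun j hj => h1 j (by omega)) fun i j hi => h2 i j (by omega)
  · rw [core_eq_sum q b a w n m (N₁ + N₂) (fun j hj => h3 j (by omega))
      fun i j hi => h4 i j (by omega), sum_comm]
    refine sum_congr rfl fun j _ => sum_congr rfl fun i _ => ?_
    rw [coeffCommute_newSeries q a b]
  · set Q := newSeries q b (Finsupp.single 0 w) with hQ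
    have h5 : fieldMulHom .h k (newSeries q a Q)
        = Q.sum fun j v => fieldMulHom .h (k + j) (newSeries q a (Finsupp.single 0 v)) := by
      conv_lhs => rw [← Finsupp.sum_single Q]
      rw [map_finsuppSum, map_finsuppSum]
      refine Finsupp.sum_congr fun j _ => ?_
      rw [(isXLinear_newSeries q a).single, fieldMulHom_mulX_pow]
    rw [h5, Finsupp.sum_of_support_subset _ (s := range (N₁ + N₂))]
    · refine sum_congr rfl fun j _ => ?_
      refine (fieldMulHom_eq_sum .h _ (newSeries q a (Finsupp.single 0 (Q j))) (N₁ + N₂)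
        fun i hi => h2 i j (by omega)).trans ?_
      refine sum_congr rfl fun i _ => ?_
      rw [show k + (j : ℤ) + i = k + i + j by ring]
      rfl
    · intro j hj
      by_contra hc
      exact (Finsupp.mem_support_iff.1 hj) (h1 j (by simp at hc; omega))
    · intro j _
      simp

theorem core_swap_odd (q : ℂ) (a b : Gen) (ha : a.parity = 1) (hb : b.parity = 1) (w : VL) (m n : ℤ) :
    core q a b w m n + core q b a w n m = structConst a b .h •
      fieldMulHom .h (m + n) (newSeries q a (newSeries q b (Finsupp.single 0 w))) := by
  obtain ⟨N, h1, h2, h3⟩ := core_swap_aux q a b w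
  rw [h1, h2, h3]
  simp only [← sum_add_distrib, smul_sum]
  refine sum_congr rfl fun j _ => sum_congr rfl fun i _ => ?_
  rw [loopOp_odd a b ha hb, show m + (i : ℤ) + (n + j) = m + n + i + j by ring]

theorem core_swap_h (q : ℂ) (b : Gen) (w : VL) (m n : ℤ) :
    core q b .h w n m = core q .h b w m n := by
  obtain ⟨N, h1, h2, h3⟩ := core_swap_aux q .h b w
  rw [h1, h2]
  refine sum_congr rfl fun j _ => sum_congr rfl fun i _ => ?_
  rw [loopOp_h_comm]

/-- Finitely many vectors enter `core`, and each is killed by all high modes; this permits clearing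
denominators. -/
theorem isSummable_core (q : ℂ) (a b : Gen) (w : VL) : IsSummable (core q a b w) := by
  obtain ⟨N, h1, -, -⟩ := core_swap_aux q a b w
  choose K hK using fun v : VL => loopOp_trunc v
  refine isSummable_of_right ?_ fun n => ?_
  · refine ⟨∑ j ∈ range N, ∑ i ∈ range N,
      K (coeffOp (newSeries q a) i (coeffOp (newSeries q b) j w)), fun m n hn => ?_⟩
    rw [h1]
    refine sum_eq_zero fun j hj => sum_eq_zero fun i hi => ?_
    have h2 := Finset.single_le_sum (f := fun j : ℕ => ∑ i ∈ range N,
      K (coeffOp (newSeries q a) i (coeffOp (newSeries q b) j w))) (fun i _ => Nat.zero_le _) hj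
    have h3 := Finset.single_le_sum (f := fun i : ℕ =>
      K (coeffOp (newSeries q a) i (coeffOp (newSeries q b) j w))) (fun i _ => Nat.zero_le _) hi
    have h4 := h3.trans h2
    rw [hK _ b (n + j), map_zero]
    have h5 : ((K (coeffOp (newSeries q a) i (coeffOp (newSeries q b) j w)) : ℕ) : ℤ) ≤ n :=
      le_trans (by exact_mod_cast h4) hn
    omega
  · refine ⟨∑ j ∈ range N, ∑ i ∈ range N,
      K (loopOp b (n + j) (coeffOp (newSeries q a) i (coeffOp (newSeries q b) j w))),
      fun m hm => ?_⟩
    rw [h1]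
    refine sum_eq_zero fun j hj => sum_eq_zero fun i hi => ?_
    have h2 := Finset.single_le_sum (f := fun j : ℕ => ∑ i ∈ range N,
      K (loopOp b (n + j) (coeffOp (newSeries q a) i (coeffOp (newSeries q b) j w))))
      (fun i _ => Nat.zero_le _) hj
    have h3 := Finset.single_le_sum (f := fun i : ℕ =>
      K (loopOp b (n + j) (coeffOp (newSeries q a) i (coeffOp (newSeries q b) j w))))
      (fun i _ => Nat.zero_le _) hi
    have h4 := h3.trans h2
    refine hK _ a _ ?_
    have h5 : ((K (loopOp b (n + j) (coeffOp (newSeries q a) i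
        (coeffOp (newSeries q b) j w))) : ℕ) : ℤ) ≤ m := le_trans (by exact_mod_cast h4) hm
    omega

theorem linArr_neg (c : ℂ) (B : ℤ → ℤ → VL) : linArr c (fun m n => - B m n)
    = fun m n => - linArr c B m n := by
  funext m n
  simp only [linArr]
  module

theorem isSummable_linArr (c : ℂ) {B : ℤ → ℤ → VL} (hB : IsSummable B) : IsSummable (linArr c B) := by
  intro m n
  have h1 := hB m n
  have h2 := hB (m + 1) n
  have h3 := hB m (n + 1)
  refine ((h1.union h2).union h3).subset fun d hd => ?_
  by_contra hc
  simp only [Set.mem_union, Set.mem_ofPred_eq, not_or, not_not] at hc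
  refine hd ?_
  rw [linArr, hc.1.1, show m + (d 0 : ℤ) + 1 = m + 1 + d 0 by ring,
    show n + (d 1 : ℤ) + 1 = n + 1 + d 1 by ring, hc.1.2, hc.2]
  simp

/-! ### The defining relations hold on `V` -/

theorem linArr_linArr_comm (c c' : ℂ) (B : ℤ → ℤ → VL) :
    linArr c (linArr c' B) = linArr c' (linArr c B) := by
  funext m n
  simp only [linArr]
  module

/-- Here `c + x₂ - x₁ = -(-c + x₁ - x₂)`. -/
theorem linArr_swap_eq (c : ℂ) {B B' : ℤ → ℤ → VL} (h : ∀ m n, B' n m = B m n) (m n : ℤ) :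
    linArr c B' n m = - linArr (-c) B m n := by
  simp only [linArr, h]
  module

theorem linArr_linArr_swap_eq (c c' : ℂ) {B B' : ℤ → ℤ → VL} (h : ∀ m n, B' n m = B m n) (m n : ℤ) :
    linArr c (linArr c' B') n m = linArr (-c) (linArr (-c') B) m n := by
  simp only [linArr, h]
  module

theorem newOp_trunc (q : ℂ) (w : VL) : ∃ N : ℤ, ∀ n, N ≤ n → ∀ a : Gen, newOp q a n w = 0 := by
  have h : ∀ a : Gen, ∃ N : ℤ, ∀ n, N ≤ n → newOp q a n w = 0 := by
    intro a
    choose K hK using fun v : VL => loopOp_trunc v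
    refine ⟨∑ i ∈ (newSeries q a (Finsupp.single 0 w)).support,
      (K (newSeries q a (Finsupp.single 0 w) i) : ℤ), fun n hn => ?_⟩
    rw [newOp_apply, fieldMulHom_apply, fieldMul]
    refine Finset.sum_eq_zero fun i hi => hK _ _ _ ?_
    have := Finset.single_le_sum (f := fun i => (K (newSeries q a (Finsupp.single 0 w) i) : ℤ))
      (fun i _ => by positivity) hi
    omega
  choose N hN using h
  refine ⟨max (N .e) (max (N .f) (N .h)), fun n hn a => hN a n ?_⟩
  cases a <;> omega

/-- One order is `q + x₁ - x₂` times `core`. In the other, the sign from `q + x₂ - x₁` cancels the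
sign from anticommuting the odd fields, leaving `-q + x₁ - x₂` times the same `core`. -/
theorem newOp_e_e (q : ℂ) (hq : q ≠ 0) (m n : ℤ) (w : VL) : newOp q .e m (newOp q .e n w)
    = act (exchange q) (fun m n => newOp q .e n (newOp q .e m w)) m n := by
  have hE := newOp_newOp_e q .e rfl w
  have hO : (fun m n => newOp q .e n (newOp q .e m w)) = linArr (-q) (core q .e .e w) := by
    funext m n
    have h := core_swap_odd q .e .e rfl rfl w
    rw [congrFun (congrFun hE n) m, linArr_swap_eq q (B := fun m n => - core q .e .e w m n),
      linArr_neg, neg_neg]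
    intro m n
    have := h m n
    simp only [structConst, zero_smul] at this
    exact eq_neg_of_add_eq_zero_right this
  rw [hO, act_exchange hq (isSummable_core _ _ _ _), ← hE]

theorem newOp_f_f (q : ℂ) (hq : q ≠ 0) (m n : ℤ) (w : VL) : newOp q .f m (newOp q .f n w)
    = act (exchange (-q)) (fun m n => newOp q .f n (newOp q .f m w)) m n := by
  have hE := newOp_newOp_f q .f rfl w
  have hO : (fun m n => newOp q .f n (newOp q .f m w)) = linArr (-(-q)) (core q .f .f w) := by
    funext m n
    have h := core_swap_odd q .f .f rfl rfl w
    rw [congrFun (congrFun hE n) m, linArr_swap_eq (-q) (B := fun m n => - core q .f .f w m n),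
      linArr_neg, neg_neg]
    intro m n
    have := h m n
    simp only [structConst, zero_smul] at this
    exact eq_neg_of_add_eq_zero_right this
  rw [hO, act_exchange (neg_ne_zero.2 hq) (isSummable_core _ _ _ _), ← hE]

/-- With `h` first the factors are `(-q + x₁ - x₂)(q + x₁ - x₂)`; with `e` first they are `(q + x₂ -
x₁)² = (-q + x₁ - x₂)²`. The quotient is the exchange series. -/
theorem newOp_h_e (q : ℂ) (hq : q ≠ 0) (m n : ℤ) (w : VL) : newOp q .h m (newOp q .e n w)
    = act (exchange q) (fun m n => newOp q .e n (newOp q .h m w)) m n := by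
  have hO : (fun m n => newOp q .e n (newOp q .h m w))
      = linArr (-q) (linArr (-q) (core q .h .e w)) := by
    funext m n
    rw [congrFun (congrFun (newOp_newOp_e_h q w) n) m]
    exact linArr_linArr_swap_eq q q (core_swap_h q .e w) m n
  rw [hO, act_exchange hq (isSummable_linArr _ (isSummable_core _ _ _ _)), linArr_linArr_comm,
    ← newOp_newOp_h q .e rfl]

theorem newOp_h_f (q : ℂ) (hq : q ≠ 0) (m n : ℤ) (w : VL) : newOp q .h m (newOp q .f n w)
    = act (exchange (-q)) (fun m n => newOp q .f n (newOp q .h m w)) m n := by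
  have hO : (fun m n => newOp q .f n (newOp q .h m w))
      = linArr (-(-q)) (linArr (-(-q)) (core q .h .f w)) := by
    funext m n
    rw [congrFun (congrFun (newOp_newOp_f_h q w) n) m]
    exact linArr_linArr_swap_eq (-q) (-q) (core_swap_h q .f w) m n
  rw [hO, act_exchange (neg_ne_zero.2 hq) (isSummable_linArr _ (isSummable_core _ _ _ _)), neg_neg,
    ← newOp_newOp_h q .f rfl]

/-- The product of the four linear factors is symmetric in `x₁, x₂`, and so is `core`. -/
theorem newOp_h_h (q : ℂ) (m n : ℤ) (w : VL) : newOp q .h m (newOp q .h n w)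
    = newOp q .h n (newOp q .h m w) := by
  rw [congrFun (congrFun (newOp_newOp_h_h q w) n) m, congrFun (congrFun (newOp_newOp_h_h q w) m) n,
    linArr_linArr_swap_eq (-q) (-q) (B := linArr (-q) (linArr (-q) (core q .h .h w)))]
  · simp only [neg_neg]
    rw [linArr_linArr_comm (-q) q, linArr_linArr_comm (-q) q, linArr_linArr_comm (-q) q,
      linArr_linArr_comm (-q) q]
  · exact linArr_linArr_swap_eq q q (core_swap_h q .h w)

/-- As `-q + x₂ - x₁ = -(q + x₁ - x₂)`, the commutator is `q + x₁ - x₂` times an anticommutator of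
odd fields, which is a delta function times `h̄`. -/
theorem newOp_e_f (q : ℂ) (m n : ℤ) (w : VL) :
    newOp q .e m (newOp q .f n w) - newOp q .f n (newOp q .e m w) = newOp q .h (m + n) w := by
  have h := core_swap_odd q .e .f rfl rfl w
  have h' : ∀ m n : ℤ, core q .f .e w n m = fieldMulHom .h (m + n)
      (newSeries q .e (newSeries q .f (Finsupp.single 0 w))) - core q .e .f w m n := by
    intro m n
    have := h m n
    rw [structConst, one_smul] at this
    rw [← this, add_sub_cancel_left]
  rw [congrFun (congrFun (newOp_newOp_e q .f rfl w) m) n,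
    congrFun (congrFun (newOp_newOp_f q .e rfl w) n) m]
  -- The anticommutator depends only on the sum of the indices, so the contributions of `x₁` and
  -- `-x₂` cancel and only the factor `q` remains.
  simp only [linArr, h']
  rw [show m + 1 + n = m + n + 1 by ring, show m + (n + 1) = m + n + 1 by ring,
    show newOp q .h (m + n) w = q • fieldMulHom .h (m + n)
      (newSeries q .e (newSeries q .f (Finsupp.single 0 w))) from map_smul (fieldMulHom .h (m + n)) q
        (newSeries q .e (newSeries q .f (Finsupp.single 0 w)))]
  module

/-! ### The module structure on `V` -/

/-- The `T`-module structure on `V`. -/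
noncomputable def newRep (q : ℂ) : Tensor →ₐ[ℂ] Module.End ℂ VL :=
  FreeAlgebra.lift ℂ fun p => newOp q p.1 p.2

theorem newRep_tgen (q : ℂ) (a : Gen) (n : ℤ) : newRep q (tgen a n) = newOp q a n :=
  FreeAlgebra.lift_ι_apply _ _

theorem isAssignment_newRep (q : ℂ) : IsAssignment q phi (newRep q) := fun a n w => by
  rw [newRep_tgen, newField_phi]

theorem IsAssignment.eq_newRep {q : ℂ} {ρ : Tensor →ₐ[ℂ] Module.End ℂ VL}
    (h : IsAssignment q phi ρ) : ρ = newRep q := by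
  refine FreeAlgebra.hom_ext (funext fun p => LinearMap.ext fun w => ?_)
  exact (h p.1 p.2 w).trans (isAssignment_newRep q p.1 p.2 w).symm

theorem isDYModule_newRep (q : ℂ) (hq : q ≠ 0) : IsDYModule q (newRep q) where
  trunc w := by
    obtain ⟨N, hN⟩ := newOp_trunc q w
    exact ⟨N, fun n hn a => by rw [newRep_tgen]; exact hN n hn a⟩
  rel r m n w := by
    rw [relDefect_eq]
    simp only [newRep_tgen]
    cases r
    · simp only [DYRel.series, DYRel.fst, DYRel.snd, DYRel.delta, zero_smul, sub_zero, sub_eq_zero]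
      exact newOp_e_e q hq m n w
    · simp only [DYRel.series, DYRel.fst, DYRel.snd, DYRel.delta, zero_smul, sub_zero, sub_eq_zero]
      exact newOp_f_f q hq m n w
    · simp only [DYRel.series, DYRel.fst, DYRel.snd, DYRel.delta, one_smul, act_one, sub_eq_zero]
      exact newOp_e_f q m n w
    · simp only [DYRel.series, DYRel.fst, DYRel.snd, DYRel.delta, zero_smul, sub_zero, sub_eq_zero]
      exact newOp_h_e q hq m n w
    · simp only [DYRel.series, DYRel.fst, DYRel.snd, DYRel.delta, zero_smul, sub_zero, sub_eq_zero,
        act_one]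
      exact newOp_h_h q m n w
    · simp only [DYRel.series, DYRel.fst, DYRel.snd, DYRel.delta, zero_smul, sub_zero, sub_eq_zero]
      exact newOp_h_f q hq m n w

theorem newOp_vac (q : ℂ) (a : Gen) (n : ℤ) (hn : 0 ≤ n) : newOp q a n vac = 0 := by
  have h : newOp q a n vac = (if a = .h then q else 1) • loopOp a n vac := by
    rw [newOp_apply]
    cases a <;> simp [newSeries, phiAt_vac, fieldMulHom_single]
  rw [h, loopOp_vac a n hn, smul_zero]

/-! ### The translation operator -/

theorem vertexOp_loopOp_vac (a : Gen) (n m : ℤ) (v : VL) :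
    (vertexOp (loopOp a n v)).1 m vac
      = ∑ᶠ j : ℕ, binCoeff n j • loopOp a (n - j) ((vertexOp v).1 (m + j) vac) := by
  have h : (rightOp a n (vertexOp v)).1 m vac = 0 := by
    change (-1 : ℂ) ^ n • ∑ᶠ j : ℕ, binCoeff n j • (parityOp ^ a.parity)
      ((vertexOp v).1 (m + n - j) ((parityOp ^ a.parity) (loopOp a j vac))) = 0
    rw [finsum_congr (g := fun _ : ℕ => (0 : VL)) fun j => by
      rw [loopOp_vac a j (by omega), map_zero, map_zero, map_zero, smul_zero], finsum_zero, smul_zero]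
  rw [vertexOp_loopOp]
  change (leftOp a n (vertexOp v)).1 m vac - (rightOp a n (vertexOp v)).1 m vac = _
  rw [h, sub_zero]
  rfl

/-- Half of the creation property: on the vacuum only the left part of the `n`-th product survives,
and it uses only indices at least `k`. -/
theorem vertexOp_vac_nonneg (v : VL) (k : ℤ) (hk : 0 ≤ k) : (vertexOp v).1 k vac = 0 := by
  induction v using VL_induction generalizing k with
  | h0 =>
    rw [vertexOp_vac]
    change (if k = -1 then 1 else 0 : Module.End ℂ VL) vac = 0
    rw [if_neg (by omega), LinearMap.zero_apply]
  | ha v w hv hw =>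
    rw [map_add]
    change (vertexOp v).1 k vac + (vertexOp w).1 k vac = 0
    rw [hv k hk, hw k hk, add_zero]
  | hs r v hv =>
    rw [map_smul]
    change r • (vertexOp v).1 k vac = 0
    rw [hv k hk, smul_zero]
  | hg a n v hv =>
    rw [vertexOp_loopOp_vac, finsum_congr (g := fun _ : ℕ => (0 : VL)) fun j => by
      rw [hv _ (by omega), map_zero, smul_zero], finsum_zero]

theorem vertexOp_vac_neg_one (v : VL) : (vertexOp v).1 (-1) vac = v := by
  induction v using VL_induction with
  | h0 =>
    rw [vertexOp_vac]
    change (if (-1 : ℤ) = -1 then 1 else 0 : Module.End ℂ VL) vac = vac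
    rw [if_pos rfl, Module.End.one_apply]
  | ha v w hv hw =>
    rw [map_add]
    change (vertexOp v).1 (-1) vac + (vertexOp w).1 (-1) vac = _
    rw [hv, hw]
  | hs r v hv =>
    rw [map_smul]
    change r • (vertexOp v).1 (-1) vac = _
    rw [hv]
  | hg a n v hv =>
    rw [vertexOp_loopOp_vac, finsum_range _ 1 fun j hj => by
      rw [vertexOp_vac_nonneg _ _ (by omega), map_zero, smul_zero]]
    simp [hv, binCoeff]

theorem transOp_vac : transOp vac = 0 := by
  change (vertexOp vac).1 (-2) vac = 0
  rw [vertexOp_vac]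
  change (if (-2 : ℤ) = -1 then 1 else 0 : Module.End ℂ VL) vac = 0
  rw [if_neg (by omega), LinearMap.zero_apply]

/-- Of the residue expansion at index `-2` only `j = 0` and `j = 1` survive, by the creation
property. -/
theorem transOp_loopOp (a : Gen) (n : ℤ) (v : VL) :
    transOp (loopOp a n v) = loopOp a n (transOp v) - (n : ℂ) • loopOp a (n - 1) v := by
  change (vertexOp (loopOp a n v)).1 (-2) vac = loopOp a n ((vertexOp v).1 (-2) vac) - _
  rw [vertexOp_loopOp_vac, finsum_range _ 2 fun j hj => by
    rw [vertexOp_vac_nonneg _ _ (by omega), map_zero, smul_zero], sum_range_succ, sum_range_one]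
  have h1 : binCoeff n 1 = -(n : ℂ) := by simp [binCoeff]
  have h0 : binCoeff n 0 = 1 := by simp [binCoeff]
  have h2 : (-2 : ℤ) + ((1 : ℕ) : ℤ) = -1 := rfl
  rw [h0, h1, h2, vertexOp_vac_neg_one]
  simp [sub_eq_add_neg]

/-- In series form, the commutator of `𝒟` with `Φ(c + x)` is its derivative in `x`. The factor `c +
x - y` is annihilated by the sum of the derivatives in `x` and `y`, so the rule passes through odd
modes. -/
theorem transOp_phiCoeff (c : ℂ) (i : ℤ) (v : VL) : transOp (phiCoeff c i v)
    = phiCoeff c i (transOp v) + ((i : ℂ) + 1) • phiCoeff c (i + 1) v := by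
  induction v using VL_induction_odd generalizing i with
  | h0 =>
    have h : ∀ i : ℤ, phiCoeff c i vac = if i = 0 then vac else 0 := by
      intro i
      cases i with
      | negSucc i => simp [phiCoeff]
      | ofNat i =>
        change phiAt c (Finsupp.single 0 vac) i = _
        rw [phiAt_vac, Finsupp.single_apply]
        simp [eq_comm]
    rw [transOp_vac, map_zero, h, h]
    by_cases hi : i + 1 = 0
    · have : (i : ℂ) + 1 = 0 := by exact_mod_cast hi
      rw [this, if_neg (by omega)]
      simp
    · rw [if_neg hi]
      split_ifs <;> simp [transOp_vac]
  | ha v w hv hw => simp only [map_add, hv, hw]; module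
  | hs r v hv => simp only [map_smul, hv]; module
  | hg a n v ha hv =>
    simp only [phiCoeff_loopOp c a ha, transOp_loopOp, map_add, map_sub, map_smul, hv]
    simp only [sub_add_cancel, add_sub_cancel_right, Int.cast_sub, Int.cast_one, Int.cast_add]
    module

theorem newOp_odd_eq_sum (q : ℂ) (a : Gen) (c : ℂ) (ha : newSeries q a = phiAt c) (w : VL) :
    ∃ N₀ : ℕ, ∀ N : ℕ, N₀ ≤ N → phiCoeff c N w = 0 ∧
      ∀ n : ℤ, newOp q a n w = ∑ i ∈ range N, loopOp a (n + i) (phiCoeff c i w) := by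
  obtain ⟨N₀, h⟩ := exists_bound (phiAt c) w
  refine ⟨N₀, fun N hN => ⟨h N hN, fun n => ?_⟩⟩
  rw [newOp_apply, ha]
  exact fieldMulHom_eq_sum a n _ N fun i hi => h i (by omega)

theorem transOp_newOp_odd (q : ℂ) (a : Gen) (c : ℂ) (ha : newSeries q a = phiAt c) (n : ℤ) (w : VL) :
    transOp (newOp q a n w) = newOp q a n (transOp w) - (n : ℂ) • newOp q a (n - 1) w := by
  obtain ⟨N₁, h1⟩ := newOp_odd_eq_sum q a c ha w
  obtain ⟨N₂, h2⟩ := newOp_odd_eq_sum q a c ha (transOp w)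
  set N := N₁ + N₂ with hN
  obtain ⟨h3, h4⟩ := h1 N (by omega)
  rw [h4, h4, (h2 N (by omega)).2, map_sum, smul_sum, ← sum_sub_distrib]
  -- The derivative of `Φ(c + x)` and the derivative of `ā(x)` together form the derivative of the
  -- product; the excess is a telescoping sum whose boundary term vanishes because `N` exceeds the
  -- degree.
  have h5 : ∀ i ∈ range N, transOp (loopOp a (n + i) (phiCoeff c i w))
      = (loopOp a (n + i) (phiCoeff c i (transOp w))
        - (n : ℂ) • loopOp a (n - 1 + i) (phiCoeff c i w))
      + ((((i + 1 : ℕ) : ℂ) • loopOp a (n - 1 + (i + 1 : ℕ)) (phiCoeff c (i + 1 : ℕ) w))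
        - (i : ℂ) • loopOp a (n - 1 + i) (phiCoeff c i w)) := by
    intro i _
    rw [transOp_loopOp, transOp_phiCoeff, map_add, map_smul]
    push_cast
    rw [show n - 1 + ((i : ℤ) + 1) = n + i by ring, show n + (i : ℤ) - 1 = n - 1 + i by ring]
    module
  rw [sum_congr rfl h5, sum_add_distrib,
    sum_range_sub fun i : ℕ => (i : ℂ) • loopOp a (n - 1 + i) (phiCoeff c i w), h3]
  simp

theorem transOp_newOp (q : ℂ) (a : Gen) (n : ℤ) (w : VL) :
    transOp (newOp q a n w) = newOp q a n (transOp w) - (n : ℂ) • newOp q a (n - 1) w := by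
  cases a
  · exact transOp_newOp_odd q .e q rfl n w
  · exact transOp_newOp_odd q .f (-q) rfl n w
  -- The even field is the commutator with `f(0)`, and `𝒟` commutes with `f(0)`, so the odd case
  -- suffices.
  · have h : ∀ (n : ℤ) w, newOp q .h n w
        = newOp q .e n (newOp q .f 0 w) - newOp q .f 0 (newOp q .e n w) := by
      intro n w
      rw [newOp_e_f, add_zero]
    rw [h, h, h]
    simp only [map_sub, transOp_newOp_odd q .e q rfl, transOp_newOp_odd q .f (-q) rfl, map_smul,
      Int.cast_zero, zero_smul, sub_zero]
    module

theorem transOp_newRep_tgen (q : ℂ) (a : Gen) (n : ℤ) :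
    transOp * newRep q (tgen a n) - newRep q (tgen a n) * transOp
      = (-(n : ℂ)) • newRep q (tgen a (n - 1)) := by
  refine LinearMap.ext fun w => ?_
  rw [newRep_tgen, newRep_tgen]
  simp only [LinearMap.sub_apply, Module.End.mul_apply, LinearMap.smul_apply, transOp_newOp]
  module

/-- Commutation with `𝒟` and `d` are both derivations, so agreement on generators is enough. This is
what makes `J` act by zero on the vacuum. -/
theorem transOp_newRep (q : ℂ) (x : Tensor) :
    transOp * newRep q x - newRep q x * transOp = newRep q (tensorD x) := by
  induction x using FreeAlgebra.induction with
  | grade0 r =>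
    have : tensorD (algebraMap ℂ Tensor r) = 0 := by
      change (tensorDual (algebraMap ℂ Tensor r)).snd = 0
      rw [AlgHom.commutes]
      rfl
    rw [this, map_zero, AlgHom.commutes, ← Algebra.commutes, sub_self]
  | grade1 p =>
    have := tensorD_tgen p.1 p.2
    rw [show FreeAlgebra.ι ℂ p = tgen p.1 p.2 from rfl, this, map_smul, transOp_newRep_tgen]
  | mul x y hx hy =>
    rw [tensorD_mul, map_mul, map_add, map_mul, map_mul, ← hx, ← hy]
    noncomm_ring
  | add x y hx hy => rw [map_add, map_add, map_add, ← hx, ← hy]; noncomm_ring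

/-! ### Triangularity with respect to the conformal weight -/

/-- The span of the words of weight at most `N` in the loop superalgebra. -/
noncomputable def wtFil (N : ℤ) : Submodule ℂ VL := wordFil loopOp vac N N

theorem wordFil_le_wtFil (r N : ℤ) : wordFil loopOp vac r N ≤ wtFil N := by
  refine Submodule.span_mono ?_
  rintro _ ⟨L, h1, h2, h3, rfl⟩
  exact ⟨L, h1, h1.length_le.trans h3, h3, rfl⟩

theorem wtFil_mono {N N' : ℤ} (h : N ≤ N') : wtFil N ≤ wtFil N' := wordFil_mono h h

theorem loopOp_mem_wtFil {N N' : ℤ} (a : Gen) (n : ℤ) (h : N - n ≤ N') {v : VL} (hv : v ∈ wtFil N) :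
    loopOp a n v ∈ wtFil N' :=
  wtFil_mono h (wordFil_le_wtFil _ _ (isExchange_loopOp.apply_mem a n hv))

theorem wordVec_mem_wtFil (L : List (Gen × ℤ)) : wordVec loopOp vac L ∈ wtFil (wordWt L) :=
  wordFil_le_wtFil _ _ (isExchange_loopOp.wordVec_mem L)

theorem exists_mem_wtFil (v : VL) : ∃ N : ℕ, v ∈ wtFil N := by
  induction v using VL_induction with
  | h0 => exact ⟨0, wordVec_mem_wtFil []⟩
  | ha v w hv hw =>
    obtain ⟨N, hN⟩ := hv
    obtain ⟨M, hM⟩ := hw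
    exact ⟨N + M, Submodule.add_mem _ (wtFil_mono (by push_cast; omega) hN)
      (wtFil_mono (by push_cast; omega) hM)⟩
  | hs r v hv =>
    obtain ⟨N, hN⟩ := hv
    exact ⟨N, Submodule.smul_mem _ _ hN⟩
  | hg a n v hv =>
    obtain ⟨N, hN⟩ := hv
    exact ⟨N + n.natAbs, loopOp_mem_wtFil a n (by push_cast; have := neg_abs_le n; omega) hN⟩

/-- A vector of weight at most `N` that is an eigenvector of the constant term of `Φ(c + x)` with
eigenvalue `k`, up to vectors of smaller weight. -/
structure IsLeading (c : ℂ) (N : ℤ) (k : ℂ) (v : VL) : Prop where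
  coeff_mem : ∀ i, phiCoeff c i v ∈ wtFil N
  zero_mem : phiCoeff c 0 v - k • v ∈ wtFil (N - 1)

theorem phiCoeff_neg_one (c : ℂ) (v : VL) : phiCoeff c (-1) v = 0 := rfl

/-- In the constant term of the passage rule, `ā(n + 1)` has smaller weight effect than `ā(n)`, so
only the factor `c` is leading. -/
theorem IsLeading.loopOp_odd {c : ℂ} {N : ℤ} {k : ℂ} {v : VL} (h : IsLeading c N k v) (a : Gen)
    (ha : a.parity = 1) (n : ℤ) : IsLeading c (N - n) (c * k) (loopOp a n v) where
  coeff_mem i := by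
    rw [phiCoeff_loopOp c a ha]
    exact Submodule.sub_mem _ (Submodule.add_mem _
      (Submodule.smul_mem _ _ (loopOp_mem_wtFil a n le_rfl (h.coeff_mem i)))
      (loopOp_mem_wtFil a n le_rfl (h.coeff_mem _)))
      (loopOp_mem_wtFil a _ (by omega) (h.coeff_mem i))
  zero_mem := by
    rw [phiCoeff_loopOp c a ha, show (0 : ℤ) - 1 = -1 from rfl, phiCoeff_neg_one, map_zero, add_zero,
      show c • loopOp a n (phiCoeff c 0 v) - loopOp a (n + 1) (phiCoeff c 0 v)
        - (c * k) • loopOp a n v = c • loopOp a n (phiCoeff c 0 v - k • v)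
        - loopOp a (n + 1) (phiCoeff c 0 v) by rw [map_sub, map_smul]; module]
    exact Submodule.sub_mem _
      (Submodule.smul_mem _ _ (loopOp_mem_wtFil a n (by omega) h.zero_mem))
      (loopOp_mem_wtFil a _ (by omega) (h.coeff_mem 0))

theorem IsLeading.add {c : ℂ} {N : ℤ} {k : ℂ} {v w : VL} (h : IsLeading c N k v)
    (h' : IsLeading c N k w) : IsLeading c N k (v + w) where
  coeff_mem i := by rw [map_add]; exact Submodule.add_mem _ (h.coeff_mem i) (h'.coeff_mem i)
  zero_mem := by
    rw [map_add, smul_add, add_sub_add_comm]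
    exact Submodule.add_mem _ h.zero_mem h'.zero_mem

theorem IsLeading.loopOp_h {c : ℂ} {N : ℤ} {k : ℂ} {v : VL} (h : IsLeading c N k v) (n : ℤ) :
    IsLeading c (N - n) (c * (c * k)) (loopOp .h n v) := by
  rw [loopOp_h_eq]
  have h1 := (h.loopOp_odd .f rfl 0).loopOp_odd .e rfl n
  have h2 := (h.loopOp_odd .e rfl n).loopOp_odd .f rfl 0
  rw [sub_zero] at h1 h2
  exact h1.add h2

theorem isLeading_vac (c : ℂ) : IsLeading c 0 1 vac where
  coeff_mem i := by
    cases i with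
    | negSucc i => exact Submodule.zero_mem _
    | ofNat i =>
      change phiAt c (Finsupp.single 0 vac) i ∈ _
      rw [phiAt_vac, Finsupp.single_apply]
      split_ifs
      · exact wordVec_mem_wtFil []
      · exact Submodule.zero_mem _
  zero_mem := by
    have : phiCoeff c 0 vac = vac := by
      change phiAt c (Finsupp.single 0 vac) 0 = _
      rw [phiAt_vac, Finsupp.single_eq_same]
    rw [this, one_smul, sub_self]
    exact Submodule.zero_mem _

/-- The eigenvalue is a power of `c`, one factor for each odd letter and two for each `h̄`. -/
theorem exists_isLeading (c : ℂ) (hc : c ≠ 0) (L : List (Gen × ℤ)) :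
    ∃ k : ℂ, k ≠ 0 ∧ IsLeading c (wordWt L) k (wordVec loopOp vac L) := by
  induction L with
  | nil => exact ⟨1, one_ne_zero, isLeading_vac c⟩
  | cons p L ih =>
    obtain ⟨k, hk, h⟩ := ih
    obtain ⟨a, n⟩ := p
    rw [wordWt_cons, wordVec_cons]
    cases a
    · exact ⟨_, mul_ne_zero hc hk, h.loopOp_odd .e rfl n⟩
    · exact ⟨_, mul_ne_zero hc hk, h.loopOp_odd .f rfl n⟩
    · exact ⟨_, mul_ne_zero hc (mul_ne_zero hc hk), h.loopOp_h n⟩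

theorem phiCoeff_mem_wtFil (c : ℂ) (hc : c ≠ 0) (i : ℤ) {N : ℤ} {v : VL} (hv : v ∈ wtFil N) :
    phiCoeff c i v ∈ wtFil N := by
  refine (?_ : wtFil N ≤ (wtFil N).comap (phiCoeff c i)) hv
  refine Submodule.span_le.2 ?_
  rintro _ ⟨L, h1, h2, h3, rfl⟩
  obtain ⟨k, hk, h⟩ := exists_isLeading c hc L
  exact wtFil_mono h3 (h.coeff_mem i)

theorem coeffOp_newSeries_mem (q : ℂ) (hq : q ≠ 0) (a : Gen) (i : ℕ) {N : ℤ} {v : VL}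
    (hv : v ∈ wtFil N) : coeffOp (newSeries q a) i v ∈ wtFil N := by
  have hq' := neg_ne_zero.2 hq
  cases a
  · exact phiCoeff_mem_wtFil q hq i hv
  · exact phiCoeff_mem_wtFil (-q) hq' i hv
  · change q • coeffOp (phiAt q * phiAt (-q)) i v ∈ _
    rw [coeffOp_mul (isXLinear_phiAt q)]
    exact Submodule.smul_mem _ _ (Submodule.sum_mem _ fun x _ =>
      phiCoeff_mem_wtFil q hq x.1 (phiCoeff_mem_wtFil (-q) hq' x.2 hv))

theorem coeffOp_newSeries_zero (q : ℂ) (hq : q ≠ 0) (a : Gen) (L : List (Gen × ℤ)) :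
    ∃ k : ℂ, k ≠ 0 ∧ coeffOp (newSeries q a) 0 (wordVec loopOp vac L) - k • wordVec loopOp vac L
      ∈ wtFil (wordWt L - 1) := by
  have hq' := neg_ne_zero.2 hq
  obtain ⟨k, hk, h⟩ := exists_isLeading q hq L
  obtain ⟨k', hk', h'⟩ := exists_isLeading (-q) hq' L
  cases a
  · exact ⟨k, hk, h.zero_mem⟩
  · exact ⟨k', hk', h'.zero_mem⟩
  · refine ⟨q * (k' * k), mul_ne_zero hq (mul_ne_zero hk' hk), ?_⟩
    set v := wordVec loopOp vac L
    have e : coeffOp (newSeries q .h) 0 v = q • phiCoeff q 0 (phiCoeff (-q) 0 v) := by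
      change q • coeffOp (phiAt q * phiAt (-q)) 0 v = _
      rw [coeffOp_mul (isXLinear_phiAt q)]
      simp
      rfl
    rw [e, show q • phiCoeff q 0 (phiCoeff (-q) 0 v) - (q * (k' * k)) • v
      = q • (phiCoeff q 0 (phiCoeff (-q) 0 v - k' • v) + k' • (phiCoeff q 0 v - k • v)) by
        rw [map_sub, map_smul]; module]
    exact Submodule.smul_mem _ _ (Submodule.add_mem _ (phiCoeff_mem_wtFil q hq 0 h'.zero_mem)
      (Submodule.smul_mem _ _ h.zero_mem))

/-- Higher powers of `x` in the series raise the index of the loop mode and so lower the weight. -/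
theorem newOp_sub_mem (q : ℂ) (hq : q ≠ 0) (a : Gen) (n : ℤ) {N : ℤ} {v : VL} (hv : v ∈ wtFil N) :
    newOp q a n v - loopOp a n (coeffOp (newSeries q a) 0 v) ∈ wtFil (N - n - 1) := by
  obtain ⟨K, hK⟩ := exists_bound (newSeries q a) v
  rw [newOp_apply, fieldMulHom_eq_sum a n _ (K + 1) fun i hi => hK i (by omega), sum_range_succ',
    Nat.cast_zero, add_zero]
  change (_ + loopOp a n (coeffOp (newSeries q a) 0 v)) - loopOp a n (coeffOp (newSeries q a) 0 v) ∈ _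
  rw [add_sub_cancel_right]
  exact Submodule.sum_mem _ fun i _ => loopOp_mem_wtFil a _ (by push_cast; omega)
    (coeffOp_newSeries_mem q hq a (i + 1) hv)

theorem newOp_mem_wtFil (q : ℂ) (hq : q ≠ 0) (a : Gen) (n : ℤ) {N : ℤ} {v : VL} (hv : v ∈ wtFil N) :
    newOp q a n v ∈ wtFil (N - n) := by
  rw [← sub_add_cancel (newOp q a n v) (loopOp a n (coeffOp (newSeries q a) 0 v))]
  exact Submodule.add_mem _ (wtFil_mono (by omega) (newOp_sub_mem q hq a n hv))
    (loopOp_mem_wtFil a n le_rfl (coeffOp_newSeries_mem q hq a 0 hv))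

/-- Triangularity: each letter contributes a nonzero scalar, and lower-weight errors remain of lower
weight under further letters. Both independence and generation on `V` rest on this. -/
theorem wordVec_newOp_sub_mem (q : ℂ) (hq : q ≠ 0) (L : List (Gen × ℤ)) : ∃ k : ℂ, k ≠ 0 ∧
    wordVec (newOp q) vac L - k • wordVec loopOp vac L ∈ wtFil (wordWt L - 1) := by
  induction L with
  | nil => exact ⟨1, one_ne_zero, by simp⟩
  | cons p L ih =>
    obtain ⟨k, hk, h⟩ := ih
    obtain ⟨k', hk', h'⟩ := coeffOp_newSeries_zero q hq p.1 L
    refine ⟨k * k', mul_ne_zero hk hk', ?_⟩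
    rw [wordVec_cons, wordVec_cons, wordWt_cons]
    have h1 := newOp_sub_mem q hq p.1 p.2 (wordVec_mem_wtFil L)
    set v := wordVec loopOp vac L
    set w := wordVec (newOp q) vac L
    have h2 := newOp_mem_wtFil q hq p.1 p.2 h
    have h3 := loopOp_mem_wtFil p.1 p.2 le_rfl h'
    rw [show newOp q p.1 p.2 w - (k * k') • loopOp p.1 p.2 v = newOp q p.1 p.2 (w - k • v)
      + k • ((newOp q p.1 p.2 v - loopOp p.1 p.2 (coeffOp (newSeries q p.1) 0 v))
        + loopOp p.1 p.2 (coeffOp (newSeries q p.1) 0 v - k' • v)) by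
      simp only [map_sub, map_smul]; module]
    rw [sub_right_comm] at h2 h3
    exact Submodule.add_mem _ h2 (Submodule.smul_mem _ _ (Submodule.add_mem _ h1 h3))

/-! ### Independence and generation for the new modes -/

/-- The normal monomials of the loop superalgebra as a basis of `V`. -/
noncomputable def loopBasis : Module.Basis {p : List ℕ × List ℕ × List ℕ // IsNormal p} ℂ VL :=
  Module.Basis.mk linearIndependent_loop_normal (by
    intro v _
    obtain ⟨N, hN⟩ := exists_mem_wtFil v
    refine Submodule.span_mono ?_ (isExchange_loopOp.wordFil_le _ _ hN)
    rintro _ ⟨p, h1, -, -, rfl⟩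
    exact ⟨⟨p, h1⟩, rfl⟩)

theorem loopBasis_apply (p : {p : List ℕ × List ℕ × List ℕ // IsNormal p}) :
    loopBasis p = wordVec loopOp vac (normalWord p.1) := Module.Basis.mk_apply _ _ _

theorem loopBasis_coord_eq_zero (p : {p : List ℕ × List ℕ × List ℕ // IsNormal p}) {N : ℤ}
    (hN : N < wordWt (normalWord p.1)) {v : VL} (hv : v ∈ wtFil N) : loopBasis.coord p v = 0 := by
  refine (?_ : wtFil N ≤ LinearMap.ker (loopBasis.coord p)) hv
  refine (isExchange_loopOp.wordFil_le N N).trans (Submodule.span_le.2 ?_)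
  rintro _ ⟨p', h1, -, h2, rfl⟩
  have := loopBasis_apply ⟨p', h1⟩
  rw [SetLike.mem_coe, LinearMap.mem_ker, ← this, Module.Basis.coord_apply,
    Module.Basis.repr_self_apply, if_neg]
  rintro rfl
  simp only at hN
  omega

theorem linearIndependent_newOp_normal (q : ℂ) (hq : q ≠ 0) : LinearIndependent ℂ
    fun p : {p : List ℕ × List ℕ × List ℕ // IsNormal p} =>
      wordVec (newOp q) vac (normalWord p.1) := by
  rw [linearIndependent_iff]
  intro g hg
  by_contra hne
  -- Take a monomial of maximal weight in the relation. Its loop coordinate sees none of the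
  -- lower-weight errors, and the leading terms of the other monomials are different basis vectors.
  obtain ⟨p, hp, hmax⟩ := Finset.exists_max_image g.support (fun p => wordWt (normalWord p.1))
    (Finsupp.support_nonempty_iff.2 hne)
  obtain ⟨k, hk, hmem⟩ := wordVec_newOp_sub_mem q hq (normalWord p.1)
  have h := congrArg (loopBasis.coord p) hg
  rw [Finsupp.linearCombination_apply, Finsupp.sum, map_sum, map_zero,
    Finset.sum_eq_single_of_mem p hp] at h
  · have h1 := loopBasis_coord_eq_zero p (by omega) hmem
    rw [map_sub, map_smul, ← loopBasis_apply, Module.Basis.coord_apply, Module.Basis.coord_apply,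
      Module.Basis.repr_self_apply, if_pos rfl, sub_eq_zero] at h1
    rw [map_smul, Module.Basis.coord_apply, h1] at h
    simp only [smul_eq_mul, mul_one, mul_eq_zero] at h
    exact h.elim (Finsupp.mem_support_iff.1 hp) hk
  · intro p' hp' hne'
    obtain ⟨k', -, hmem'⟩ := wordVec_newOp_sub_mem q hq (normalWord p'.1)
    have := hmax p' hp'
    have h1 := loopBasis_coord_eq_zero p (by omega) hmem'
    rw [map_sub, map_smul, ← loopBasis_apply, Module.Basis.coord_apply, Module.Basis.coord_apply,
      Module.Basis.repr_self_apply, if_neg hne', smul_zero, sub_zero] at h1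
    rw [map_smul, Module.Basis.coord_apply, h1, smul_zero]

/-- Induction on the weight: a loop word is a nonzero multiple of the new word up to smaller weight.
-/
theorem wtFil_le_of_wordVec_newOp (q : ℂ) (hq : q ≠ 0) (R : Submodule ℂ VL)
    (hR : ∀ L, wordVec (newOp q) vac L ∈ R) (k : ℕ) : ∀ N : ℤ, N < k → wtFil N ≤ R := by
  induction k with
  | zero =>
    intro N hN
    rw [wtFil, wordFil_neg (by exact_mod_cast hN)]
    exact bot_le
  | succ k ih =>
    intro N hN
    refine Submodule.span_le.2 ?_
    rintro _ ⟨L, -, -, h3, rfl⟩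
    obtain ⟨c, hc, h⟩ := wordVec_newOp_sub_mem q hq L
    have h1 := Submodule.sub_mem _ (hR L) (ih (wordWt L - 1) (by push_cast at hN; omega) h)
    rw [sub_sub_cancel] at h1
    exact (Submodule.smul_mem_iff _ hc).1 h1

theorem mem_of_wordVec_newOp (q : ℂ) (hq : q ≠ 0) (R : Submodule ℂ VL)
    (hR : ∀ L, wordVec (newOp q) vac L ∈ R) (v : VL) : v ∈ R := by
  obtain ⟨N, hN⟩ := exists_mem_wtFil v
  exact wtFil_le_of_wordVec_newOp q hq R hR (N + 1) N (by push_cast; omega) hN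

/-! ### Normal bases of the filtration by length -/

theorem tensor_induction {C : Tensor → Prop} (h1 : C 1) (ha : ∀ x y, C x → C y → C (x + y))
    (hs : ∀ (r : ℂ) x, C x → C (r • x)) (hg : ∀ a n x, C x → C (tgen a n * x)) (x : Tensor) : C x := by
  have key : ∀ x : Tensor, ∀ y, C y → C (x * y) := by
    intro x
    induction x using FreeAlgebra.induction with
    | grade0 r => intro y hy; rw [← Algebra.smul_def]; exact hs r y hy
    | grade1 p => intro y hy; exact hg p.1 p.2 y hy
    | mul x y hx hy => intro z hz; rw [mul_assoc]; exact hx _ (hy _ hz)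
    | add x y hx hy => intro z hz; rw [add_mul]; exact ha _ _ (hx _ hz) (hy _ hz)
  have := key x 1 h1
  rwa [mul_one] at this

section Modules

variable {W : Type*} [AddCommGroup W] [Module ℂ W] {ρ : Tensor →ₐ[ℂ] Module.End ℂ W} {w₀ : W}

theorem rep_prod_eq_wordVec (ρ : Tensor →ₐ[ℂ] Module.End ℂ W) (w₀ : W) (L : List (Gen × ℤ)) :
    ρ ((L.map fun p => tgen p.1 p.2).prod) w₀ = wordVec (fun a n => ρ (tgen a n)) w₀ L := by
  induction L with
  | nil => simp
  | cons p L ih => rw [List.map_cons, List.prod_cons, map_mul, Module.End.mul_apply, ih, wordVec_cons]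

theorem normalVector_eq_wordVec (ρ : Tensor →ₐ[ℂ] Module.End ℂ W) (w₀ : W)
    (p : List ℕ × List ℕ × List ℕ) :
    normalVector ρ w₀ p = wordVec (fun a n => ρ (tgen a n)) w₀ (normalWord p) := by
  rw [← rep_prod_eq_wordVec, normalVector, normalWord, List.map_append, List.map_append,
    List.prod_append, List.prod_append, mul_assoc]
  simp only [bind_pure_comp, List.map_eq_map, List.map_map]
  rfl

theorem isIncreasingFiltration_of_generates (h : ∀ w : W, ∃ x : Tensor, ρ x w₀ = w) :
    IsIncreasingFiltration (wordSpan ρ w₀) := by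
  have hmono : Monotone (wordSpan ρ w₀) := by
    intro m n hmn
    refine Submodule.span_mono ?_
    rintro _ ⟨L, hL, rfl⟩
    exact ⟨L, hL.trans hmn, rfl⟩
  refine ⟨hmono, (Submodule.eq_top_iff'.2 fun w => ?_)⟩
  obtain ⟨x, rfl⟩ := h w
  induction x using tensor_induction with
  | h1 => exact Submodule.mem_iSup_of_mem 0 (Submodule.subset_span ⟨[], by simp, by simp⟩)
  | ha x y hx hy =>
    rw [map_add]
    exact Submodule.add_mem _ hx hy
  | hs r x hx =>
    rw [map_smul]
    exact Submodule.smul_mem _ _ hx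
  | hg a n x hx =>
    rw [map_mul, Module.End.mul_apply]
    refine (iSup_le fun k => Submodule.span_le.2 ?_ :
      ⨆ k, wordSpan ρ w₀ k ≤ (⨆ k, wordSpan ρ w₀ k).comap (ρ (tgen a n))) hx
    rintro _ ⟨L, hL, rfl⟩
    refine Submodule.mem_iSup_of_mem (k + 1) (Submodule.subset_span ⟨(a, n) :: L, by simpa using hL, ?_⟩)
    rw [List.map_cons, List.prod_cons, map_mul, Module.End.mul_apply]

/-- The sorting procedure never increases the length, so words with at most `n` letters reduce to
normal monomials with at most `n` letters. -/
theorem hasNormalBasis_of_linearIndependent {ε : Gen → Gen → ℂ}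
    (h : IsExchange (fun a n => ρ (tgen a n)) w₀ ε)
    (hli : LinearIndependent ℂ fun p : {p : List ℕ × List ℕ × List ℕ // IsNormal p} =>
      wordVec (fun a n => ρ (tgen a n)) w₀ (normalWord p.1)) : HasNormalBasis ρ w₀ := by
  intro n
  have hli' : LinearIndependent ℂ fun p : normalIndex n => normalVector ρ w₀ p.1 := by
    have := hli.comp (fun p : normalIndex n =>
      (⟨p.1, (mem_normalIndex.1 p.2).1⟩ : {p : List ℕ × List ℕ × List ℕ // IsNormal p}))
      fun p p' hp => Subtype.ext (congrArg (fun x => x.1) hp)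
    convert this using 2 with p
    exact normalVector_eq_wordVec ρ w₀ p.1
  have hspan : Submodule.span ℂ (Set.range fun p : normalIndex n => normalVector ρ w₀ p.1)
      = wordSpan ρ w₀ n := by
    refine le_antisymm (Submodule.span_mono ?_) (Submodule.span_le.2 ?_)
    · rintro _ ⟨p, rfl⟩
      exact ⟨normalWord p.1, (mem_normalIndex.1 p.2).2, by
        rw [rep_prod_eq_wordVec]; exact normalVector_eq_wordVec ρ w₀ p.1⟩
    · rintro _ ⟨L, hL, rfl⟩
      rw [rep_prod_eq_wordVec]
      refine Submodule.span_mono ?_ (h.wordFil_le _ _ (h.wordVec_mem L))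
      rintro _ ⟨p, h1, h2, -, rfl⟩
      exact ⟨⟨p, mem_normalIndex.2 ⟨h1, by omega⟩⟩, normalVector_eq_wordVec ρ w₀ p⟩
  refine ⟨(Module.Basis.span hli').map (LinearEquiv.ofEq _ _ hspan), fun p => ?_⟩
  rw [Module.Basis.map_apply, LinearEquiv.coe_ofEq_apply, Module.Basis.span_apply]

/-- Truncation makes the sum in the relation finite, which is needed for a linear map to pass
through `finsum`. -/
theorem map_relDefect {W' : Type*} [AddCommGroup W'] [Module ℂ W'] {ρ' : Tensor →ₐ[ℂ] Module.End ℂ W'}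
    (g : W →ₗ[ℂ] W') (hg : ∀ x v, g (ρ x v) = ρ' x (g v))
    (ht : ∀ w : W, ∃ N : ℤ, ∀ n, N ≤ n → ∀ a : Gen, ρ (tgen a n) w = 0)
    (q : ℂ) (r : DYRel) (m n : ℤ) (w : W) :
    g (relDefect q ρ r m n w) = relDefect q ρ' r m n (g w) := by
  have hfin := isSummable_of_trunc ht r.fst r.snd w m n
  have hs := g.toAddMonoidHom.map_finsum (f := fun d : Fin 2 →₀ ℕ => MvPowerSeries.coeff d (r.series q) •
    ρ (tgen r.snd (n + d 1)) (ρ (tgen r.fst (m + d 0)) w)) (hfin.subset fun d hd hc => hd (by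
      exact (congrArg _ hc).trans (smul_zero _)))
  have hs' : g (∑ᶠ d : Fin 2 →₀ ℕ, MvPowerSeries.coeff d (r.series q) •
      ρ (tgen r.snd (n + d 1)) (ρ (tgen r.fst (m + d 0)) w))
      = ∑ᶠ d : Fin 2 →₀ ℕ, MvPowerSeries.coeff d (r.series q) •
        ρ' (tgen r.snd (n + d 1)) (ρ' (tgen r.fst (m + d 0)) (g w)) := by
    refine hs.trans (finsum_congr fun d => ?_)
    change g (_ • _) = _
    rw [map_smul, hg, hg]
  rw [relDefect, map_sub, map_sub, hs', map_smul, hg, hg, hg, relDefect]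

end Modules

/-! ### The module `V` -/

theorem isVacuumModule_newRep (q : ℂ) (hq : q ≠ 0) : IsVacuumModule q (newRep q) vac where
  toIsDYModule := isDYModule_newRep q hq
  vacuum a n hn := by rw [newRep_tgen, newOp_vac q a n hn]
  generates w := by
    refine mem_of_wordVec_newOp q hq
      (LinearMap.range (LinearMap.applyₗ vac ∘ₗ (newRep q).toLinearMap)) (fun L => ?_) w
    refine ⟨(L.map fun p => tgen p.1 p.2).prod, (rep_prod_eq_wordVec _ _ _).trans ?_⟩
    simp only [newRep_tgen]

theorem isExchange_newRep (q : ℂ) (hq : q ≠ 0) :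
    IsExchange (fun a n => newRep q (tgen a n)) vac dySign :=
  (isDYModule_newRep q hq).isExchange hq vac (isVacuumModule_newRep q hq).vacuum

theorem linearIndependent_newRep_normal (q : ℂ) (hq : q ≠ 0) : LinearIndependent ℂ
    fun p : {p : List ℕ × List ℕ × List ℕ // IsNormal p} =>
      wordVec (fun a n => newRep q (tgen a n)) vac (normalWord p.1) := by
  simpa only [newRep_tgen] using linearIndependent_newOp_normal q hq

/-! ### The universal vacuum module -/

theorem tensor_mem_span_words (x : Tensor) : x ∈ Submodule.span ℂ
    {x | ∃ L : List (Gen × ℤ), x = (L.map fun p => tgen p.1 p.2).prod} := by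
  induction x using tensor_induction with
  | h1 => exact Submodule.subset_span ⟨[], rfl⟩
  | ha x y hx hy => exact Submodule.add_mem _ hx hy
  | hs r x hx => exact Submodule.smul_mem _ _ hx
  | hg a n x hx =>
    refine (Submodule.span_le.2 ?_ : _ ≤ (Submodule.span ℂ _).comap
      (LinearMap.mulLeft ℂ (tgen a n))) hx
    rintro _ ⟨L, rfl⟩
    exact Submodule.subset_span ⟨(a, n) :: L, by simp⟩

theorem mem_vacIdeal_of_tensorDeg {n : ℤ} (hn : 1 ≤ n) {x : Tensor} (hx : x ∈ tensorDeg n) :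
    x ∈ vacIdeal := Submodule.subset_span ⟨0, n, x, hn, hx, rfl⟩

/-- For large `n` the element `a(n)x` has only components of positive degree, which lie in `J`. -/
theorem TJ_trunc (w : TJ) : ∃ N : ℤ, ∀ n, N ≤ n → ∀ a : Gen,
    (Algebra.lsmul ℂ ℂ TJ : Tensor →ₐ[ℂ] Module.End ℂ TJ) (tgen a n) w = 0 := by
  obtain ⟨x, rfl⟩ : ∃ x, TJ.mk x = w := vacIdeal.mkQ_surjective w
  have h : ∃ N : ℤ, ∀ n, N ≤ n → ∀ a : Gen, tgen a n * x ∈ vacIdeal := by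
    induction tensor_mem_span_words x using Submodule.span_induction with
    | mem x hx =>
      obtain ⟨L, rfl⟩ := hx
      refine ⟨1 - (L.map Prod.snd).sum, fun n hn a => ?_⟩
      exact mem_vacIdeal_of_tensorDeg (n := n + (L.map Prod.snd).sum) (by omega)
        (Submodule.subset_span ⟨(a, n) :: L, by simp, by simp⟩)
    | zero => exact ⟨0, fun n _ a => by rw [mul_zero]; exact Submodule.zero_mem _⟩
    | add x y _ _ hx hy =>
      obtain ⟨N, hN⟩ := hx
      obtain ⟨M, hM⟩ := hy
      exact ⟨max N M, fun n hn a => by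
        rw [mul_add]; exact Submodule.add_mem _ (hN n (by omega) a) (hM n (by omega) a)⟩
    | smul r x _ hx =>
      obtain ⟨N, hN⟩ := hx
      exact ⟨N, fun n hn a => by
        rw [mul_smul_comm]; exact Submodule.smul_of_tower_mem _ r (hN n hn a)⟩
  obtain ⟨N, hN⟩ := h
  refine ⟨N, fun n hn a => ?_⟩
  change tgen a n • TJ.mk x = 0
  rw [← map_smul, smul_eq_mul]
  exact (Submodule.Quotient.mk_eq_zero _).2 (hN n hn a)

theorem Vq.mk_surjective (q : ℂ) : Function.Surjective (Vq.mk q) := (relSubmodule q).mkQ_surjective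

theorem isDYModule_vqRep (q : ℂ) : IsDYModule q (vqRep q) where
  trunc w := by
    obtain ⟨w, rfl⟩ := Vq.mk_surjective q w
    obtain ⟨N, hN⟩ := TJ_trunc w
    refine ⟨N, fun n hn a => ?_⟩
    change tgen a n • Vq.mk q w = 0
    rw [← map_smul]
    exact (congrArg (Vq.mk q) (hN n hn a)).trans (map_zero _)
  rel r m n w := by
    obtain ⟨w, rfl⟩ := Vq.mk_surjective q w
    have := map_relDefect (ρ' := vqRep q) ((Vq.mk q).restrictScalars ℂ)
      (fun x v => (Vq.mk q).map_smul x v) TJ_trunc q r m n w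
    refine this.symm.trans ((Submodule.Quotient.mk_eq_zero _).2 ?_)
    exact Submodule.subset_span ⟨r, m, n, w, rfl⟩

theorem isVacuumModule_vqRep (q : ℂ) : IsVacuumModule q (vqRep q) (vqVac q) where
  toIsDYModule := isDYModule_vqRep q
  vacuum a n hn := by
    have h : tgen a n ∈ vacIdeal := by
      rcases hn.lt_or_eq with h | rfl
      · exact mem_vacIdeal_of_tensorDeg (n := n) h (Submodule.subset_span ⟨[(a, n)], by simp, by simp⟩)
      -- The mode `a(0)` has degree zero but equals `-d(a(1))`, which is why `J` contains `ℂ[d]T₊`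
      -- and not only `T₊`.
      · have h1 : tensorD (tgen a 1) ∈ vacIdeal := Submodule.subset_span ⟨1, 1, tgen a 1, le_rfl,
          Submodule.subset_span ⟨[(a, 1)], by simp, by simp⟩, rfl⟩
        rw [tensorD_tgen] at h1
        simpa using h1
    change tgen a n • Vq.mk q (TJ.mk 1) = 0
    rw [← map_smul, ← map_smul, smul_eq_mul, mul_one]
    have : TJ.mk (tgen a n) = 0 := (Submodule.Quotient.mk_eq_zero _).2 h
    rw [this, map_zero]
  generates w := by
    obtain ⟨w, rfl⟩ := Vq.mk_surjective q w
    obtain ⟨x, rfl⟩ : ∃ x, TJ.mk x = w := vacIdeal.mkQ_surjective w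
    refine ⟨x, ?_⟩
    change x • Vq.mk q (TJ.mk 1) = _
    rw [← map_smul, ← map_smul, smul_eq_mul, mul_one]

/-- Since `𝒟` kills the vacuum, the commutator with `𝒟` reduces to applying `𝒟`. -/
theorem newRep_tensorD_vac (q : ℂ) (k : ℕ) (x : Tensor) :
    newRep q ((tensorD ^ k) x) vac = (transOp ^ k) (newRep q x vac) := by
  induction k with
  | zero => rfl
  | succ k ih =>
    rw [pow_succ', Module.End.mul_apply, ← transOp_newRep, LinearMap.sub_apply, Module.End.mul_apply,
      Module.End.mul_apply, transOp_vac, map_zero, sub_zero, ih, pow_succ', Module.End.mul_apply]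

/-- Positive degree is negative weight, and words of negative weight vanish on the vacuum by the
exchange relations. -/
theorem newRep_vac_eq_zero (q : ℂ) (hq : q ≠ 0) {n : ℤ} {x : Tensor} (hx : x ∈ tensorDeg n) (hn : 1 ≤ n) :
    newRep q x vac = 0 := by
  refine (Submodule.span_le.2 ?_ : tensorDeg n ≤
    LinearMap.ker (LinearMap.applyₗ vac ∘ₗ (newRep q).toLinearMap)) hx
  rintro _ ⟨L, hL, rfl⟩
  refine (rep_prod_eq_wordVec (newRep q) vac L).trans ?_
  exact (isExchange_newRep q hq).wordVec_eq_zero (by rw [wordWt, hL]; omega)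

/-- The action on the vacuum vector of `V`. -/
noncomputable def actVac (q : ℂ) : Tensor →ₛₗ[(newRep q : Tensor →+* Module.End ℂ VL)] VL where
  toFun x := newRep q x vac
  map_add' x y := by simp
  map_smul' x y := by simp

/-- The homomorphism `T / J → V`. -/
noncomputable def ofTJ (q : ℂ) (hq : q ≠ 0) : TJ →ₛₗ[(newRep q : Tensor →+* Module.End ℂ VL)] VL :=
  vacIdeal.liftQ (actVac q) (Submodule.span_le.2 (by
    rintro _ ⟨k, n, x, hn, hx, rfl⟩
    change newRep q ((tensorD ^ k) x) vac = 0
    rw [newRep_tensorD_vac, newRep_vac_eq_zero q hq hx hn, map_zero]))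

theorem ofTJ_smul (q : ℂ) (hq : q ≠ 0) (x : Tensor) (v : TJ) :
    ofTJ q hq (x • v) = newRep q x (ofTJ q hq v) := (ofTJ q hq).map_smulₛₗ x v

/-- The homomorphism `T / J → V` as a linear map. -/
noncomputable def ofTJLin (q : ℂ) (hq : q ≠ 0) : TJ →ₗ[ℂ] VL where
  toFun := ofTJ q hq
  map_add' := (ofTJ q hq).map_add
  map_smul' r v := by
    have h := ofTJ_smul q hq (algebraMap ℂ Tensor r) v
    rw [algebraMap_smul] at h
    rw [h, AlgHom.commutes]
    simp

/-- The homomorphism `V_q → V`. -/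
noncomputable def ofVq (q : ℂ) (hq : q ≠ 0) :
    Vq q →ₛₗ[(newRep q : Tensor →+* Module.End ℂ VL)] VL :=
  (relSubmodule q).liftQ (ofTJ q hq) (Submodule.span_le.2 (by
    rintro _ ⟨r, m, n, w, rfl⟩
    exact (map_relDefect (ρ' := newRep q) (ofTJLin q hq) (ofTJ_smul q hq) TJ_trunc q r m n w).trans
      ((isDYModule_newRep q hq).rel r m n _)))

theorem ofVq_smul (q : ℂ) (hq : q ≠ 0) (x : Tensor) (v : Vq q) :
    ofVq q hq (x • v) = newRep q x (ofVq q hq v) := (ofVq q hq).map_smulₛₗ x v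

theorem ofVq_vac (q : ℂ) (hq : q ≠ 0) : ofVq q hq (vqVac q) = vac := by
  change newRep q 1 vac = vac
  rw [map_one, Module.End.one_apply]

/-- The homomorphism `V_q → V` as a linear map. -/
noncomputable def ofVqLin (q : ℂ) (hq : q ≠ 0) : Vq q →ₗ[ℂ] VL where
  toFun := ofVq q hq
  map_add' := (ofVq q hq).map_add
  map_smul' r v := by
    have h := ofVq_smul q hq (algebraMap ℂ Tensor r) v
    rw [algebraMap_smul] at h
    rw [h, AlgHom.commutes]
    simp

theorem ofVq_wordVec (q : ℂ) (hq : q ≠ 0) (L : List (Gen × ℤ)) :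
    ofVq q hq (wordVec (fun a n => vqRep q (tgen a n)) (vqVac q) L)
      = wordVec (fun a n => newRep q (tgen a n)) vac L := by
  rw [← rep_prod_eq_wordVec, ← rep_prod_eq_wordVec]
  exact (ofVq_smul q hq _ _).trans (by rw [ofVq_vac])

/-- The homomorphism to `V` carries normal monomials to normal monomials, and a linear map reflects
independence of a family. -/
theorem linearIndependent_vqRep_normal (q : ℂ) (hq : q ≠ 0) : LinearIndependent ℂ
    fun p : {p : List ℕ × List ℕ × List ℕ // IsNormal p} =>
      wordVec (fun a n => vqRep q (tgen a n)) (vqVac q) (normalWord p.1) := by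
  refine LinearIndependent.of_comp (ofVqLin q hq) ?_
  convert linearIndependent_newRep_normal q hq using 1
  exact funext fun p => ofVq_wordVec q hq _

end DoubleYangian

open DoubleYangian
theorem proposition2p10 (q : ℂ) (hq : q ≠ 0) :
    (∃! Φ : VL →ₗ[ℂ] (ℕ →₀ VL), IsPhi Φ) ∧
    (∀ Φ : VL →ₗ[ℂ] (ℕ →₀ VL), IsPhi Φ →
      (∃! ρ : Tensor →ₐ[ℂ] Module.End ℂ VL, IsAssignment q Φ ρ) ∧
      ∀ ρ : Tensor →ₐ[ℂ] Module.End ℂ VL, IsAssignment q Φ ρ →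
        IsVacuumModule q ρ vac ∧
        (∀ (a : Gen) (n : ℤ), transOp * ρ (tgen a n) - ρ (tgen a n) * transOp
          = (-(n : ℂ)) • ρ (tgen a (n - 1))) ∧
        IsIncreasingFiltration (wordSpan ρ vac) ∧
        HasNormalBasis ρ vac) ∧
    IsVacuumModule q (vqRep q) (vqVac q) ∧
    IsIncreasingFiltration (wordSpan (vqRep q) (vqVac q)) ∧
    HasNormalBasis (vqRep q) (vqVac q) := by
  have hV := isVacuumModule_newRep q hq
  have hU := isVacuumModule_vqRep q
  refine ⟨⟨phi, isPhi_phi, fun Φ h => h.eq_phi⟩, fun Φ hΦ => ?_, hU,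
    isIncreasingFiltration_of_generates hU.generates,
    hasNormalBasis_of_linearIndependent (hU.toIsDYModule.isExchange hq _ hU.vacuum)
      (linearIndependent_vqRep_normal q hq)⟩
  obtain rfl := hΦ.eq_phi
  refine ⟨⟨newRep q, isAssignment_newRep q, fun ρ h => h.eq_newRep⟩, fun ρ hρ => ?_⟩
  obtain rfl := hρ.eq_newRep
  exact ⟨hV, transOp_newRep_tgen q, isIncreasingFiltration_of_generates hV.generates,
    hasNormalBasis_of_linearIndependent (isExchange_newRep q hq)
      (linearIndependent_newRep_normal q hq)⟩
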